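/- Conventions: sums over repeated indices; $i,j,k,\dots\in\{1,2,3\}$ are fuzzy sphere indices, $\mu,\nu,\alpha,\dots\in\{1,\dots,n\}$ are spacetime indices; $\epsilon_{ijk}$ is the totally antisymmetric symbol with $\epsilon_{123}=1$; Ricci scalars carry $-\tfrac12$ of their usual normalisation. Let $M$ be a spacetime with coordinates $x^\mu$ (an open set of $\mathbb R^n$) and let $\lambda$ be real with $\lambda\neq0$, $\lambda^2\ne 1$. Let $\mathbb C_\lambda[S^2]$ be the unital algebra over $\mathbb C$ with generators $y^i$ and relations $[y^i,y^j]=2\imath\lambda\epsilon_{ijk}y^k$, $\sum_i (y^i)^2=1-\lambda^2$. Its calculus has a central basis of 1-forms $s^i$, with $\mathrm d f=(\partial_i f)s^i$, $\partial_i=\frac1{2\imath\lambda}[y^i,\ ]$, $\mathrm d s^i=-\frac12\epsilon_{ijk}s^j\wedge s^k$, $s^i\wedge s^j=-s^j\wedge s^i$. Give $C^\infty(M)\otimes\mathbb C_\lambda[S^2]$ the graded tensor product calculus, where $C^\infty(M)$ consists of complex-valued functions; it has the central basis $\{\mathrm d x^\mu,s^i\}$ of 1-forms. Let $$\mathfrak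 g=g_{\mu\nu}\,\mathrm d x^\mu\otimes\mathrm d x^\nu+A_{\mu i}(\mathrm d x^\mu\otimes s^i+s^i\otimes\mathrm d x^\mu)+h_{ij}\,s^i\otimes s^j$$ be a quantum metric, with inverse bimodule map $(\ ,\ )$, where $g_{\mu\nu},A_{\mu i},h_{ij}$ are smooth real functions on $M$, $g$ is symmetric and $h$ is symmetric and positive definite. A quantum Levi-Civita connection (QLC) is a bimodule connection $\nabla$ on 1-forms, with generalised braiding $\sigma$, that is torsion free, $\wedge\nabla=\mathrm d$, and satisfies $\nabla\mathfrak g=0$. It is required that $\sigma(s^i\otimes s^j)=s^j\otimes s^i$ and $\sigma(\mathrm d x^\mu\otimes s^i)=s^i\otimes\mathrm d x^\mu$. The Ricci scalar is $R=(\ ,\ )\,\mathrm{Ricci}$ with $$\mathrm{Ricci}=((\ ,\ )\otimes\mathrm{id})(\mathrm{id}\otimes i\otimes\mathrm{id})(\mathrm{id}\otimes R_\nabla)\mathfrak g,\qquad R_\nabla=(\mathrm d\otimes\mathrm{id}-\mathrm{id}\wedge\nabla)\nabla,$$ where $i$ is the antisymmetric lift, $i(e\wedge e')=\frac12(e\otimes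 e'-e'\otimes e)$ on basic 1-forms $e,e'\in\{\mathrm d x^\mu,s^i\}$. Let $h^{ij}$ be the inverse matrix of $h_{ij}$, let $\tilde g_{\mu\nu}=g_{\mu\nu}-h^{ij}A_{\mu i}A_{\nu j}$ with inverse matrix $\tilde g^{\mu\nu}$ and Levi-Civita connection $\tilde\nabla$, and let $$\tilde R_M=\tfrac12\tilde g^{\alpha\beta}\big(-\partial_\mu\tilde\Gamma^\mu_{\alpha\beta}+\partial_\alpha\tilde\Gamma^\mu_{\mu\beta}+\tilde\Gamma^\mu_{\alpha\nu}\tilde\Gamma^\nu_{\mu\beta}-\tilde\Gamma^\mu_{\mu\nu}\tilde\Gamma^\nu_{\alpha\beta}\big)$$ be its Ricci scalar. Put $\tilde A_{\alpha i}=h^{ij}A_{\alpha j}$, with $su_2$ curvature $$\tilde F^i_{\alpha\beta}=\partial_\alpha\tilde A_{\beta i}-\partial_\beta\tilde A_{\alpha i}-\epsilon_{ijk}\tilde A_{\alpha j}\tilde A_{\beta k},\qquad \tilde F^{i\mu\nu}=\tilde g^{\mu\alpha}\tilde g^{\nu\beta}\tilde F^i_{\alpha\beta}.$$ Put also $$\tilde\nabla_{A\alpha}h_{ij}=\partial_\alpha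 h_{ij}-\tilde A_{\alpha k}(h_{li}\epsilon_{jkl}+h_{lj}\epsilon_{ikl}),\qquad \Phi=\ln h,\qquad (\Phi_\alpha)^i{}_j=h^{ik}\tilde\nabla_{A\alpha}h_{kj}.$$ Then the product has a unique QLC with the stated braiding, and its Ricci scalar is the function on $M$ $$R=\tilde R_M+R_h+\frac18h_{ij}\tilde F^i_{\mu\nu}\tilde F^{j\mu\nu}+\frac12\tilde g^{\alpha\beta}\tilde\nabla_\alpha\mathrm{Tr}(\Phi_\beta)+\frac18\tilde g^{\alpha\beta}\big(\mathrm{Tr}(\Phi_\alpha\Phi_\beta)+\mathrm{Tr}(\Phi_\alpha)\mathrm{Tr}(\Phi_\beta)\big),$$ where $\mathrm{Tr}(\Phi_\alpha)=\partial_\alpha\mathrm{Tr}(\Phi)$ and $$R_h=\frac{e^{-\mathrm{Tr}(\Phi)}}2\Big(\mathrm{Tr}(e^{2\Phi})-\frac12\mathrm{Tr}(e^\Phi)^2\Big).$$ Moreover, for each $x\in M$, $R_h(x)$ is the Ricci scalar of the fuzzy sphere with the quantum metric $h_{ij}(x)s^i\otimes s^j$ and its unique QLC whose braiding is the flip on the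 basis, $\sigma(s^i\otimes s^j)=s^j\otimes s^i$. -/

import Mathlib

open scoped TensorProduct ContDiff

noncomputable section

namespace FuzzyKK

/-! ## Quantum Riemannian geometry over an algebra whose 1-forms have a central basis -/

/-- The data, up to degree two, of a differential calculus on a unital algebra `B` over `ℂ` for which
`Ω¹` is freely generated by finitely many 1-forms `e^a` commuting with `B`, with anticommuting
products `e^a ∧ e^b = - e^b ∧ e^a`. The exterior derivative is
`d f = ∑ (∂_a f) e^a` on `B` and `d e^a = ½ ∑ c^a_{bc} e^b ∧ e^c` on the basis. -/
structure FramedCalculus (I B : Type) [Fintype I] [Ring B] [Algebra ℂ B] where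
  /-- the partial derivatives `∂_a` -/
  pd : I → B →ₗ[ℂ] B
  /-- the coefficients, `c a b c` standing for `c^a_{bc}` -/
  c : I → I → I → ℂ
  pd_mul : ∀ a x y, pd a (x * y) = pd a x * y + x * pd a y
  c_antisymm : ∀ a b b', c a b b' = - c a b' b
  /-- `d² = 0` on `B` -/
  dd : ∀ a b x, pd a (pd b x) - pd b (pd a x) + ∑ k, c k a b • pd k x = 0

/-- `Ω¹`: the array `w` stands for `∑ w_a e^a = ∑ e^a w_a`. -/
abbrev T1 (I B : Type) := I → B
/-- `Ω¹ ⊗_B Ω¹`: the array `T` stands for `∑ T_{ab} e^a ⊗ e^b`. -/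
abbrev T2 (I B : Type) := I → I → B
/-- `Ω¹ ⊗_B Ω¹ ⊗_B Ω¹`: the array `T` stands for `∑ T_{abc} e^a ⊗ e^b ⊗ e^c`. -/
abbrev T3 (I B : Type) := I → I → I → B

section General

variable {I B : Type} [Fintype I] [DecidableEq I] [Ring B] [Algebra ℂ B]

/-- The basic 1-form `e^a`. -/
def basis (a : I) : T1 I B := Pi.single a 1

/-- The product `w ⊗ η`. -/
def tens (w η : T1 I B) : T2 I B := fun a b => w a * η b

/-- The wedge product `Ω¹ ⊗_B Ω¹ → Ω²`. A 2-form `½ ∑ w_{ab} e^a ∧ e^b` is recorded by its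
antisymmetric array of components `w_{ab}`. -/
def wedge (T : T2 I B) : T2 I B := fun a b => T a b - T b a

/-- The antisymmetric lift `Ω² → Ω¹ ⊗_B Ω¹`, `e^a ∧ e^b ↦ ½ (e^a ⊗ e^b - e^b ⊗ e^a)`, in terms of
the antisymmetric array of components of a 2-form. -/
def lift (w : T2 I B) : T2 I B := fun a b => (1 / 2 : ℂ) • w a b

/-- `d : B → Ω¹`. -/
def d0 (C : FramedCalculus I B) (f : B) : T1 I B := fun a => C.pd a f

/-- `d : Ω¹ → Ω²`, `d (w_a e^a) = d w_a ∧ e^a + w_a d e^a`. -/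
def d1 (C : FramedCalculus I B) (w : T1 I B) : T2 I B := fun a b =>
  C.pd a (w b) - C.pd b (w a) + ∑ k, C.c k a b • w k

/-- A left bimodule connection on `Ω¹`, with its generalised braiding `σ`. The action of `f : B` from
the right is written `MulOpposite.op f • w`. -/
@[ext]
structure BimoduleConnection (C : FramedCalculus I B) where
  nabla : T1 I B →+ T2 I B
  sigma : T2 I B →+ T2 I B
  sigma_left : ∀ (f : B) (T : T2 I B), sigma (f • T) = f • sigma T
  sigma_right : ∀ (f : B) (T : T2 I B),
    sigma (MulOpposite.op f • T) = MulOpposite.op f • sigma T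
  leibniz_left : ∀ (f : B) (w : T1 I B), nabla (f • w) = f • nabla w + tens (d0 C f) w
  leibniz_right : ∀ (f : B) (w : T1 I B),
    nabla (MulOpposite.op f • w) = MulOpposite.op f • nabla w + sigma (tens w (d0 C f))

/-- A bimodule map `( , ) : Ω¹ ⊗_B Ω¹ → B`. -/
structure BimodulePairing (I B : Type) [Fintype I] [Ring B] where
  ev : T2 I B →+ B
  ev_left : ∀ (f : B) (T : T2 I B), ev (f • T) = f * ev T
  ev_right : ∀ (f : B) (T : T2 I B), ev (MulOpposite.op f • T) = ev T * f

/-- `( , )` is inverse to the metric `G`: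
`((w, ) ⊗ id) G = w = (id ⊗ ( , w)) G` for every 1-form `w`. -/
def IsInverseMetric (G : T2 I B) (P : BimodulePairing I B) : Prop :=
  ∀ w : T1 I B,
    (∀ b, P.ev (tens w (fun a => G a b)) = w b) ∧
    (∀ a, P.ev (tens (fun b => G a b) w) = w a)

/-- `∇ T = (∇ ⊗ id + (σ ⊗ id)(id ⊗ ∇)) T` for `T = ∑ T_{·b} ⊗ e^b` in `Ω¹ ⊗_B Ω¹`. -/
def nabla2 {C : FramedCalculus I B} (D : BimoduleConnection C) (T : T2 I B) : T3 I B :=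
  fun a b k =>
    D.nabla (fun a' => T a' k) a b
      + D.sigma (fun a' b' => ∑ l, T a' l * D.nabla (basis l) b' k) a b

/-- Vanishing torsion `∧ ∇ = d`. -/
def TorsionFree {C : FramedCalculus I B} (D : BimoduleConnection C) : Prop :=
  ∀ w, wedge (D.nabla w) = d1 C w

/-- Quantum Levi-Civita connections: torsion free and metric compatible. -/
def IsQLC {C : FramedCalculus I B} (G : T2 I B) (D : BimoduleConnection C) : Prop :=
  TorsionFree D ∧ nabla2 D G = 0

/-- `σ` flips `e^a ⊗ e^b` for every `a` and every `b` in the set `S`. -/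
def FlipsOn {C : FramedCalculus I B} (S : Set I) (D : BimoduleConnection C) : Prop :=
  ∀ a, ∀ b ∈ S, D.sigma (tens (basis a) (basis b)) = tens (basis b) (basis a)

/-- The curvature `R_∇ w = (d ⊗ id - id ∧ ∇) ∇ w` in `Ω² ⊗_B Ω¹`. With `∇ w = ∑ X_{·k} ⊗ e^k` this is
`∑ d X_{·k} ⊗ e^k - ∑ X_{·k} ∧ ∇ e^k`. -/
def curvature {C : FramedCalculus I B} (D : BimoduleConnection C) (w : T1 I B) : T3 I B :=
  fun a b k =>
    d1 C (fun a' => D.nabla w a' k) a b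
      - ∑ l, wedge (tens (fun a' => D.nabla w a' l) (fun b' => D.nabla (basis l) b' k)) a b

/-- `Ricci = (( , ) ⊗ id)(id ⊗ i ⊗ id)(id ⊗ R_∇) G`, where `i` is the antisymmetric lift and
`(id ⊗ R_∇) G = ∑ G_{al} e^a ⊗ R_∇ e^l`. -/
def ricci {C : FramedCalculus I B} (D : BimoduleConnection C) (G : T2 I B)
    (P : BimodulePairing I B) : T2 I B :=
  fun b k =>
    P.ev (fun a a' => ∑ l, G a l * lift (fun p q => curvature D (basis l) p q k) a' b)

/-- The Ricci scalar `( , ) Ricci`. -/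
def ricciScalar {C : FramedCalculus I B} (D : BimoduleConnection C) (G : T2 I B)
    (P : BimodulePairing I B) : B :=
  P.ev (ricci D G P)

end General

/-! ## The fuzzy sphere -/

/-- The totally antisymmetric symbol with `ε_{123} = 1` (indices run over `0, 1, 2` here). -/
def eps (i j k : Fin 3) : ℤ := ((j : ℤ) - i) * ((k : ℤ) - i) * ((k : ℤ) - j) / 2

/-- The relations `[y^i, y^j] = 2 i λ ε_{ijk} y^k` and `∑ (y^i)² = 1 - λ²`. -/
inductive FuzzyRel (lam : ℝ) : FreeAlgebra ℂ (Fin 3) → FreeAlgebra ℂ (Fin 3) → Prop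
  | comm (i j : Fin 3) : FuzzyRel lam
      (FreeAlgebra.ι ℂ i * FreeAlgebra.ι ℂ j - FreeAlgebra.ι ℂ j * FreeAlgebra.ι ℂ i)
      (∑ k, (2 * Complex.I * (lam : ℂ) * (eps i j k : ℂ)) • FreeAlgebra.ι ℂ k)
  | casimir : FuzzyRel lam
      (∑ i, FreeAlgebra.ι ℂ i * FreeAlgebra.ι ℂ i)
      (algebraMap ℂ (FreeAlgebra ℂ (Fin 3)) (1 - (lam : ℂ) ^ 2))

/-- The fuzzy sphere algebra `ℂ_λ[S²]`. -/
def FuzzySphere (lam : ℝ) : Type := RingQuot (FuzzyRel lam)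

instance (lam : ℝ) : Ring (FuzzySphere lam) := inferInstanceAs (Ring (RingQuot (FuzzyRel lam)))

instance (lam : ℝ) : Algebra ℂ (FuzzySphere lam) :=
  inferInstanceAs (Algebra ℂ (RingQuot (FuzzyRel lam)))

/-- The quotient map from the free algebra. -/
def fmk (lam : ℝ) : FreeAlgebra ℂ (Fin 3) →ₐ[ℂ] FuzzySphere lam :=
  RingQuot.mkAlgHom ℂ (FuzzyRel lam)

/-- The generators `y^i`. -/
def fy (lam : ℝ) (i : Fin 3) : FuzzySphere lam :=
  fmk lam (FreeAlgebra.ι ℂ i)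

/-- `∂_i = (2 i λ)⁻¹ [y^i, ·]`. -/
def fpd (lam : ℝ) (i : Fin 3) : FuzzySphere lam →ₗ[ℂ] FuzzySphere lam :=
  (1 / (2 * Complex.I * (lam : ℂ))) •
    (LinearMap.mulLeft ℂ (fy lam i) - LinearMap.mulRight ℂ (fy lam i))

theorem fpd_apply (lam : ℝ) (i : Fin 3) (x : FuzzySphere lam) :
    fpd lam i x = (1 / (2 * Complex.I * (lam : ℂ))) • (fy lam i * x - x * fy lam i) := rfl

theorem fpd_mul (lam : ℝ) (i : Fin 3) (x y : FuzzySphere lam) :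
    fpd lam i (x * y) = fpd lam i x * y + x * fpd lam i y := by
  simp only [fpd_apply, smul_mul_assoc, mul_smul_comm, ← smul_add]
  congr 1
  simp only [sub_mul, mul_sub, mul_assoc]
  abel

theorem fy_comm (lam : ℝ) (i j : Fin 3) :
    fy lam i * fy lam j - fy lam j * fy lam i
      = ∑ k, (2 * Complex.I * (lam : ℂ) * (eps i j k : ℂ)) • fy lam k := by
  have h : fmk lam _ = fmk lam _ := RingQuot.mkAlgHom_rel ℂ (FuzzyRel.comm (lam := lam) i j)
  simpa [fy, map_sum] using h

/-- The coefficients of `d s^i = - ½ ε_{ijk} s^j ∧ s^k`. -/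
def fc (i j k : Fin 3) : ℂ := -(eps i j k : ℂ)

theorem fc_antisymm (i j k : Fin 3) : fc i j k = - fc i k j := by
  have h : ∀ i j k : Fin 3, eps i j k = - eps i k j := by decide
  simp [fc, h i j k]

theorem fpd_dd (lam : ℝ) (i j : Fin 3) (x : FuzzySphere lam) :
    fpd lam i (fpd lam j x) - fpd lam j (fpd lam i x) + ∑ k, fc k i j • fpd lam k x = 0 := by
  by_cases h0 : lam = 0
  · subst h0
    simp [fpd_apply]
  have hne : (2 * Complex.I * (lam : ℂ)) ≠ 0 := by simp [h0]
  have hcyc : ∀ i j k : Fin 3, eps k i j = eps i j k := by decide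
  set t : ℂ := 2 * Complex.I * (lam : ℂ) with ht
  have hc := fy_comm lam i j
  have key : fpd lam i (fpd lam j x) - fpd lam j (fpd lam i x)
      = ((1 / t) * (1 / t)) • ((fy lam i * fy lam j - fy lam j * fy lam i) * x
          - x * (fy lam i * fy lam j - fy lam j * fy lam i)) := by
    simp only [fpd_apply, ← ht, smul_mul_assoc, mul_smul_comm, ← smul_sub, ← mul_smul]
    congr 1
    simp only [sub_mul, mul_sub, mul_assoc]
    abel
  rw [key, hc]
  simp only [Finset.sum_mul, Finset.mul_sum, ← Finset.sum_sub_distrib, Finset.smul_sum,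
    ← Finset.sum_add_distrib]
  refine Finset.sum_eq_zero fun k _ => ?_
  have hz : (1 / t) * (1 / t) * (t * (eps i j k : ℂ)) + -(eps i j k : ℂ) * (1 / t) = 0 := by
    field_simp
    ring
  simp only [fpd_apply, ← ht, fc, hcyc, smul_mul_assoc, mul_smul_comm]
  rw [← smul_sub, smul_smul, smul_smul, ← add_smul, hz, zero_smul]

/-- The rotationally invariant 3-dimensional calculus on the fuzzy sphere, with central basis `s^i`. -/
def fuzzyCalculus (lam : ℝ) : FramedCalculus (Fin 3) (FuzzySphere lam) where
  pd := fpd lam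
  c := fc
  pd_mul := fpd_mul lam
  c_antisymm := fc_antisymm
  dd := fpd_dd lam

/-! ## Spacetime: an open set with coordinates `x^μ` -/

/-- Coordinate space. -/
abbrev E (n : ℕ) : Type := Fin n → ℝ

/-- The partial derivative `∂_μ` of a function of the coordinates. -/
def del {n : ℕ} {F : Type} [NormedAddCommGroup F] [NormedSpace ℝ F] (μ : Fin n) (f : E n → F)
    (x : E n) : F := fderiv ℝ f x (Pi.single μ 1)

/-- Extension by zero. -/
def ext0 {n : ℕ} {U : TopologicalSpace.Opens (E n)} (f : U → ℂ) : E n → ℂ :=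
  Function.extend Subtype.val f 0

theorem ext0_coe {n : ℕ} {U : TopologicalSpace.Opens (E n)} (f : U → ℂ) (x : U) :
    ext0 f x = f x := Subtype.val_injective.extend_apply _ _ _

/-- `C^∞(U)`: the algebra of smooth complex functions on the open set `U`. -/
def Smooth {n : ℕ} (U : TopologicalSpace.Opens (E n)) : Subalgebra ℂ (U → ℂ) where
  carrier := {f | ContDiffOn ℝ ∞ (ext0 f) U}
  mul_mem' {f g} hf hg := (ContDiffOn.mul hf hg).congr fun x hx => by
    simpa using ext0_coe (f * g) ⟨x, hx⟩ |>.trans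
      (by rw [Pi.mul_apply, ← ext0_coe f, ← ext0_coe g])
  add_mem' {f g} hf hg := (ContDiffOn.add hf hg).congr fun x hx => by
    simpa using ext0_coe (f + g) ⟨x, hx⟩ |>.trans
      (by rw [Pi.add_apply, ← ext0_coe f, ← ext0_coe g])
  algebraMap_mem' z := (contDiffOn_const (c := z)).congr fun x hx => by
    simpa using ext0_coe (algebraMap ℂ (U → ℂ) z) ⟨x, hx⟩

section Spacetime

variable {n : ℕ} {U : TopologicalSpace.Opens (E n)}

theorem smooth_differentiableAt (f : Smooth U) (x : U) :
    DifferentiableAt ℝ (ext0 (f : U → ℂ)) x :=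
  (f.2.contDiffAt (U.isOpen.mem_nhds x.2)).differentiableAt (by simp)

theorem ext0_eventuallyEq {f : U → ℂ} {F : E n → ℂ} (h : ∀ x : U, f x = F x) (x : U) :
    ext0 f =ᶠ[nhds (x : E n)] F := by
  filter_upwards [U.isOpen.mem_nhds x.2] with y hy
  rw [← h ⟨y, hy⟩]
  exact ext0_coe f ⟨y, hy⟩

/-- `∂_μ` on `C^∞(U)`. -/
def spd (μ : Fin n) : Smooth U →ₗ[ℂ] Smooth U where
  toFun f := ⟨fun x => del μ (ext0 (f : U → ℂ)) x, by
    have h : ContDiffOn ℝ ∞ (fun x => del μ (ext0 (f : U → ℂ)) x) U :=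
      (f.2.fderiv_of_isOpen U.isOpen (m := ∞) (by simp)).clm_apply contDiffOn_const
    exact h.congr fun x hx => ext0_coe _ ⟨x, hx⟩⟩
  map_add' f g := by
    ext x
    have h : ext0 ((f + g : Smooth U) : U → ℂ) =ᶠ[nhds (x : E n)]
        (ext0 (f : U → ℂ) + ext0 (g : U → ℂ)) :=
      ext0_eventuallyEq (fun y => by simp [ext0_coe]) x
    simp only [del, h.fderiv_eq, fderiv_add (smooth_differentiableAt f x) (smooth_differentiableAt g x)]
    rfl
  map_smul' z f := by
    ext x
    have h : ext0 ((z • f : Smooth U) : U → ℂ) =ᶠ[nhds (x : E n)] (z • ext0 (f : U → ℂ)) :=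
      ext0_eventuallyEq (fun y => by simp [ext0_coe]) x
    simp only [del, h.fderiv_eq, fderiv_const_smul (smooth_differentiableAt f x) z]
    rfl

theorem spd_apply (μ : Fin n) (f : Smooth U) (x : U) :
    (spd μ f : U → ℂ) x = del μ (ext0 (f : U → ℂ)) x := rfl

theorem spd_mul (μ : Fin n) (f g : Smooth U) :
    spd μ (f * g) = spd μ f * g + f * spd μ g := by
  ext x
  have h : ext0 ((f * g : Smooth U) : U → ℂ) =ᶠ[nhds (x : E n)]
      (ext0 (f : U → ℂ) * ext0 (g : U → ℂ)) :=
    ext0_eventuallyEq (fun y => by simp [ext0_coe]) x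
  show del μ _ _ = del μ _ _ * (g : U → ℂ) x + (f : U → ℂ) x * del μ _ _
  simp only [del, h.fderiv_eq, fderiv_mul (smooth_differentiableAt f x) (smooth_differentiableAt g x)]
  simp [ext0_coe]
  ring

theorem spd_comm (μ ν : Fin n) (f : Smooth U) : spd μ (spd ν f) = spd ν (spd μ f) := by
  ext x
  have key : ∀ μ ν : Fin n, (spd μ (spd ν f) : U → ℂ) x
      = fderiv ℝ (fderiv ℝ (ext0 (f : U → ℂ))) x (Pi.single μ 1) (Pi.single ν 1) := by
    intro μ ν
    have h : ext0 (spd ν f : U → ℂ) =ᶠ[nhds (x : E n)]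
        (fun y => fderiv ℝ (ext0 (f : U → ℂ)) y (Pi.single ν 1)) :=
      ext0_eventuallyEq (F := fun y => fderiv ℝ (ext0 (f : U → ℂ)) y (Pi.single ν 1))
        (fun y => rfl) x
    have hd : DifferentiableAt ℝ (fderiv ℝ (ext0 (f : U → ℂ))) x :=
      ((f.2.fderiv_of_isOpen U.isOpen (m := ∞) (by simp)).contDiffAt
        (U.isOpen.mem_nhds x.2)).differentiableAt (by simp)
    rw [spd_apply, del, h.fderiv_eq, fderiv_clm_apply hd (differentiableAt_const _)]
    simp
  rw [key, key]
  exact ((f.2.contDiffAt (U.isOpen.mem_nhds x.2)).isSymmSndFDerivAt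
    (by simp only [minSmoothness_of_isRCLikeNormedField]; exact WithTop.coe_le_coe.2 le_top)) _ _

/-- A real smooth function as an element of `C^∞(U)`. -/
def ofReal (f : E n → ℝ) (hf : ContDiffOn ℝ ∞ f U) : Smooth U :=
  ⟨fun x => (f x : ℂ), (Complex.ofRealCLM.contDiff.comp_contDiffOn hf).congr
    fun x hx => ext0_coe _ ⟨x, hx⟩⟩

end Spacetime

/-! ## The product of spacetime and the fuzzy sphere -/

/-- The coordinate algebra `C^∞(U) ⊗ ℂ_λ[S²]` of the product. -/
def ProdAlg {n : ℕ} (U : TopologicalSpace.Opens (E n)) (lam : ℝ) : Type :=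
  Smooth U ⊗[ℂ] FuzzySphere lam

instance {n : ℕ} (U : TopologicalSpace.Opens (E n)) (lam : ℝ) : Ring (ProdAlg U lam) :=
  inferInstanceAs (Ring (Smooth U ⊗[ℂ] FuzzySphere lam))

instance {n : ℕ} (U : TopologicalSpace.Opens (E n)) (lam : ℝ) : Algebra ℂ (ProdAlg U lam) :=
  inferInstanceAs (Algebra ℂ (Smooth U ⊗[ℂ] FuzzySphere lam))

/-- The element `f ⊗ p` of the product algebra. -/
def ptmul {n : ℕ} {U : TopologicalSpace.Opens (E n)} {lam : ℝ} (f : Smooth U)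
    (p : FuzzySphere lam) : ProdAlg U lam := f ⊗ₜ[ℂ] p

/-- The index set of the combined basis `{d x^μ, s^i}` of 1-forms. -/
abbrev Idx (n : ℕ) : Type := Fin n ⊕ Fin 3

section Product

variable {n : ℕ} (U : TopologicalSpace.Opens (E n)) (lam : ℝ)

/-- The partial derivatives on the product. -/
def ppd : Idx n → ProdAlg U lam →ₗ[ℂ] ProdAlg U lam
  | .inl μ => TensorProduct.map (spd μ) LinearMap.id
  | .inr i => TensorProduct.map LinearMap.id (fpd lam i)

/-- The coefficients of `d (d x^μ) = 0` and `d s^i = - ½ ε_{ijk} s^j ∧ s^k`. -/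
def pc : Idx n → Idx n → Idx n → ℂ
  | .inr i, .inr j, .inr k => fc i j k
  | _, _, _ => 0

@[elab_as_elim]
theorem prod_induction {p : ProdAlg U lam → Prop} (x : ProdAlg U lam) (h0 : p 0)
    (ht : ∀ f q, p (ptmul f q)) (ha : ∀ x y, p x → p y → p (x + y)) : p x :=
  TensorProduct.induction_on (motive := p) x h0 ht ha

theorem ptmul_mul (f g : Smooth U) (p q : FuzzySphere lam) :
    (ptmul f p : ProdAlg U lam) * ptmul g q = ptmul (f * g) (p * q) :=
  Algebra.TensorProduct.tmul_mul_tmul _ _ _ _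

theorem ppd_inl (μ : Fin n) (f : Smooth U) (p : FuzzySphere lam) :
    ppd U lam (.inl μ) (ptmul f p) = ptmul (spd μ f) p := rfl

theorem ppd_inr (i : Fin 3) (f : Smooth U) (p : FuzzySphere lam) :
    ppd U lam (.inr i) (ptmul f p) = ptmul f (fpd lam i p) := rfl

theorem ptmul_add (f : Smooth U) (p q : FuzzySphere lam) :
    (ptmul f (p + q) : ProdAlg U lam) = ptmul f p + ptmul f q := TensorProduct.tmul_add _ _ _

theorem add_ptmul (f g : Smooth U) (p : FuzzySphere lam) :
    (ptmul (f + g) p : ProdAlg U lam) = ptmul f p + ptmul g p := TensorProduct.add_tmul _ _ _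

theorem ppd_mul (a : Idx n) (x y : ProdAlg U lam) :
    ppd U lam a (x * y) = ppd U lam a x * y + x * ppd U lam a y := by
  refine prod_induction U lam x ?_ (fun f p => ?_) fun x x' hx hx' => ?_
  · simp only [zero_mul, map_zero, add_zero]
  · refine prod_induction U lam y ?_ (fun g q => ?_) fun y y' hy hy' => ?_
    · simp only [mul_zero, map_zero, add_zero]
    · rcases a with μ | i
      · simp only [ptmul_mul, ppd_inl, spd_mul, add_ptmul]
      · simp only [ptmul_mul, ppd_inr, fpd_mul, ptmul_add]
    · rw [mul_add, map_add, hy, hy', map_add, mul_add, mul_add]; abel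
  · rw [add_mul, map_add, hx, hx', map_add, add_mul, add_mul]; abel

theorem ppd_dd (a b : Idx n) (x : ProdAlg U lam) :
    ppd U lam a (ppd U lam b x) - ppd U lam b (ppd U lam a x)
      + ∑ k, pc k a b • ppd U lam k x = 0 := by
  refine prod_induction U lam x ?_ (fun f p => ?_) fun x x' hx hx' => ?_
  · simp only [map_zero, sub_zero, smul_zero, Finset.sum_const_zero, add_zero]
  · rcases a with μ | i <;> rcases b with ν | j
    · simp [pc, ppd_inl, spd_comm μ ν]
    · simp [pc, ppd_inl, ppd_inr]
    · simp [pc, ppd_inl, ppd_inr]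
    · let L : FuzzySphere lam →ₗ[ℂ] ProdAlg U lam := TensorProduct.mk ℂ _ _ f
      have hL : ∀ q, (ptmul f q : ProdAlg U lam) = L q := fun q => rfl
      have h := congrArg L (fpd_dd lam i j p)
      have hL' : ∀ k q, ppd U lam (.inr k) (L q) = L (fpd lam k q) := fun k q => rfl
      simpa [pc, hL, hL'] using h
  · rw [← add_zero (0 : ProdAlg U lam)]
    nth_rw 1 [← hx]
    rw [← hx']
    simp only [map_add, smul_add, Finset.sum_add_distrib]
    abel

/-- The product calculus: the graded tensor product of the calculi on `U` and on the fuzzy sphere. -/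
def prodCalculus : FramedCalculus (Idx n) (ProdAlg U lam) where
  pd := ppd U lam
  c := pc
  pd_mul := ppd_mul U lam
  c_antisymm a b b' := by
    rcases a with _ | _ <;> rcases b with _ | _ <;> rcases b' with _ | _ <;>
      simp only [pc, neg_zero]
    exact fc_antisymm _ _ _
  dd := ppd_dd U lam

end Product

/-! ## The fields on spacetime and the product metric -/

/-- Real smooth fields `g_{μν}`, `A_{μi}`, `h_{ij}` on `U` with `g` symmetric and `h` symmetric
positive definite. (Values outside `U` play no role.) -/
structure Fields {n : ℕ} (U : TopologicalSpace.Opens (E n)) where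
  g : E n → Matrix (Fin n) (Fin n) ℝ
  A : E n → Matrix (Fin n) (Fin 3) ℝ
  h : E n → Matrix (Fin 3) (Fin 3) ℝ
  g_smooth : ∀ μ ν, ContDiffOn ℝ ∞ (fun x => g x μ ν) U
  A_smooth : ∀ μ i, ContDiffOn ℝ ∞ (fun x => A x μ i) U
  h_smooth : ∀ i j, ContDiffOn ℝ ∞ (fun x => h x i j) U
  g_symm : ∀ x ∈ U, (g x).IsSymm
  h_posDef : ∀ x ∈ U, (h x).PosDef

namespace Fields

variable {n : ℕ} {U : TopologicalSpace.Opens (E n)} (F : Fields U)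

/-- The metric
`g_{μν} d x^μ ⊗ d x^ν + A_{μi} (d x^μ ⊗ s^i + s^i ⊗ d x^μ) + h_{ij} s^i ⊗ s^j` on the product. -/
def metric (lam : ℝ) : T2 (Idx n) (ProdAlg U lam)
  | .inl μ, .inl ν => ptmul (ofReal (fun x => F.g x μ ν) (F.g_smooth μ ν)) 1
  | .inl μ, .inr i => ptmul (ofReal (fun x => F.A x μ i) (F.A_smooth μ i)) 1
  | .inr i, .inl μ => ptmul (ofReal (fun x => F.A x μ i) (F.A_smooth μ i)) 1
  | .inr i, .inr j => ptmul (ofReal (fun x => F.h x i j) (F.h_smooth i j)) 1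

/-- The metric `h_{ij}(x) s^i ⊗ s^j` on the fuzzy sphere at a spacetime point `x`. -/
def fuzzyMetric (lam : ℝ) (x : E n) : T2 (Fin 3) (FuzzySphere lam) :=
  fun i j => algebraMap ℂ (FuzzySphere lam) (F.h x i j : ℂ)

/-- The effective metric `g̃_{μν} = g_{μν} - h^{ij} A_{iμ} A_{jν}`. -/
def gt (x : E n) : Matrix (Fin n) (Fin n) ℝ := F.g x - F.A x * (F.h x)⁻¹ * (F.A x).transpose

/-- Its inverse `g̃^{μν}`. -/
def gtInv (x : E n) : Matrix (Fin n) (Fin n) ℝ := (F.gt x)⁻¹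

/-- The Christoffel symbols `Γ̃^σ_{μν}` of `g̃`. -/
def Gam (σ μ ν : Fin n) (x : E n) : ℝ :=
  1 / 2 * ∑ ρ, F.gtInv x σ ρ *
    (del μ (fun y => F.gt y ρ ν) x + del ν (fun y => F.gt y ρ μ) x - del ρ (fun y => F.gt y μ ν) x)

/-- The Ricci scalar `R̃_M` of `g̃`, with the normalisation `-½` times the usual one. -/
def RM (x : E n) : ℝ :=
  1 / 2 * ∑ α, ∑ β, F.gtInv x α β *
    ((∑ μ, (- del μ (F.Gam μ α β) x + del α (F.Gam μ μ β) x))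
      + ∑ μ, ∑ ν, (F.Gam μ α ν x * F.Gam ν μ β x - F.Gam μ μ ν x * F.Gam ν α β x))

/-- The gauge field `Ã_{αi} = h^{ij} A_{αj}`. -/
def At (x : E n) (α : Fin n) (i : Fin 3) : ℝ := ∑ j, (F.h x)⁻¹ i j * F.A x α j

/-- Its curvature `F̃^i_{αβ} = ∂_α Ã_{βi} - ∂_β Ã_{αi} - ε_{ijk} Ã_{αj} Ã_{βk}`. -/
def Ft (i : Fin 3) (α β : Fin n) (x : E n) : ℝ :=
  del α (fun y => F.At y β i) x - del β (fun y => F.At y α i) x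
    - ∑ j, ∑ k, (eps i j k : ℝ) * F.At x α j * F.At x β k

/-- `F̃^{iμν} = g̃^{μα} g̃^{νβ} F̃^i_{αβ}`. -/
def FtUp (i : Fin 3) (μ ν : Fin n) (x : E n) : ℝ :=
  ∑ α, ∑ β, F.gtInv x μ α * F.gtInv x ν β * F.Ft i α β x

/-- The gauge covariant derivative
`∇̃_{Aα} h_{ij} = ∂_α h_{ij} - Ã_{αk} (h_{li} ε_{jkl} + h_{lj} ε_{ikl})`. -/
def covH (α : Fin n) (x : E n) : Matrix (Fin 3) (Fin 3) ℝ := Matrix.of fun i j =>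
  del α (fun y => F.h y i j) x
    - ∑ k, ∑ l, F.At x α k * (F.h x l i * (eps j k l : ℝ) + F.h x l j * (eps i k l : ℝ))

/-- `Φ = ln h`, the logarithm of a positive definite matrix. -/
def Phi (x : E n) : Matrix (Fin 3) (Fin 3) ℝ := cfc Real.log (F.h x)

/-- `Φ_α = h⁻¹ ∇̃_{Aα} h`. -/
def PhiD (α : Fin n) (x : E n) : Matrix (Fin 3) (Fin 3) ℝ := (F.h x)⁻¹ * F.covH α x

/-- `R_h = ½ e^{-Tr Φ} (Tr e^{2Φ} - ½ (Tr e^Φ)²)`. -/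
def Rh (x : E n) : ℝ :=
  Real.exp (-(F.Phi x).trace) / 2 *
    ((NormedSpace.exp ((2 : ℝ) • F.Phi x)).trace - 1 / 2 * (NormedSpace.exp (F.Phi x)).trace ^ 2)

/-- `h_{ij} F̃^i_{μν} F̃^{jμν}`. -/
def YM (x : E n) : ℝ :=
  ∑ i, ∑ j, ∑ μ, ∑ ν, F.h x i j * F.Ft i μ ν x * F.FtUp j μ ν x

/-- `g̃^{αβ} ∇̃_α Tr(Φ_β)`, with `∇̃` the Levi-Civita connection of `g̃` on covectors. -/
def divTrPhi (x : E n) : ℝ :=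
  ∑ α, ∑ β, F.gtInv x α β *
    (del α (fun y => (F.PhiD β y).trace) x - ∑ γ, F.Gam γ α β x * (F.PhiD γ x).trace)

/-- `g̃^{αβ} (Tr(Φ_α Φ_β) + Tr(Φ_α) Tr(Φ_β))`. -/
def sigmaModel (x : E n) : ℝ :=
  ∑ α, ∑ β, F.gtInv x α β *
    ((F.PhiD α x * F.PhiD β x).trace + (F.PhiD α x).trace * (F.PhiD β x).trace)

end Fields

end FuzzyKK

end

set_option linter.unusedSectionVars false

noncomputable section

namespace FuzzyKK

/-! ## Levi-Civita connections in a frame over a commutative algebra -/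

section Frame

variable {I A : Type} [Fintype I] [DecidableEq I] [CommRing A] [Algebra ℂ A]

/-! The basic 1-forms are central and the metric coefficients lie in the central subalgebra of
functions on spacetime. With flip braiding, the QLC conditions are therefore the classical
Levi-Civita conditions in a frame, over the commutative algebra `Smooth U`: the fibre directions
differentiate its elements to zero and enter only through the structure constants of su(2).
Solutions of the classical conditions give QLCs (`connOf_isQLC`). The usual argument with a tensor
symmetric in one pair of indices and antisymmetric in another also works for noncentral
coefficients, so uniqueness holds among all connections with flip braiding (`isQLC_unique`). The
flip on e ⊗ dx^ν follows from the two Leibniz rules, because x^ν is central (`flips_univ`). The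
Ricci scalar is then half of a classical contraction of the curvature (`ricciScalar_connOf`).

That contraction is a Kaluza-Klein computation. The frame dx^μ, θ^i = s^i + Ã_{μi} dx^μ completes
the square and makes the metric g̃ ⊕ h. In exchange, dθ^i acquires F̃^i as its base components and
the adjoint action of Ã as its mixed components. For a block diagonal metric the Levi-Civita
connection can be written down and checked (`KaluzaKlein.conn_isLeviCivita`), and its scalar
curvature splits into a base and a fibre contribution (`base_block`, `fibre_block`, combined in
`scalarCurv_conn`). Curvature is tensorial (`curv_changeFrame`), so the result returns to the frame
dx^μ, s^i unchanged (`scalarCurv_changeFrame`).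

The intrinsic fibre term is the scalar curvature of a left invariant metric on su(2). Multiplied by
det h it equals Tr h² - ½ (Tr h)² (`su2_fibreScalar`). Since e^Φ = h and e^{Tr Φ} = det h, this is 2
R_h. The same identity over ℂ settles the single fuzzy sphere.

Invertibility of g̃ is a consequence of the existence of the inverse pairing (`gt_det_ne_zero`). It
requires the fuzzy sphere algebra to be nonzero, which an explicit representation on functions on ℤ
shows. The relation `Rep` translates identities in `Smooth U` into the real fields of the statement.
-/

/-- The entrywise derivative of a matrix. -/
def dmat {J K : Type} (d : Derivation ℂ A A) (M : Matrix J K A) : Matrix J K A := M.map d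

@[simp]
theorem dmat_apply {J K : Type} (d : Derivation ℂ A A) (M : Matrix J K A) (i : J) (j : K) :
    dmat d M i j = d (M i j) := rfl

theorem dmat_mul {J K : Type} (d : Derivation ℂ A A) (M : Matrix J I A) (N : Matrix I K A) :
    dmat d (M * N) = dmat d M * N + M * dmat d N := by
  ext i j
  simp only [dmat_apply, Matrix.mul_apply, map_sum, Derivation.leibniz, smul_eq_mul,
    Matrix.add_apply, ← Finset.sum_add_distrib]
  exact Finset.sum_congr rfl fun k _ => by ring

theorem dmat_one (d : Derivation ℂ A A) : dmat d (1 : Matrix I I A) = 0 := by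
  ext i j
  by_cases h : i = j <;> simp [h]

/-- The conditions on coefficients `Γ^l_{ab} = Γ a l b` of a connection `∇ e^l = Γ^l_{ab} e^a ⊗ e^b`
to be torsion free and compatible with the metric `G`, in a frame whose dual vector fields act
on functions by `δ` and for which `d e^l = ½ c^l_{ab} e^a ∧ e^b`. -/
structure IsLeviCivita (δ : I → Derivation ℂ A A) (c : I → I → I → A) (G : Matrix I I A)
    (Γ : I → Matrix I I A) : Prop where
  torsion : ∀ l a b, Γ a l b - Γ b l a = c l a b
  metric : ∀ a, dmat (δ a) G + (Γ a).transpose * G + G * Γ a = 0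

/-- The curvature 2-form `(d Γ - Γ ∧ Γ)_{pq}` of a connection in a frame. -/
def curv (δ : I → Derivation ℂ A A) (c : I → I → I → A) (Γ : I → Matrix I I A) (p q : I) :
    Matrix I I A :=
  dmat (δ p) (Γ q) - dmat (δ q) (Γ p) + ∑ m, c m p q • Γ m - (Γ p * Γ q - Γ q * Γ p)

/-- The full contraction `G^{bk} R^l_{lbk}` of the curvature. -/
def scalarCurv (δ : I → Derivation ℂ A A) (c : I → I → I → A) (Gi : Matrix I I A)
    (Γ : I → Matrix I I A) : A :=
  ∑ b, ∑ k, Gi b k * ∑ l, curv δ c Γ l b l k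

end Frame

/-! ## Quantum Levi-Civita connections with central coefficients -/

section Central

variable {I A B : Type} [Fintype I] [DecidableEq I] [CommRing A] [Algebra ℂ A] [Ring B]
  [Algebra ℂ B] {C : FramedCalculus I B} {ι : A →ₐ[ℂ] B}

theorem FramedCalculus.pd_one (C : FramedCalculus I B) (a : I) : C.pd a 1 = 0 := by
  simpa using C.pd_mul a 1 1

theorem basis_apply (a b : I) : (basis a : T1 I B) b = if b = a then 1 else 0 := by
  simp [basis, Pi.single_apply]

theorem pd_basis (C : FramedCalculus I B) (a l b : I) : C.pd a ((basis l : T1 I B) b) = 0 := by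
  rw [basis_apply]
  split_ifs
  · exact C.pd_one a
  · exact map_zero _

theorem eq_sum_basis (w : T1 I B) : w = ∑ l, w l • basis l := by
  ext a
  simp [Finset.sum_apply, basis_apply]

theorem eq_sum_tens (T : T2 I B) : T = ∑ a, ∑ b, T a b • tens (basis a) (basis b) := by
  ext a b
  simp [Finset.sum_apply, basis_apply, tens]

/-- The bimodule connection with flip braiding and central coefficients `Γ`. -/
def connOf (C : FramedCalculus I B) (ι : A →ₐ[ℂ] B) (hι : ∀ f b, Commute (ι f) b)
    (Γ : I → Matrix I I A) : BimoduleConnection C where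
  nabla := AddMonoidHom.mk' (fun w a b => C.pd a (w b) + ∑ l, w l * ι (Γ a l b)) fun w η => by
    ext a b
    simp only [Pi.add_apply, map_add, add_mul, Finset.sum_add_distrib]
    abel
  sigma := AddMonoidHom.mk' (fun T a b => T b a) fun _ _ => rfl
  sigma_left _ _ := rfl
  sigma_right _ _ := rfl
  leibniz_left f w := by
    ext a b
    simp only [AddMonoidHom.mk'_apply, Pi.smul_apply, smul_eq_mul, Pi.add_apply, C.pd_mul, tens, d0,
      mul_add, Finset.mul_sum, mul_assoc]
    abel
  leibniz_right f w := by
    ext a b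
    simp only [AddMonoidHom.mk'_apply, Pi.smul_apply, MulOpposite.smul_eq_mul_unop,
      MulOpposite.unop_op, Pi.add_apply, C.pd_mul, tens, d0, add_mul, Finset.sum_mul, mul_assoc]
    rw [add_right_comm]
    congr 2
    exact Finset.sum_congr rfl fun l _ => by rw [(hι _ f).eq]

theorem connOf_nabla (hι : ∀ f b, Commute (ι f) b) (Γ : I → Matrix I I A) (w : T1 I B) (a b : I) :
    (connOf C ι hι Γ).nabla w a b = C.pd a (w b) + ∑ l, w l * ι (Γ a l b) := rfl

theorem connOf_nabla_basis (hι : ∀ f b, Commute (ι f) b) (Γ : I → Matrix I I A) (l a b : I) :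
    (connOf C ι hι Γ).nabla (basis l) a b = ι (Γ a l b) := by
  rw [connOf_nabla, pd_basis]
  simp [basis_apply]

theorem connOf_flips (hι : ∀ f b, Commute (ι f) b) (Γ : I → Matrix I I A) (S : Set I) :
    FlipsOn S (connOf C ι hι Γ) := by
  intro a b _
  ext p q
  simp only [connOf, AddMonoidHom.mk'_apply, tens, basis_apply]
  split_ifs <;> simp

/-- A connection with coefficients satisfying the Levi-Civita conditions is a QLC. -/
theorem connOf_isQLC (hι : ∀ f b, Commute (ι f) b) {δ : I → Derivation ℂ A A}
    (hδ : ∀ a f, C.pd a (ι f) = ι (δ a f)) {G : Matrix I I A} {Γ : I → Matrix I I A}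
    (h : IsLeviCivita δ (fun l a b => algebraMap ℂ A (C.c l a b)) G Γ) :
    IsQLC (fun a b => ι (G a b)) (connOf C ι hι Γ) := by
  constructor
  · intro w
    ext a b
    simp only [wedge, connOf_nabla, d1]
    rw [add_sub_add_comm, ← Finset.sum_sub_distrib]
    congr 1
    refine Finset.sum_congr rfl fun l _ => ?_
    rw [← mul_sub, ← map_sub, h.torsion, AlgHom.commutes, ← Algebra.commutes, Algebra.smul_def]
  · ext a b k
    have := congrFun (congrFun (h.metric a) b) k
    simp only [Matrix.add_apply, dmat_apply, Matrix.mul_apply, Matrix.transpose_apply,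
      Matrix.zero_apply] at this
    simp only [nabla2, connOf_nabla_basis]
    show C.pd a (ι (G b k)) + ∑ l, ι (G l k) * ι (Γ a l b) + ∑ l, ι (G b l) * ι (Γ a l k) = 0
    simp only [hδ, ← map_mul, ← map_sum, ← map_add]
    rw [← map_zero ι, ← this]
    simp only [mul_comm (G _ k)]

/-- The products of basic forms generate Ω¹ ⊗ Ω¹ as a left module, and σ is left linear. -/
theorem sigma_eq_flip {D : BimoduleConnection C} (h : FlipsOn Set.univ D) (T : T2 I B) :
    D.sigma T = fun a b => T b a := by
  conv_lhs => rw [eq_sum_tens T]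
  simp only [map_sum, D.sigma_left, h _ _ (Set.mem_univ _)]
  ext a b
  simp [Finset.sum_apply, basis_apply, tens]

/-- The left Leibniz rule alone determines ∇ from its values on the basis. Those values are not
assumed central, so this applies to every competing connection. -/
theorem nabla_apply (D : BimoduleConnection C) (w : T1 I B) (a b : I) :
    D.nabla w a b = C.pd a (w b) + ∑ l, w l * D.nabla (basis l) a b := by
  conv_lhs => rw [eq_sum_basis w]
  simp [map_sum, D.leibniz_left, Finset.sum_apply, tens, d0, basis_apply, Finset.sum_add_distrib,
    add_comm]

/-- Uniqueness of quantum Levi-Civita connections with flip braiding. -/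
theorem isQLC_unique {G : Matrix I I A} {Gi : Matrix I I A} (hG : G.IsSymm) (hGi : Gi * G = 1)
    {D D' : BimoduleConnection C}
    (h : IsQLC (fun a b => ι (G a b)) D) (h' : IsQLC (fun a b => ι (G a b)) D')
    (hf : FlipsOn Set.univ D) (hf' : FlipsOn Set.univ D') : D = D' := by
  -- The derivative terms of the two connections agree, so their difference is a tensor; its
  -- components may be noncentral.
  set Y : I → I → I → B := fun a l b => D.nabla (basis l) a b - D'.nabla (basis l) a b with hY
  have hsym : ∀ a l b, Y a l b = Y b l a := by
    intro a l b
    have h1 := congrFun (congrFun (h.1 (basis l)) a) b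
    have h2 := congrFun (congrFun (h'.1 (basis l)) a) b
    simp only [wedge] at h1 h2
    have h3 := h1.trans h2.symm
    simp only [hY]
    rw [sub_eq_sub_iff_add_eq_add] at h3 ⊢
    rw [add_comm, ← sub_eq_zero] at h3 ⊢
    rw [← h3]
    abel
  have hmet : ∀ a b k, ∑ l, ι (G k l) * Y a l b + ∑ l, ι (G b l) * Y a l k = 0 := by
    intro a b k
    have h1 := congrFun (congrFun (congrFun h.2 a) b) k
    have h2 := congrFun (congrFun (congrFun h'.2 a) b) k
    simp only [nabla2, sigma_eq_flip hf, sigma_eq_flip hf', Pi.zero_apply] at h1 h2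
    rw [nabla_apply] at h1 h2
    rw [← sub_self (0 : B)]
    nth_rw 1 [← h1]
    rw [← h2]
    simp only [hY, mul_sub, Finset.sum_sub_distrib]
    simp only [hG.apply k]
    abel
  set Z : I → I → I → B := fun a k b => ∑ l, ι (G k l) * Y a l b with hZ
  have zs : ∀ a k b, Z a k b = Z b k a := fun a k b => by simp only [hZ, hsym a _ b]
  have za : ∀ a k b, Z a k b = - Z a b k := fun a k b => eq_neg_of_add_eq_zero_left (hmet a b k)
  -- Z is symmetric in its outer indices and antisymmetric in its last two. These transpositions
  -- generate the permutations of three indices with incompatible signs, so Z = -Z, and 2 is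
  -- invertible in ℂ.
  have z0 : ∀ a k b, Z a k b = 0 := by
    intro a k b
    have : Z a k b = - Z a k b := by
      calc Z a k b = - Z a b k := za a k b
        _ = - Z k b a := by rw [zs a b k]
        _ = Z k a b := by rw [za k b a, neg_neg]
        _ = Z b a k := zs k a b
        _ = - Z b k a := za b a k
        _ = - Z a k b := by rw [zs b k a]
    have h2 : (2 : ℂ) • Z a k b = 0 := by
      rw [two_smul]
      nth_rw 1 [this]
      simp
    simpa using h2
  have y0 : ∀ a l b, Y a l b = 0 := by
    intro a l b
    have h1 : ∑ k, ι (Gi l k) * Z a k b = Y a l b := by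
      simp only [hZ, Finset.mul_sum, ← mul_assoc, ← map_mul]
      rw [Finset.sum_comm]
      simp only [← Finset.sum_mul, ← map_sum, ← Matrix.mul_apply, hGi, Matrix.one_apply]
      simp
    rw [← h1]
    simp [z0]
  refine BimoduleConnection.ext (AddMonoidHom.ext fun w => ?_) (AddMonoidHom.ext fun T => ?_)
  · ext a b
    rw [nabla_apply, nabla_apply D']
    congr 1
    exact Finset.sum_congr rfl fun l _ => by rw [sub_eq_zero.1 (y0 a l b)]
  · rw [sigma_eq_flip hf, sigma_eq_flip hf']

/-- The bimodule pairing with central coefficients `Gi`. -/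
def pairingOf (ι : A →ₐ[ℂ] B) (hι : ∀ f b, Commute (ι f) b) (Gi : Matrix I I A) :
    BimodulePairing I B where
  ev := AddMonoidHom.mk' (fun T => ∑ a, ∑ b, ι (Gi a b) * T a b) fun T T' => by
    simp only [Pi.add_apply, mul_add, Finset.sum_add_distrib]
  ev_left f T := by
    simp only [AddMonoidHom.mk'_apply, Pi.smul_apply, smul_eq_mul, Finset.mul_sum]
    refine Finset.sum_congr rfl fun a _ => Finset.sum_congr rfl fun b _ => ?_
    rw [← mul_assoc, (hι _ f).eq, mul_assoc]
  ev_right f T := by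
    simp only [AddMonoidHom.mk'_apply, Pi.smul_apply, MulOpposite.smul_eq_mul_unop,
      MulOpposite.unop_op, Finset.sum_mul, mul_assoc]

/-- This supplies the inverse on the fuzzy sphere at a point, where only the metric is given. -/
theorem pairingOf_isInverseMetric (hι : ∀ f b, Commute (ι f) b) {G Gi : Matrix I I A}
    (h : Gi * G = 1) (h' : G * Gi = 1) :
    IsInverseMetric (fun a b => ι (G a b)) (pairingOf ι hι Gi) := by
  intro w
  constructor
  · intro b
    show ∑ a, ∑ a', ι (Gi a a') * (w a * ι (G a' b)) = w b
    have : ∀ a a', ι (Gi a a') * (w a * ι (G a' b)) = ι (Gi a a' * G a' b) * w a := fun a a' => by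
      rw [← (hι _ _).eq, ← mul_assoc, ← map_mul]
    simp only [this, ← Finset.sum_mul, ← map_sum, ← Matrix.mul_apply, h, Matrix.one_apply]
    simp
  · intro a
    show ∑ b, ∑ b', ι (Gi b b') * (ι (G a b) * w b') = w a
    have : ∀ b b', ι (Gi b b') * (ι (G a b) * w b') = ι (G a b * Gi b b') * w b' := fun b b' => by
      rw [← mul_assoc, ← map_mul, mul_comm (Gi b b')]
    simp only [this]
    rw [Finset.sum_comm]
    simp only [← Finset.sum_mul, ← map_sum, ← Matrix.mul_apply, h', Matrix.one_apply]
    simp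

/-- An inverse of a metric with central coefficients contracts with the inverse matrix. -/
theorem ev_central {P : BimodulePairing I B} (T : I → I → A) :
    P.ev (fun a b => ι (T a b)) = ∑ a, ∑ b, ι (T a b) * P.ev (tens (basis a) (basis b)) := by
  rw [eq_sum_tens (fun a b => ι (T a b))]
  simp only [map_sum, P.ev_left]

/-- The inversion identity at w = e^a, with the central coefficients pulled out by left linearity:
the values of the pairing form a left inverse of G, a priori with entries in B. No inverse matrix
over A is presupposed, so non-degeneracy can be derived from it. -/
theorem ev_basis_mul (hι : ∀ f b, Commute (ι f) b) {P : BimodulePairing I B} {G : Matrix I I A}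
    (hP : IsInverseMetric (fun a b => ι (G a b)) P) (a b : I) :
    ∑ k, P.ev (tens (basis a) (basis k)) * ι (G k b) = if b = a then 1 else 0 := by
  rw [← basis_apply, ← (hP (basis a)).1 b]
  have h1 : tens (basis a) (fun k => ι (G k b)) = ∑ k, ι (G k b) • tens (basis a) (basis k) := by
    ext p q
    simp only [tens, basis_apply, Finset.sum_apply, Pi.smul_apply, smul_eq_mul]
    split_ifs <;> simp
  rw [h1, map_sum]
  refine Finset.sum_congr rfl fun k _ => ?_
  rw [P.ev_left, (hι _ _).eq]

/-- A left inverse with entries in B coincides with a right inverse with entries in A. Any inverse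
pairing therefore has central values on the basis. -/
theorem ev_basis (hι : ∀ f b, Commute (ι f) b) {P : BimodulePairing I B} {G Gi : Matrix I I A}
    (hP : IsInverseMetric (fun a b => ι (G a b)) P) (h' : G * Gi = 1) (a b : I) :
    P.ev (tens (basis a) (basis b)) = ι (Gi a b) := by
  have h1 : ∑ m, (∑ k, P.ev (tens (basis a) (basis k)) * ι (G k m)) * ι (Gi m b)
      = ι (Gi a b) := by
    simp [ev_basis_mul hι hP]
  rw [← h1]
  simp only [Finset.sum_mul, mul_assoc, ← map_mul]
  rw [Finset.sum_comm]
  simp only [← Finset.mul_sum, ← map_sum, ← Matrix.mul_apply, h', Matrix.one_apply]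
  simp

/-- The Ricci scalar of a connection with central coefficients. -/
theorem ricciScalar_connOf (hι : ∀ f b, Commute (ι f) b) {δ : I → Derivation ℂ A A}
    (hδ : ∀ a f, C.pd a (ι f) = ι (δ a f)) {G Gi : Matrix I I A} {P : BimodulePairing I B}
    (hP : IsInverseMetric (fun a b => ι (G a b)) P) (hG : G.IsSymm) (h' : G * Gi = 1)
    (Γ : I → Matrix I I A) :
    ricciScalar (connOf C ι hι Γ) (fun a b => ι (G a b)) P
      = ι ((1 / 2 : ℂ) • scalarCurv δ (fun l a b => algebraMap ℂ A (C.c l a b)) Gi Γ) := by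
  have hR : ∀ l p q k, curvature (connOf C ι hι Γ) (basis l) p q k
      = ι (curv δ (fun l a b => algebraMap ℂ A (C.c l a b)) Γ p q l k) := by
    intro l p q k
    simp only [curvature, d1, connOf_nabla_basis, hδ, wedge, tens, curv, Matrix.sub_apply,
      Matrix.add_apply, dmat_apply, Matrix.sum_apply, Matrix.smul_apply, smul_eq_mul,
      Matrix.mul_apply, map_sub, map_add, map_sum, map_mul, AlgHom.commutes,
      Finset.sum_sub_distrib]
    simp only [Algebra.smul_def]
  have hev : ∀ T : I → I → A, P.ev (fun a b => ι (T a b)) = ι (∑ a, ∑ b, Gi a b * T a b) := by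
    intro T
    rw [ev_central]
    simp only [ev_basis hι hP h', ← map_mul, ← map_sum, mul_comm]
  have hGi : Gi * G = 1 := mul_eq_one_comm.1 h'
  have hGis : Gi.IsSymm := by
    have h2 : Gi.transpose * G = 1 := by
      rw [← hG.eq, ← Matrix.transpose_mul, h', Matrix.transpose_one]
    calc Gi.transpose = Gi.transpose * (G * Gi) := by rw [h', mul_one]
      _ = Gi := by rw [← mul_assoc, h2, one_mul]
  have hric : ∀ b k, ricci (connOf C ι hι Γ) (fun a b => ι (G a b)) P b k
      = ι ((1 / 2 : ℂ) • ∑ l, curv δ (fun l a b => algebraMap ℂ A (C.c l a b)) Γ l b l k) := by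
    intro b k
    simp only [ricci, lift, hR, ← map_smul, ← map_mul, ← map_sum]
    rw [hev]
    congr 1
    simp only [Finset.mul_sum, Finset.smul_sum, mul_smul_comm]
    -- The metric inside the Ricci tensor cancels against the pairing and leaves a trace; the
    -- surviving factor 1/2 is that of the antisymmetric lift.
    have : ∀ a' l, ∑ a, Gi a a' * (G a l * curv δ (fun l a b => algebraMap ℂ A (C.c l a b)) Γ a' b l k)
        = if a' = l then curv δ (fun l a b => algebraMap ℂ A (C.c l a b)) Γ a' b l k else 0 := by
      intro a' l
      have h3 : ∑ a, Gi a a' * G a l = if a' = l then 1 else 0 := by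
        rw [← Matrix.one_apply, ← hGi, Matrix.mul_apply]
        exact Finset.sum_congr rfl fun a _ => by rw [hGis.apply a' a]
      simp only [← mul_assoc, ← Finset.sum_mul, h3]
      simp
    rw [Finset.sum_comm]
    refine Finset.sum_congr rfl fun a' _ => ?_
    rw [Finset.sum_comm]
    simp only [← Finset.smul_sum, this]
    simp
  rw [ricciScalar]
  have : ricci (connOf C ι hι Γ) (fun a b => ι (G a b)) P = fun b k => ι ((1 / 2 : ℂ) •
      ∑ l, curv δ (fun l a b => algebraMap ℂ A (C.c l a b)) Γ l b l k) := by
    ext b k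
    exact hric b k
  rw [this, hev, scalarCurv]
  congr 1
  simp only [mul_smul_comm, ← Finset.smul_sum]

end Central

/-! ## Change of frame -/

section FrameChange

variable {I A : Type} [Fintype I] [DecidableEq I] [CommRing A] [Algebra ℂ A]
  {δ : I → Derivation ℂ A A} {c c' : I → I → I → A} {M N : Matrix I I A}

theorem dmat_sum {J K L : Type} (d : Derivation ℂ A A) (s : Finset L) (X : L → Matrix J K A) :
    dmat d (∑ l ∈ s, X l) = ∑ l ∈ s, dmat d (X l) := by
  ext i j
  simp [Matrix.sum_apply]

theorem dmat_smul {J K : Type} (d : Derivation ℂ A A) (a : A) (X : Matrix J K A) :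
    dmat d (a • X) = d a • X + a • dmat d X := by
  ext i j
  simp [add_comm, mul_comm]

theorem dmat_sub {J K : Type} (d : Derivation ℂ A A) (X Y : Matrix J K A) :
    dmat d (X - Y) = dmat d X - dmat d Y := by
  ext i j
  simp

theorem dmat_transpose {J K : Type} (d : Derivation ℂ A A) (X : Matrix J K A) :
    dmat d X.transpose = (dmat d X).transpose := rfl

theorem dmat_inv (hNM : N * M = 1) (d : Derivation ℂ A A) :
    dmat d N = - (N * dmat d M * N) := by
  have hMN := mul_eq_one_comm.1 hNM
  have h := dmat_mul d N M
  rw [hNM, dmat_one] at h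
  calc dmat d N = (dmat d N * M) * N := by rw [mul_assoc, hMN, mul_one]
    _ = - (N * dmat d M) * N := by rw [eq_neg_of_add_eq_zero_left h.symm]
    _ = _ := by rw [neg_mul]

/-- The components, in the frame `e^a`, of the matrix of 1-forms `Γ_B M^B_b e^b`. -/
def pullForm (M : Matrix I I A) (Γ : I → Matrix I I A) (b : I) : Matrix I I A :=
  ∑ B, M B b • Γ B

/-- The connection coefficients in the frame `e^a` of a connection given by the coefficients `Γ` in
the frame `M^A_a e^a`; here `N` is the inverse of `M`. -/
def changeFrame (δ : I → Derivation ℂ A A) (M N : Matrix I I A) (Γ : I → Matrix I I A) (b : I) :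
    Matrix I I A :=
  N * (pullForm M Γ b * M - dmat (δ b) M)

/-- `N^p_A ∂_p` acts on functions as `∂_A`, and `c'` are the structure coefficients of the frame
`M^A_a e^a`, if those of `e^a` are `c`. -/
structure IsFrameChange (δ : I → Derivation ℂ A A) (c c' : I → I → I → A) (M N : Matrix I I A) :
    Prop where
  inv : N * M = 1
  der : ∀ p f, δ p f = ∑ B, M B p * δ B f
  comm : ∀ p q f, δ p (δ q f) - δ q (δ p f) + ∑ m, c m p q * δ m f = 0
  coeff : ∀ B p q, δ p (M B q) - δ q (M B p) + ∑ m, c m p q * M B m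
    = ∑ C, ∑ D, c' B C D * (M C p * M D q)

theorem dmat_frame (h : IsFrameChange δ c c' M N) (p : I) (X : Matrix I I A) :
    dmat (δ p) X = ∑ B, M B p • dmat (δ B) X := by
  ext i j
  simp [Matrix.sum_apply, h.der p (X i j)]

/-- The inhomogeneous term dM makes both conditions tensorial. In the torsion it is what `coeff`
requires, since `coeff` computes d of the new frame forms in two ways; in metricity it cancels the
derivatives of M in Mᵀ G M. -/
theorem IsLeviCivita.changeFrame (h : IsFrameChange δ c c' M N) {G : Matrix I I A}
    {Γ : I → Matrix I I A} (hΓ : IsLeviCivita δ c' G Γ) :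
    IsLeviCivita δ c (M.transpose * G * M) (changeFrame δ M N Γ) := by
  have hMN := mul_eq_one_comm.1 h.inv
  constructor
  · intro l a b
    have key : ∀ L, (pullForm M Γ a * M - dmat (δ a) M) L b - (pullForm M Γ b * M - dmat (δ b) M) L a
        = ∑ m, M L m * c m a b := by
      intro L
      have h1 : (pullForm M Γ a * M) L b - (pullForm M Γ b * M) L a
          = ∑ C, ∑ D, c' L C D * (M C a * M D b) := by
        simp only [Matrix.mul_apply, pullForm, Matrix.sum_apply, Matrix.smul_apply, smul_eq_mul,
          Finset.sum_mul]
        rw [Finset.sum_comm, ← Finset.sum_sub_distrib]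
        simp only [← Finset.sum_sub_distrib]
        refine Finset.sum_congr rfl fun C _ => Finset.sum_congr rfl fun D _ => ?_
        rw [← hΓ.torsion]
        ring
      rw [← h.coeff] at h1
      simp only [Matrix.sub_apply, dmat_apply]
      rw [sub_sub_sub_comm, h1]
      simp only [mul_comm (M L _)]
      ring
    simp only [FuzzyKK.changeFrame]
    rw [Matrix.mul_apply, Matrix.mul_apply, ← Finset.sum_sub_distrib]
    simp only [← mul_sub, key, Finset.mul_sum, ← mul_assoc]
    rw [Finset.sum_comm]
    simp only [← Finset.sum_mul, ← Matrix.mul_apply, h.inv, Matrix.one_apply]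
    simp
  · intro b
    have h1 : dmat (δ b) G + (pullForm M Γ b).transpose * G + G * pullForm M Γ b = 0 := by
      rw [dmat_frame h, pullForm]
      simp only [Matrix.transpose_sum, Matrix.transpose_smul, Finset.sum_mul, Finset.mul_sum,
        ← Finset.sum_add_distrib, smul_mul_assoc, mul_smul_comm, ← smul_add, hΓ.metric]
      simp
    have hG1 : M.transpose * G * M * FuzzyKK.changeFrame δ M N Γ b
        = M.transpose * G * (pullForm M Γ b * M - dmat (δ b) M) := by
      rw [FuzzyKK.changeFrame, ← mul_assoc, mul_assoc _ M N, hMN, mul_one]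
    have hG2 : (FuzzyKK.changeFrame δ M N Γ b).transpose * (M.transpose * G * M)
        = (pullForm M Γ b * M - dmat (δ b) M).transpose * (G * M) := by
      rw [FuzzyKK.changeFrame, Matrix.transpose_mul, mul_assoc, mul_assoc M.transpose,
        ← mul_assoc N.transpose, ← Matrix.transpose_mul, hMN, Matrix.transpose_one, one_mul]
    rw [hG1, hG2, dmat_mul, dmat_mul, dmat_transpose, Matrix.transpose_sub, Matrix.transpose_mul]
    have h2 : M.transpose * (dmat (δ b) G + (pullForm M Γ b).transpose * G + G * pullForm M Γ b) * M
        = 0 := by rw [h1]; simp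
    rw [← h2]
    noncomm_ring

/-- Terms quadratic in dM cancel through dN = -N dM N, and second derivatives of M cancel because d²
= 0 (`comm`). First derivatives of the coefficients of the pulled back form are traded by `coeff`
for the c' term of the curvature. -/
theorem curv_changeFrame (h : IsFrameChange δ c c' M N) (Γ : I → Matrix I I A) (p q : I) :
    curv δ c (changeFrame δ M N Γ) p q
      = N * (∑ C, ∑ D, (M C p * M D q) • curv δ c' Γ C D) * M := by
  have hMN := mul_eq_one_comm.1 h.inv
  set P := pullForm M Γ with hP
  -- The middle group on the right is symmetric in p and q, so it disappears on antisymmetrising.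
  have h1 : ∀ p q, dmat (δ p) (changeFrame δ M N Γ q)
        - changeFrame δ M N Γ p * changeFrame δ M N Γ q
      = N * ((dmat (δ p) (P q) - P p * P q) * M + (P q * dmat (δ p) M + P p * dmat (δ q) M)
          - dmat (δ p) (dmat (δ q) M)) := by
    intro p q
    have h2 : changeFrame δ M N Γ p * changeFrame δ M N Γ q
        = N * (P p * (P q * M - dmat (δ q) M) - dmat (δ p) M * N * (P q * M - dmat (δ q) M)) := by
      simp only [changeFrame, ← hP]
      have : M * (N * (P q * M - dmat (δ q) M)) = P q * M - dmat (δ q) M := by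
        rw [← mul_assoc, hMN, one_mul]
      rw [mul_assoc, sub_mul, mul_assoc (P p), this, mul_assoc (dmat (δ p) M)]
    rw [h2]
    simp only [changeFrame, ← hP]
    rw [dmat_mul, dmat_inv h.inv, dmat_sub, dmat_mul]
    noncomm_ring
  have h2 : dmat (δ p) (dmat (δ q) M) - dmat (δ q) (dmat (δ p) M) + ∑ m, c m p q • dmat (δ m) M
      = 0 := by
    ext i j
    simpa [Matrix.sum_apply] using h.comm p q (M i j)
  have h3 : curv δ c (changeFrame δ M N Γ) p q
      = N * (dmat (δ p) (P q) - dmat (δ q) (P p) + ∑ m, c m p q • P m - (P p * P q - P q * P p))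
          * M := by
    have h4 : ∑ m, c m p q • changeFrame δ M N Γ m
        = N * ((∑ m, c m p q • P m) * M - ∑ m, c m p q • dmat (δ m) M) := by
      simp only [changeFrame, Finset.sum_mul, ← Finset.sum_sub_distrib, Finset.mul_sum,
        ← hP, smul_mul_assoc, ← smul_sub, mul_smul_comm]
    rw [curv, h4]
    have h5 : ∀ a b s d e : Matrix I I A, a - b + s - (d - e) = (a - d) - (b - e) + s :=
      fun a b s d e => by abel
    rw [h5, h1 p q, h1 q p, eq_neg_of_add_eq_zero_right h2]
    noncomm_ring
  rw [h3]
  congr 2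
  have h4 : ∀ p q, dmat (δ p) (P q)
      = ∑ D, δ p (M D q) • Γ D + ∑ C, ∑ D, (M C p * M D q) • dmat (δ C) (Γ D) := by
    intro p q
    rw [hP, pullForm, dmat_sum]
    simp only [dmat_smul, Finset.sum_add_distrib]
    congr 1
    rw [Finset.sum_comm]
    refine Finset.sum_congr rfl fun D _ => ?_
    rw [dmat_frame h, Finset.smul_sum]
    refine Finset.sum_congr rfl fun C _ => ?_
    rw [smul_smul, mul_comm]
  have h5 : ∀ p q, P p * P q = ∑ C, ∑ D, (M C p * M D q) • (Γ C * Γ D) := by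
    intro p q
    simp only [hP, pullForm, Finset.sum_mul, Finset.mul_sum, smul_mul_assoc, mul_smul_comm,
      Finset.smul_sum, smul_smul]
    rw [Finset.sum_comm]
    simp only [mul_comm]
  have h6 : ∑ C, ∑ D, (M C p * M D q) • ∑ m, c' m C D • Γ m
      = ∑ D, δ p (M D q) • Γ D - ∑ D, δ q (M D p) • Γ D + ∑ m, c m p q • P m := by
    have : ∑ m, c m p q • P m = ∑ D, (∑ m, c m p q * M D m) • Γ D := by
      simp only [hP, pullForm, Finset.smul_sum, Finset.sum_smul, smul_smul]
      rw [Finset.sum_comm]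
    rw [this, ← Finset.sum_sub_distrib, ← Finset.sum_add_distrib]
    simp only [← sub_smul, ← add_smul, h.coeff]
    simp only [Finset.smul_sum, Finset.sum_smul, smul_smul]
    calc _ = ∑ C, ∑ m, ∑ D, (M C p * M D q * c' m C D) • Γ m :=
          Finset.sum_congr rfl fun C _ => Finset.sum_comm
      _ = ∑ m, ∑ C, ∑ D, (M C p * M D q * c' m C D) • Γ m := Finset.sum_comm
      _ = _ := by simp only [mul_comm (c' _ _ _)]
  have h7 : ∀ X : I → I → Matrix I I A, ∑ C, ∑ D, (M C p * M D q) • X D C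
      = ∑ C, ∑ D, (M C q * M D p) • X C D := fun X => by
    rw [Finset.sum_comm]
    simp only [mul_comm]
  simp only [curv, smul_sub, smul_add, Finset.sum_sub_distrib, Finset.sum_add_distrib, h6, h4, h5]
  rw [h7 fun C D => dmat (δ C) (Γ D), h7 fun C D => Γ C * Γ D]
  abel

/-- The contraction `R^l_{lbk}` of the curvature. -/
def ric (δ : I → Derivation ℂ A A) (c : I → I → I → A) (Γ : I → Matrix I I A) : Matrix I I A :=
  Matrix.of fun b k => ∑ l, curv δ c Γ l b l k

theorem scalarCurv_eq_trace (Gi : Matrix I I A) (Γ : I → Matrix I I A) :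
    scalarCurv δ c Gi Γ = (Gi.transpose * ric δ c Γ).trace := by
  simp only [scalarCurv, Matrix.trace, Matrix.diag, Matrix.mul_apply, Matrix.transpose_apply, ric,
    Matrix.of_apply]
  rw [Finset.sum_comm]

/-- The contracted form index carries M and the contracted endomorphism index carries N, so the
trace cancels them. -/
theorem ric_changeFrame (h : IsFrameChange δ c c' M N) (Γ : I → Matrix I I A) :
    ric δ c (changeFrame δ M N Γ) = M.transpose * ric δ c' Γ * M := by
  have hMN := mul_eq_one_comm.1 h.inv
  ext b k
  have h1 : ∀ C D, ∑ l, M C l * (N * curv δ c' Γ C D * M) l k = (curv δ c' Γ C D * M) C k := by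
    intro C D
    rw [← Matrix.mul_apply, mul_assoc, ← mul_assoc M, hMN, one_mul]
  have h2 : ∀ l, curv δ c (changeFrame δ M N Γ) l b l k
      = ∑ C, ∑ D, M D b * (M C l * (N * curv δ c' Γ C D * M) l k) := by
    intro l
    rw [curv_changeFrame h]
    simp only [Finset.mul_sum, Finset.sum_mul, Matrix.sum_apply, mul_smul_comm, smul_mul_assoc,
      Matrix.smul_apply, smul_eq_mul]
    exact Finset.sum_congr rfl fun C _ => Finset.sum_congr rfl fun D _ => by ring
  simp only [ric, Matrix.of_apply, h2]
  rw [Finset.sum_comm]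
  have h3 : ∀ C, ∑ l, ∑ D, M D b * (M C l * (N * curv δ c' Γ C D * M) l k)
      = ∑ D, M D b * (curv δ c' Γ C D * M) C k := by
    intro C
    rw [Finset.sum_comm]
    simp only [← Finset.mul_sum, h1]
  simp only [h3]
  rw [Finset.sum_comm, mul_assoc, Matrix.mul_apply]
  refine Finset.sum_congr rfl fun D _ => ?_
  rw [← Finset.mul_sum, Matrix.transpose_apply]
  congr 1
  simp only [Matrix.mul_apply, Matrix.of_apply, Finset.sum_mul]
  rw [Finset.sum_comm]

/-- The scalar curvature does not depend on the frame. -/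
theorem scalarCurv_changeFrame (h : IsFrameChange δ c c' M N) (Gi : Matrix I I A)
    (Γ : I → Matrix I I A) :
    scalarCurv δ c (N * Gi * N.transpose) (changeFrame δ M N Γ) = scalarCurv δ c' Gi Γ := by
  have hMN := mul_eq_one_comm.1 h.inv
  rw [scalarCurv_eq_trace, scalarCurv_eq_trace, ric_changeFrame h]
  have h1 : N.transpose * M.transpose = 1 := by
    rw [← Matrix.transpose_mul, hMN, Matrix.transpose_one]
  rw [Matrix.transpose_mul, Matrix.transpose_mul, Matrix.transpose_transpose, ← mul_assoc,
    Matrix.trace_mul_comm]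
  simp only [mul_assoc]
  rw [← mul_assoc N.transpose, h1, one_mul, ← mul_assoc M N, hMN, one_mul]

/-- For a torsion free connection the scalar curvature does not involve the structure
coefficients of the frame explicitly. -/
theorem scalarCurv_eq {Γ : I → Matrix I I A} (h : ∀ l a b, Γ a l b - Γ b l a = c l a b)
    (Gi : Matrix I I A) :
    scalarCurv δ c Gi Γ = ∑ b, ∑ k, Gi b k * (∑ l, δ l (Γ b l k) - δ b (∑ l, Γ l l k)
      - ∑ m, (∑ l, Γ l l m) * Γ b m k + ∑ l, ∑ m, Γ l m b * Γ m l k) := by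
  refine Finset.sum_congr rfl fun b _ => Finset.sum_congr rfl fun k _ => ?_
  congr 1
  simp only [curv, Matrix.sub_apply, Matrix.add_apply, dmat_apply, Matrix.sum_apply,
    Matrix.smul_apply, smul_eq_mul, Matrix.mul_apply, Finset.sum_add_distrib,
    Finset.sum_sub_distrib, ← h, map_sum, sub_mul, Finset.sum_mul]
  rw [Finset.sum_comm (f := fun m l => Γ l l m * Γ b m k),
    Finset.sum_comm (f := fun l m => Γ b m l * Γ m l k)]
  ring

end FrameChange

/-! ## The Levi-Civita connection of a Kaluza-Klein metric in an adapted frame -/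

/-- A Kaluza-Klein metric `g ⊕ h` in an adapted frame `d x^μ`, `θ^i`. Functions depend on the base
only, the fibre directions have structure coefficients `f`, and `d θ^i` has the base components
`F^i_{αβ}` and the mixed components `d θ^i (∂_j, ∂_α) = (W_α)^i_j`. The base and fibre Levi-Civita
connections are `K` and `L`. -/
structure KaluzaKlein (m κ A : Type) [Fintype m] [DecidableEq m] [Fintype κ] [DecidableEq κ]
    [CommRing A] [Algebra ℂ A] where
  d : m → Derivation ℂ A A
  f : κ → κ → κ → A
  g : Matrix m m A
  gi : Matrix m m A
  h : Matrix κ κ A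
  hi : Matrix κ κ A
  K : m → Matrix m m A
  L : κ → Matrix κ κ A
  F : κ → Matrix m m A
  W : m → Matrix κ κ A
  /-- one half -/
  r : A
  two_r : 2 * r = 1
  g_symm : g.IsSymm
  gi_mul : gi * g = 1
  h_symm : h.IsSymm
  hi_mul : hi * h = 1
  K_lc : IsLeviCivita d 0 g K
  L_lc : IsLeviCivita 0 f h L
  F_antisymm : ∀ i, (F i).transpose = - F i
  f_trace : ∀ j, ∑ i, f i i j = 0

theorem isSymm_of_mul_eq_one {J A : Type} [Fintype J] [DecidableEq J] [CommRing A]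
    {X Y : Matrix J J A} (hX : X.IsSymm) (h : Y * X = 1) : Y.IsSymm := by
  have h1 : X * Y.transpose = 1 := by
    rw [← hX.eq, ← Matrix.transpose_mul, h, Matrix.transpose_one]
  calc Y.transpose = (Y * X) * Y.transpose := by rw [h, one_mul]
    _ = Y := by rw [mul_assoc, h1, mul_one]

namespace KaluzaKlein

variable {m κ A : Type} [Fintype m] [DecidableEq m] [Fintype κ] [DecidableEq κ]
  [CommRing A] [Algebra ℂ A] (S : KaluzaKlein m κ A)

theorem g_mul : S.g * S.gi = 1 := mul_eq_one_comm.1 S.gi_mul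

theorem h_mul : S.h * S.hi = 1 := mul_eq_one_comm.1 S.hi_mul

theorem gi_symm : S.gi.IsSymm := isSymm_of_mul_eq_one S.g_symm S.gi_mul

theorem hi_symm : S.hi.IsSymm := isSymm_of_mul_eq_one S.h_symm S.hi_mul

/-- The covariant derivative of `h`. -/
def H (α : m) : Matrix κ κ A :=
  dmat (S.d α) S.h - S.h * S.W α - (S.h * S.W α).transpose

theorem H_symm (α : m) : (S.H α).IsSymm := by
  rw [Matrix.IsSymm, H, Matrix.transpose_sub, Matrix.transpose_sub, Matrix.transpose_transpose,
    ← dmat_transpose, S.h_symm.eq]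
  abel

/-- The curvature with its index lowered by `h`. -/
def Fl (i : κ) : Matrix m m A := ∑ j, S.h i j • S.F j

theorem Fl_antisymm (i : κ) : (S.Fl i).transpose = - S.Fl i := by
  simp only [Fl, Matrix.transpose_sum, Matrix.transpose_smul, S.F_antisymm, smul_neg,
    Finset.sum_neg_distrib]

/-- The dual vector fields of the adapted frame act on functions of the base. -/
def der : m ⊕ κ → Derivation ℂ A A := Sum.elim S.d 0

/-- The structure coefficients of the adapted frame. -/
def coeff : m ⊕ κ → m ⊕ κ → m ⊕ κ → A
  | .inr i, .inl α, .inl β => S.F i α β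
  | .inr i, .inl α, .inr j => - S.W α i j
  | .inr i, .inr j, .inl α => S.W α i j
  | .inr i, .inr j, .inr k => S.f i j k
  | .inl _, _, _ => 0

/-- The metric in the adapted frame. -/
def metric : Matrix (m ⊕ κ) (m ⊕ κ) A := Matrix.fromBlocks S.g 0 0 S.h

/-- The inverse metric in the adapted frame. -/
def metricInv : Matrix (m ⊕ κ) (m ⊕ κ) A := Matrix.fromBlocks S.gi 0 0 S.hi

/-- The Levi-Civita connection in the adapted frame. -/
def conn : m ⊕ κ → Matrix (m ⊕ κ) (m ⊕ κ) A
  | .inl α => Matrix.fromBlocks (S.K α) (Matrix.of fun l i => S.r * (S.gi * S.Fl i) l α)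
      (Matrix.of fun i β => S.r * S.F i α β) (- (S.r • (S.hi * S.H α)) - S.W α)
  | .inr i => Matrix.fromBlocks (S.r • (S.gi * S.Fl i))
      (Matrix.of fun l j => S.r * ∑ α, S.gi l α * S.H α i j)
      (Matrix.of fun j α => - (S.r * (S.hi * S.H α) j i)) (S.L i)

theorem gi_mul_g_mul {κ' : Type} (X : Matrix m κ' A) : S.g * (S.gi * X) = X := by
  rw [← Matrix.mul_assoc, S.g_mul, Matrix.one_mul]

theorem hi_mul_h_mul {κ' : Type} (X : Matrix κ κ' A) : S.h * (S.hi * X) = X := by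
  rw [← Matrix.mul_assoc, S.h_mul, Matrix.one_mul]

/-- The two halves of F add up by antisymmetry. The H terms cancel, by symmetry of H when both lower
indices are fibre indices and directly in the mixed component, where only W remains. -/
theorem conn_torsion (a b c : m ⊕ κ) : S.conn b a c - S.conn c a b = S.coeff a b c := by
  have hF : ∀ i α β, S.F i β α = - S.F i α β := fun i α β =>
    congrFun (congrFun (S.F_antisymm i) α) β
  rcases a with l | i <;> rcases b with α | j <;> rcases c with β | k
  · simpa [conn, coeff] using S.K_lc.torsion l α β
  · simp [conn, coeff]
  · simp [conn, coeff]
  · simp [conn, coeff, (S.H_symm _).apply j k]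
  · simp only [conn, coeff, Matrix.fromBlocks_apply₂₁, Matrix.of_apply, hF i α β]
    linear_combination S.F i α β * S.two_r
  · simp [conn, coeff]
    ring
  · simp [conn, coeff]
  · simpa [conn, coeff] using S.L_lc.torsion i j k

theorem Fl_apply (i : κ) (α β : m) : S.Fl i α β = ∑ j, S.h i j * S.F j α β := by
  simp [Fl, Matrix.sum_apply]

theorem Fl_swap (i : κ) (α β : m) : S.Fl i β α = - S.Fl i α β :=
  congrFun (congrFun (S.Fl_antisymm i) α) β

/-- Lowering an index turns every mixed block into a half of `Fl` or of H, and these cancel by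
antisymmetry of `Fl` and symmetry of H. When h itself is differentiated, the two halves of H
together with the W terms make up exactly dh. -/
theorem conn_metric (a : m ⊕ κ) :
    dmat (S.der a) S.metric + (S.conn a).transpose * S.metric + S.metric * S.conn a = 0 := by
  have hg : ∀ i β α, ∑ l, S.g β l * (S.r * (S.gi * S.Fl i) l α) = S.r * S.Fl i β α := by
    intro i β α
    simp only [mul_left_comm _ S.r, ← Finset.mul_sum]
    rw [← Matrix.mul_apply, S.gi_mul_g_mul]
  have hg' : ∀ i β α, ∑ l, S.r * (S.gi * S.Fl i) l α * S.g l β = S.r * S.Fl i β α := by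
    intro i β α
    rw [← hg]
    exact Finset.sum_congr rfl fun l _ => by rw [S.g_symm.apply β l, mul_comm]
  have hF : ∀ i α β, ∑ j, S.r * S.F j α β * S.h j i = S.r * S.Fl i α β := by
    intro i α β
    rw [Fl_apply, Finset.mul_sum]
    exact Finset.sum_congr rfl fun j _ => by rw [S.h_symm.apply i j]; ring
  have hF' : ∀ i α β, ∑ j, S.h i j * (S.r * S.F j α β) = S.r * S.Fl i α β := by
    intro i α β
    rw [Fl_apply, Finset.mul_sum]
    exact Finset.sum_congr rfl fun j _ => by ring
  have hH : ∀ α j i, ∑ k, S.h j k * (S.r * (S.hi * S.H α) k i) = S.r * S.H α j i := by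
    intro α j i
    simp only [mul_left_comm _ S.r, ← Finset.mul_sum]
    rw [← Matrix.mul_apply, S.hi_mul_h_mul]
  have hH' : ∀ α j i, ∑ k, S.r * (S.hi * S.H α) k i * S.h k j = S.r * S.H α j i := by
    intro α j i
    rw [← hH]
    exact Finset.sum_congr rfl fun k _ => by rw [S.h_symm.apply j k, mul_comm]
  have hgH : ∀ i j β, ∑ l, S.g β l * (S.r * ∑ α, S.gi l α * S.H α i j) = S.r * S.H β i j := by
    intro i j β
    have := congrFun (congrFun (S.gi_mul_g_mul (Matrix.of fun α (_ : Unit) => S.H α i j)) β) ()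
    simp only [Matrix.mul_apply, Matrix.of_apply] at this
    rw [← this, Finset.mul_sum]
    exact Finset.sum_congr rfl fun k _ => by ring
  have hgH' : ∀ i j β, ∑ l, (S.r * ∑ α, S.gi l α * S.H α i j) * S.g l β = S.r * S.H β i j := by
    intro i j β
    rw [← hgH]
    exact Finset.sum_congr rfl fun l _ => by rw [S.g_symm.apply β l, mul_comm]
  ext b k
  rcases a with α | i
  · rcases b with β | j <;> rcases k with γ | k <;>
      simp only [Matrix.add_apply, Matrix.mul_apply, Matrix.transpose_apply, Fintype.sum_sum_type,
        conn, metric, dmat_apply, der, Matrix.fromBlocks_apply₁₁, Matrix.fromBlocks_apply₁₂,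
        Matrix.fromBlocks_apply₂₁, Matrix.fromBlocks_apply₂₂, Matrix.zero_apply, mul_zero, zero_mul,
        Finset.sum_const_zero, add_zero, zero_add, Matrix.of_apply, map_zero, Sum.elim_inl]
    · simpa [Matrix.mul_apply] using congrFun (congrFun (S.K_lc.metric α) β) γ
    · rw [hF]
      simp only [← Matrix.mul_apply]
      rw [hg, S.Fl_swap k β α]
      ring
    · rw [hF']
      simp only [← Matrix.mul_apply]
      rw [hg', S.Fl_swap j γ α]
      ring
    · simp only [Matrix.sub_apply, Matrix.neg_apply, Matrix.smul_apply, smul_eq_mul, mul_sub,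
        sub_mul, Finset.sum_sub_distrib, mul_neg, neg_mul, Finset.sum_neg_distrib]
      rw [hH, hH', (S.H_symm α).apply j k]
      have h1 : ∑ l, S.W α l j * S.h l k = (S.h * S.W α) k j := by
        rw [Matrix.mul_apply]
        exact Finset.sum_congr rfl fun l _ => by rw [S.h_symm.apply k l, mul_comm]
      have h2 : S.H α j k = S.d α (S.h j k) - (S.h * S.W α) j k - (S.h * S.W α) k j := rfl
      rw [h1, ← Matrix.mul_apply]
      linear_combination -(S.H α j k) * S.two_r - h2
  · rcases b with β | j <;> rcases k with γ | k <;>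
      simp only [Matrix.add_apply, Matrix.mul_apply, Matrix.transpose_apply, Fintype.sum_sum_type,
        conn, metric, dmat_apply, der, Matrix.fromBlocks_apply₁₁, Matrix.fromBlocks_apply₁₂,
        Matrix.fromBlocks_apply₂₁, Matrix.fromBlocks_apply₂₂, Matrix.zero_apply, mul_zero, zero_mul,
        Finset.sum_const_zero, add_zero, zero_add, Matrix.of_apply, Sum.elim_inr,
        Pi.zero_apply, Derivation.zero_apply, Matrix.smul_apply, smul_eq_mul, neg_mul, mul_neg,
        Finset.sum_neg_distrib]
    · simp only [← Matrix.mul_apply]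
      rw [hg, hg', S.Fl_swap i β γ]
      ring
    · simp only [← Matrix.mul_apply]
      rw [hH', hgH, (S.H_symm β).apply i k]
      ring
    · simp only [← Matrix.mul_apply]
      rw [hH, hgH', (S.H_symm γ).apply i j]
      ring
    · simpa [Matrix.mul_apply] using congrFun (congrFun (S.L_lc.metric i) j) k

theorem conn_isLeviCivita : IsLeviCivita S.der S.coeff S.metric S.conn :=
  ⟨S.conn_torsion, S.conn_metric⟩

end KaluzaKlein

/-! ## The scalar curvature of a Kaluza-Klein metric -/

section Contraction

variable {J A : Type} [Fintype J] [CommRing A] [Algebra ℂ A]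

/-- The full contraction of two matrices. -/
def contr (X Y : Matrix J J A) : A := ∑ i, ∑ j, X i j * Y i j

theorem contr_eq_trace (X Y : Matrix J J A) : contr X Y = (X.transpose * Y).trace := by
  simp only [contr, Matrix.trace, Matrix.diag, Matrix.mul_apply, Matrix.transpose_apply]
  exact Finset.sum_comm

theorem contr_smul (X Y : Matrix J J A) (a : A) : contr X (a • Y) = a * contr X Y := by
  simp only [contr, Matrix.smul_apply, smul_eq_mul, mul_left_comm _ a, Finset.mul_sum]

theorem contr_sum {L : Type} (s : Finset L) (X : Matrix J J A) (Y : L → Matrix J J A) :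
    contr X (∑ l ∈ s, Y l) = ∑ l ∈ s, contr X (Y l) := by
  simp only [contr_eq_trace, Matrix.mul_sum, Matrix.trace_sum]

theorem der_contr (d : Derivation ℂ A A) (X Y : Matrix J J A) :
    d (contr X Y) = contr (dmat d X) Y + contr X (dmat d Y) := by
  simp only [contr, map_sum, Derivation.leibniz, smul_eq_mul, dmat_apply,
    ← Finset.sum_add_distrib]
  exact Finset.sum_congr rfl fun i _ => Finset.sum_congr rfl fun j _ => by ring

end Contraction

/-! ### Trace identities on a unimodular fibre -/

section Fibre

variable {κ A : Type} [Fintype κ] [DecidableEq κ] [CommRing A] [Algebra ℂ A]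
  {f : κ → κ → κ → A} {h hi : Matrix κ κ A} {L : κ → Matrix κ κ A} {r : A}

/-- The fibre directions do not differentiate h, so metricity makes L_j antisymmetric with respect
to h, hence traceless. -/
theorem trace_conn_eq_zero (hr : 2 * r = 1) (hh : hi * h = 1)
    (hL : IsLeviCivita (0 : κ → Derivation ℂ A A) f h L) (j : κ) : (L j).trace = 0 := by
  have h1 : (L j).transpose * h + h * L j = 0 := by
    have h0 : dmat (0 : Derivation ℂ A A) h = 0 := rfl
    have := hL.metric j
    rwa [Pi.zero_apply, h0, zero_add] at this
  have h2 : L j = - (hi * (L j).transpose * h) := by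
    rw [mul_assoc, eq_neg_of_add_eq_zero_left h1, mul_neg, neg_neg, ← mul_assoc, hh, one_mul]
  have h3 : (L j).trace = - (L j).trace := by
    conv_lhs => rw [h2]
    rw [Matrix.trace_neg, mul_assoc, Matrix.trace_mul_comm, mul_assoc, mul_eq_one_comm.1 hh,
      mul_one, Matrix.trace_transpose]
  linear_combination r * h3 - (L j).trace * hr

/-- Vanishing torsion converts a contraction with the form index into Tr L_j plus a trace of
structure constants, and the latter is zero by unimodularity. -/
theorem trace_fibre_eq_zero (hr : 2 * r = 1) (hh : hi * h = 1)
    (hL : IsLeviCivita (0 : κ → Derivation ℂ A A) f h L) (hf : ∀ j, ∑ i, f i i j = 0) (j : κ) :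
    ∑ i, L i i j = 0 := by
  have h1 := trace_conn_eq_zero hr hh hL j
  rw [← hf j, ← sub_eq_zero]
  simp only [← hL.torsion, Finset.sum_sub_distrib, sub_sub_cancel]
  exact h1

/-- The scalar curvature of a left invariant metric on a unimodular group. -/
theorem scalarCurv_fibre (hr : 2 * r = 1) (hh : hi * h = 1)
    (hL : IsLeviCivita (0 : κ → Derivation ℂ A A) f h L) (hf : ∀ j, ∑ i, f i i j = 0) :
    scalarCurv (0 : κ → Derivation ℂ A A) f hi L
      = ∑ i, ∑ j, hi i j * ∑ k, ∑ l, L k l i * L l k j := by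
  rw [scalarCurv_eq hL.torsion]
  simp [trace_fibre_eq_zero hr hh hL hf]

end Fibre

namespace KaluzaKlein

variable {m κ A : Type} [Fintype m] [DecidableEq m] [Fintype κ] [DecidableEq κ]
  [CommRing A] [Algebra ℂ A] (S : KaluzaKlein m κ A)

/-- `Φ_α = h⁻¹ ∇_α h`. -/
def P (α : m) : Matrix κ κ A := S.hi * S.H α

/-- `Tr Φ_α`. -/
def t (α : m) : A := (S.P α).trace

/-- The trace `K^l_{lβ}` of the base connection. -/
def kt (β : m) : A := ∑ l, S.K l l β

/-- The scalar curvature of the base. -/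
def baseScalar : A := ∑ α, ∑ β, S.gi α β * (∑ l, S.d l (S.K α l β) - S.d α (S.kt β)
  - ∑ μ, S.kt μ * S.K α μ β + ∑ l, ∑ μ, S.K l μ α * S.K μ l β)

/-- The scalar curvature of the fibre. -/
def fibreScalar : A := ∑ i, ∑ j, S.hi i j * ∑ k, ∑ l, S.L k l i * S.L l k j

/-- The square of the curvature, up to sign. -/
def Y : A := ∑ i, (S.F i * S.gi * S.Fl i * S.gi).trace

theorem der_r (d : Derivation ℂ A A) : d S.r = 0 := by
  have h : d (2 * S.r) = 0 := by rw [S.two_r]; exact d.map_one_eq_zero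
  rw [two_mul, map_add] at h
  linear_combination S.r * h - d S.r * S.two_r

theorem trace_gi_Fl (j : κ) : (S.gi * S.Fl j).trace = 0 := by
  have h : (S.gi * S.Fl j).trace = - (S.gi * S.Fl j).trace := by
    conv_lhs => rw [← Matrix.trace_transpose, Matrix.transpose_mul, S.Fl_antisymm, S.gi_symm.eq,
      neg_mul, Matrix.trace_neg, Matrix.trace_mul_comm]
  linear_combination S.r * h - (S.gi * S.Fl j).trace * S.two_r

/-- This contraction enters `scalarCurv_eq` twice. Beyond the base contribution it sees only the
mean curvature of the fibres, a multiple of Tr Φ_β. -/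
theorem trace_conn_inl (β : m) : ∑ a, S.conn a a (.inl β) = S.kt β - S.r * S.t β := by
  simp [conn, kt, t, P, Matrix.trace, Finset.mul_sum, sub_eq_add_neg]

theorem trace_conn_inr (j : κ) : ∑ a, S.conn a a (.inr j) = 0 := by
  have h1 : ∑ l, S.r * (S.gi * S.Fl j) l l = 0 := by
    rw [← Finset.mul_sum]
    exact (congrArg (S.r * ·) (S.trace_gi_Fl j)).trans (mul_zero _)
  simp [conn, h1, trace_fibre_eq_zero S.two_r S.hi_mul S.L_lc S.f_trace]

theorem contr_hi_H (α : m) : contr S.hi (S.H α) = S.t α := by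
  rw [contr_eq_trace, S.hi_symm.eq]
  rfl

/-- Metricity of K, transferred to the inverse metric and contracted. It is needed because
`fibre_block` differentiates the inverse base metric. -/
theorem der_gi (α : m) : ∑ l, S.d l (S.gi l α)
    = ∑ l, ∑ β, S.gi l β * S.K l α β + ∑ β, S.kt β * S.gi β α := by
  have h : ∀ l, dmat (S.d l) S.gi = S.gi * (S.K l).transpose + S.K l * S.gi := by
    intro l
    have h1 : dmat (S.d l) S.g = - ((S.K l).transpose * S.g + S.g * S.K l) := by
      have := S.K_lc.metric l
      rw [add_assoc] at this
      exact eq_neg_of_add_eq_zero_left this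
    rw [dmat_inv S.gi_mul, h1]
    calc _ = S.gi * (S.K l).transpose * (S.g * S.gi) + (S.gi * S.g) * S.K l * S.gi := by
          noncomm_ring
      _ = _ := by rw [S.g_mul, S.gi_mul, mul_one, one_mul]
  have h2 : ∀ l, S.d l (S.gi l α) = ∑ β, S.gi l β * S.K l α β + ∑ β, S.K l l β * S.gi β α := by
    intro l
    have := congrFun (congrFun (h l) l) α
    simpa [Matrix.mul_apply] using this
  simp only [h2, Finset.sum_add_distrib, kt, Finset.sum_mul]
  congr 1
  exact Finset.sum_comm

theorem contr_gi_F (i : κ) :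
    ∑ α, ∑ β, S.gi α β * ∑ l, S.F i l α * (S.gi * S.Fl i) l β
      = - (S.F i * S.gi * S.Fl i * S.gi).trace := by
  have h : ∀ α β, ∑ l, S.F i l α * (S.gi * S.Fl i) l β
      = ((S.F i).transpose * (S.gi * S.Fl i)) α β := fun α β => rfl
  simp only [h]
  change contr S.gi _ = _
  rw [contr_eq_trace, S.F_antisymm, S.gi_symm.eq, Matrix.trace_mul_comm, neg_mul, neg_mul,
    Matrix.trace_neg, ← mul_assoc]

/-- The two sums that pair F with the raised `Fl` agree by symmetry of the inverse metric, and each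
gives -r² Y. The mean curvature in the connection trace supplies half of the Laplacian term;
`fibre_block` supplies the other half. -/
theorem base_block :
    ∑ α, ∑ β, S.gi α β * (∑ l, S.d l (S.K α l β) - S.d α (S.kt β - S.r * S.t β)
        - ∑ μ, (S.kt μ - S.r * S.t μ) * S.K α μ β
        + (∑ l, ∑ μ, S.K l μ α * S.K μ l β
          + ∑ l, ∑ i, S.r * S.F i l α * (S.r * (S.gi * S.Fl i) l β)
          + ∑ i, ∑ l, S.r * (S.gi * S.Fl i) l α * (S.r * S.F i l β)
          + ∑ i, ∑ j, S.r * S.P α j i * (S.r * S.P β i j)))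
      = S.baseScalar + S.r * ∑ α, ∑ β, S.gi α β * S.d α (S.t β)
        + S.r * ∑ α, ∑ β, S.gi α β * ∑ μ, S.t μ * S.K α μ β - 2 * S.r ^ 2 * S.Y
        + S.r ^ 2 * ∑ α, ∑ β, S.gi α β * (S.P α * S.P β).trace := by
  have h1 : ∑ α, ∑ β, S.gi α β * ∑ l, ∑ i, S.r * S.F i l α * (S.r * (S.gi * S.Fl i) l β)
      = - (S.r ^ 2 * S.Y) := by
    have h : ∀ α β, S.gi α β * ∑ l, ∑ i, S.r * S.F i l α * (S.r * (S.gi * S.Fl i) l β)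
        = ∑ i, S.r ^ 2 * (S.gi α β * ∑ l, S.F i l α * (S.gi * S.Fl i) l β) := by
      intro α β
      rw [Finset.sum_comm]
      simp only [Finset.mul_sum]
      exact Finset.sum_congr rfl fun i _ => Finset.sum_congr rfl fun l _ => by ring
    simp only [h]
    calc _ = ∑ α, ∑ i, ∑ β, S.r ^ 2 * (S.gi α β * ∑ l, S.F i l α * (S.gi * S.Fl i) l β) :=
          Finset.sum_congr rfl fun α _ => Finset.sum_comm
      _ = ∑ i, ∑ α, ∑ β, S.r ^ 2 * (S.gi α β * ∑ l, S.F i l α * (S.gi * S.Fl i) l β) :=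
          Finset.sum_comm
      _ = _ := by
          simp only [← Finset.mul_sum]
          simp only [contr_gi_F, Y, Finset.sum_neg_distrib, mul_neg]
  have h2 : ∑ α, ∑ β, S.gi α β * ∑ i, ∑ l, S.r * (S.gi * S.Fl i) l α * (S.r * S.F i l β)
      = - (S.r ^ 2 * S.Y) := by
    rw [← h1, Finset.sum_comm]
    refine Finset.sum_congr rfl fun α _ => Finset.sum_congr rfl fun β _ => ?_
    rw [S.gi_symm.apply, Finset.sum_comm]
    congr 1
    exact Finset.sum_congr rfl fun i _ => Finset.sum_congr rfl fun l _ => by ring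
  have h3 : ∀ α β, ∑ i, ∑ j, S.r * S.P α j i * (S.r * S.P β i j)
      = S.r ^ 2 * (S.P α * S.P β).trace := by
    intro α β
    simp only [Matrix.trace, Matrix.diag, Matrix.mul_apply, Finset.mul_sum]
    rw [Finset.sum_comm]
    exact Finset.sum_congr rfl fun i _ => Finset.sum_congr rfl fun l _ => by ring
  have h4 : ∀ α β, S.gi α β * (∑ l, S.d l (S.K α l β) - S.d α (S.kt β - S.r * S.t β)
        - ∑ μ, (S.kt μ - S.r * S.t μ) * S.K α μ β
        + (∑ l, ∑ μ, S.K l μ α * S.K μ l β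
          + ∑ l, ∑ i, S.r * S.F i l α * (S.r * (S.gi * S.Fl i) l β)
          + ∑ i, ∑ l, S.r * (S.gi * S.Fl i) l α * (S.r * S.F i l β)
          + ∑ i, ∑ j, S.r * S.P α j i * (S.r * S.P β i j)))
      = S.gi α β * (∑ l, S.d l (S.K α l β) - S.d α (S.kt β)
          - ∑ μ, S.kt μ * S.K α μ β + ∑ l, ∑ μ, S.K l μ α * S.K μ l β)
        + S.r * (S.gi α β * S.d α (S.t β))
        + S.r * (S.gi α β * ∑ μ, S.t μ * S.K α μ β)
        + S.gi α β * (∑ l, ∑ i, S.r * S.F i l α * (S.r * (S.gi * S.Fl i) l β))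
        + S.gi α β * (∑ i, ∑ l, S.r * (S.gi * S.Fl i) l α * (S.r * S.F i l β))
        + S.r ^ 2 * (S.gi α β * (S.P α * S.P β).trace) := by
    intro α β
    rw [h3]
    simp only [map_sub, Derivation.leibniz, S.der_r, smul_eq_mul, mul_zero, add_zero, sub_mul,
      mul_assoc, Finset.sum_sub_distrib, ← Finset.mul_sum]
    ring
  simp only [h4, Finset.sum_add_distrib, h1, h2, ← Finset.mul_sum]
  rw [baseScalar]
  ring

theorem contr_hi_Fl (l : κ) : ∑ j, S.hi l j • S.Fl j = S.F l := by
  simp only [Fl, Finset.smul_sum, smul_smul]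
  rw [Finset.sum_comm]
  simp only [← Finset.sum_smul, ← Matrix.mul_apply, S.hi_mul, Matrix.one_apply]
  simp

/-- The gauge part of dh is hW plus its transpose, and both have the same trace against the
symmetric matrices h⁻¹ and H. -/
theorem two_trace_W (l α : m) : 2 * (S.W l * S.hi * S.H α).trace
    = (S.hi * dmat (S.d l) S.h * S.hi * S.H α).trace - (S.P l * S.P α).trace := by
  have h1 : (S.hi * (S.h * S.W l) * S.hi * S.H α).trace = (S.W l * S.hi * S.H α).trace := by
    rw [← mul_assoc S.hi, S.hi_mul, one_mul]
  have h2 : (S.hi * (S.h * S.W l).transpose * S.hi * S.H α).trace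
      = (S.W l * S.hi * S.H α).trace := by
    rw [← h1, ← Matrix.trace_transpose]
    simp only [Matrix.transpose_mul, S.hi_symm.eq, S.h_symm.eq, (S.H_symm α).eq,
      Matrix.transpose_transpose]
    rw [Matrix.trace_mul_comm]
    simp only [mul_assoc]
  have h3 : dmat (S.d l) S.h = S.H l + S.h * S.W l + (S.h * S.W l).transpose := by
    rw [H]; abel
  rw [h3, two_mul]
  nth_rw 1 [← h1]
  rw [← h2, P, P]
  simp only [mul_add, add_mul, Matrix.trace_add, mul_assoc]
  ring

/-- Moving h⁻¹ inside the derivative produces Tr Φ and a trace with dh. That trace cancels against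
the W terms and the Tr(Φ_α Φ_β) terms of the connection products, so the bare gauge field drops out.
The divergence of the inverse base metric cancels the base part of the connection trace. -/
theorem fibre_block :
    ∑ i, ∑ j, S.hi i j * (∑ l, S.d l (S.r * ∑ α, S.gi l α * S.H α i j)
        - ∑ μ, (S.kt μ - S.r * S.t μ) * (S.r * ∑ α, S.gi μ α * S.H α i j)
        + (∑ l, ∑ μ, S.r * (S.gi * S.Fl i) μ l * (S.r * (S.gi * S.Fl j) l μ)
          + ∑ l, ∑ k, (- (S.r * S.P l k i) - S.W l k i) * (S.r * ∑ α, S.gi l α * S.H α k j)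
          + ∑ k, ∑ l, (S.r * ∑ α, S.gi l α * S.H α k i) * (- (S.r * S.P l k j) - S.W l k j)
          + ∑ k, ∑ l, S.L k l i * S.L l k j))
      = S.fibreScalar + S.r * ∑ α, ∑ β, S.gi α β * S.d α (S.t β)
        + S.r * ∑ α, ∑ β, S.gi α β * ∑ μ, S.t μ * S.K α μ β + S.r ^ 2 * S.Y
        + S.r ^ 2 * ∑ α, ∑ β, S.gi α β * (S.t α * S.t β) := by
  set Z : m → Matrix κ κ A := fun l => ∑ α, (S.r * S.gi l α) • S.H α with hZ
  have hZa : ∀ l i j, S.r * ∑ α, S.gi l α * S.H α i j = Z l i j := by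
    intro l i j
    simp only [hZ, Matrix.sum_apply, Matrix.smul_apply, smul_eq_mul, Finset.mul_sum, mul_assoc]
  have hcZ : ∀ X l, contr X (Z l) = S.r * ∑ α, S.gi l α * contr X (S.H α) := by
    intro X l
    simp only [hZ, contr_sum, contr_smul, Finset.mul_sum, mul_assoc]
  have hdh : ∀ l α, contr (dmat (S.d l) S.hi) (S.H α)
      = - (S.hi * dmat (S.d l) S.h * S.hi * S.H α).trace := by
    intro l α
    rw [contr_eq_trace, ← dmat_transpose, S.hi_symm.eq, dmat_inv S.hi_mul, neg_mul,
      Matrix.trace_neg]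
  have h1 : ∑ i, ∑ j, S.hi i j * ∑ l, S.d l (Z l i j)
      = S.r * ∑ α, ∑ β, S.gi α β * S.d α (S.t β)
        + S.r * ∑ α, ∑ β, S.gi α β * ∑ μ, S.t μ * S.K α μ β
        + S.r * ∑ μ, S.kt μ * ∑ α, S.gi μ α * S.t α
        + S.r * ∑ l, ∑ α, S.gi l α * (S.hi * dmat (S.d l) S.h * S.hi * S.H α).trace := by
    have h : ∑ i, ∑ j, S.hi i j * ∑ l, S.d l (Z l i j) = contr S.hi (∑ l, dmat (S.d l) (Z l)) := by
      simp only [contr, Matrix.sum_apply, dmat_apply]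
    have h' : ∀ l, contr S.hi (dmat (S.d l) (Z l))
        = S.r * ∑ α, S.t α * S.d l (S.gi l α) + S.r * ∑ α, S.gi l α * S.d l (S.t α)
          + S.r * ∑ α, S.gi l α * (S.hi * dmat (S.d l) S.h * S.hi * S.H α).trace := by
      intro l
      have := der_contr (S.d l) S.hi (Z l)
      rw [hcZ, hcZ] at this
      simp only [contr_hi_H, hdh, Derivation.leibniz, S.der_r, map_sum, smul_eq_mul, mul_zero,
        add_zero, mul_neg, Finset.sum_neg_distrib, Finset.sum_add_distrib] at this
      linear_combination - this
    rw [h, contr_sum]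
    simp only [h', Finset.sum_add_distrib, ← Finset.mul_sum]
    rw [Finset.sum_comm (f := fun l α => S.t α * S.d l (S.gi l α))]
    simp only [← Finset.mul_sum, der_gi, mul_add, Finset.sum_add_distrib]
    have h2 : ∑ α, S.t α * ∑ l, ∑ β, S.gi l β * S.K l α β
        = ∑ α, ∑ β, S.gi α β * ∑ μ, S.t μ * S.K α μ β := by
      simp only [Finset.mul_sum]
      rw [Finset.sum_comm]
      refine Finset.sum_congr rfl fun l _ => ?_
      rw [Finset.sum_comm]
      exact Finset.sum_congr rfl fun α _ => Finset.sum_congr rfl fun β _ => by ring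
    have h3 : ∑ α, S.t α * ∑ β, S.kt β * S.gi β α = ∑ μ, S.kt μ * ∑ α, S.gi μ α * S.t α := by
      simp only [Finset.mul_sum]
      rw [Finset.sum_comm]
      exact Finset.sum_congr rfl fun α _ => Finset.sum_congr rfl fun β _ => by ring
    rw [h2, h3]
    ring
  have h2 : ∑ i, ∑ j, S.hi i j * ∑ μ, (S.kt μ - S.r * S.t μ) * Z μ i j
      = S.r * ∑ μ, S.kt μ * ∑ α, S.gi μ α * S.t α
        - S.r ^ 2 * ∑ α, ∑ β, S.gi α β * (S.t α * S.t β) := by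
    have h : ∑ i, ∑ j, S.hi i j * ∑ μ, (S.kt μ - S.r * S.t μ) * Z μ i j
        = contr S.hi (∑ μ, (S.kt μ - S.r * S.t μ) • Z μ) := by
      simp only [contr, Matrix.sum_apply, Matrix.smul_apply, smul_eq_mul]
    rw [h, contr_sum]
    simp only [contr_smul, hcZ, contr_hi_H, sub_mul, Finset.sum_sub_distrib, Finset.mul_sum]
    congr 1
    · exact Finset.sum_congr rfl fun α _ => Finset.sum_congr rfl fun β _ => by ring
    · exact Finset.sum_congr rfl fun α _ => Finset.sum_congr rfl fun β _ => by ring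
  have h3 : ∑ i, ∑ j, S.hi i j * ∑ l, ∑ μ, S.r * (S.gi * S.Fl i) μ l * (S.r * (S.gi * S.Fl j) l μ)
      = S.r ^ 2 * S.Y := by
    rw [Y, Finset.mul_sum]
    refine Finset.sum_congr rfl fun i _ => ?_
    have h : ∀ j, ∑ l, ∑ μ, S.r * (S.gi * S.Fl i) μ l * (S.r * (S.gi * S.Fl j) l μ)
        = S.r ^ 2 * (S.gi * S.Fl i * (S.gi * S.Fl j)).trace := by
      intro j
      have htr : ∀ X Y : Matrix m m A, (X * Y).trace = ∑ l, ∑ μ, X l μ * Y μ l := fun _ _ => rfl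
      rw [Matrix.trace_mul_comm, htr]
      simp only [Finset.mul_sum]
      exact Finset.sum_congr rfl fun α _ => Finset.sum_congr rfl fun β _ => by ring
    have h' : (S.F i * S.gi * S.Fl i * S.gi).trace
        = ∑ j, S.hi i j * (S.gi * S.Fl i * (S.gi * S.Fl j)).trace := by
      rw [mul_assoc (S.F i), mul_assoc (S.F i), Matrix.trace_mul_comm, ← contr_hi_Fl]
      simp only [Matrix.mul_sum, Matrix.trace_sum, mul_smul_comm, Matrix.trace_smul, smul_eq_mul,
        mul_assoc]
    rw [h', Finset.mul_sum]
    exact Finset.sum_congr rfl fun j _ => by rw [h]; ring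
  have h4 : ∑ i, ∑ j, S.hi i j * ∑ l, ∑ k, (- (S.r * S.P l k i) - S.W l k i) * Z l k j
      = - (S.r ^ 2 * ∑ α, ∑ β, S.gi α β * (S.P α * S.P β).trace)
        - S.r * ∑ l, ∑ α, S.gi l α * (S.W l * S.hi * S.H α).trace := by
    have h : ∑ i, ∑ j, S.hi i j * ∑ l, ∑ k, (- (S.r * S.P l k i) - S.W l k i) * Z l k j
        = contr S.hi (∑ l, (- (S.r • S.P l) - S.W l).transpose * Z l) := by
      simp only [contr, Matrix.sum_apply]
      rfl
    have h' : ∀ l, contr S.hi ((- (S.r • S.P l) - S.W l).transpose * Z l)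
        = - (S.r ^ 2 * ∑ α, S.gi l α * (S.P l * S.P α).trace)
          - S.r * ∑ α, S.gi l α * (S.W l * S.hi * S.H α).trace := by
      intro l
      have hX : ∀ X : Matrix κ κ A, contr S.hi (X.transpose * Z l)
          = S.r * ∑ α, S.gi l α * (X * S.hi * S.H α).trace := by
        intro X
        have : contr S.hi (X.transpose * Z l) = contr (X * S.hi) (Z l) := by
          rw [contr_eq_trace, contr_eq_trace, Matrix.transpose_mul, mul_assoc]
        rw [this, hcZ]
        refine congrArg _ (Finset.sum_congr rfl fun α _ => ?_)
        rw [contr_eq_trace, ← Matrix.trace_transpose, Matrix.transpose_mul,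
          Matrix.transpose_transpose, (S.H_symm α).eq, Matrix.trace_mul_comm]
      rw [hX]
      simp only [sub_mul, neg_mul, smul_mul_assoc, Matrix.trace_sub, Matrix.trace_neg,
        Matrix.trace_smul, smul_eq_mul, mul_sub, mul_neg, Finset.sum_sub_distrib,
        Finset.sum_neg_distrib, mul_left_comm _ S.r, ← Finset.mul_sum, mul_assoc, P]
      ring
    rw [h, contr_sum]
    simp only [h', Finset.sum_sub_distrib, Finset.sum_neg_distrib, ← Finset.mul_sum]
  have h5 : ∑ i, ∑ j, S.hi i j * ∑ k, ∑ l, Z l k i * (- (S.r * S.P l k j) - S.W l k j)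
      = ∑ i, ∑ j, S.hi i j * ∑ l, ∑ k, (- (S.r * S.P l k i) - S.W l k i) * Z l k j := by
    rw [Finset.sum_comm]
    refine Finset.sum_congr rfl fun i _ => Finset.sum_congr rfl fun j _ => ?_
    rw [S.hi_symm.apply, Finset.sum_comm]
    simp only [mul_comm]
  have h6 : 2 * ∑ l, ∑ α, S.gi l α * (S.W l * S.hi * S.H α).trace
      = ∑ l, ∑ α, S.gi l α * (S.hi * dmat (S.d l) S.h * S.hi * S.H α).trace
        - ∑ α, ∑ β, S.gi α β * (S.P α * S.P β).trace := by
    simp only [Finset.mul_sum, mul_left_comm (2 : A), two_trace_W, mul_sub,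
      Finset.sum_sub_distrib]
  simp only [hZa]
  simp only [mul_add, mul_sub, Finset.sum_add_distrib, Finset.sum_sub_distrib] at h1 h2 h3 h4 h5 ⊢
  rw [h5, h1, h2, h3, h4, fibreScalar]
  -- The total coefficient r - 2r² of the Tr(Φ_α Φ_β) term vanishes because 2r = 1.
  linear_combination (-S.r) * h6 - S.r * (∑ α, ∑ β, S.gi α β * (S.P α * S.P β).trace) * S.two_r

/-- The scalar curvature of a Kaluza-Klein metric. -/
theorem scalarCurv_conn : scalarCurv S.der S.coeff S.metricInv S.conn
    = S.baseScalar + S.fibreScalar - S.r ^ 2 * S.Y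
      + ∑ α, ∑ β, S.gi α β * (S.d α (S.t β) + ∑ μ, S.K α μ β * S.t μ)
      + S.r ^ 2 * ∑ α, ∑ β, S.gi α β * ((S.P α * S.P β).trace + S.t α * S.t β) := by
  rw [scalarCurv_eq S.conn_torsion]
  have h1 : ∀ α β, ∑ l, S.der l (S.conn (.inl α) l (.inl β))
        - S.der (.inl α) (∑ l, S.conn l l (.inl β))
        - ∑ a, (∑ l, S.conn l l a) * S.conn (.inl α) a (.inl β)
        + ∑ l, ∑ a, S.conn l a (.inl α) * S.conn a l (.inl β)
      = ∑ l, S.d l (S.K α l β) - S.d α (S.kt β - S.r * S.t β)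
        - ∑ μ, (S.kt μ - S.r * S.t μ) * S.K α μ β
        + (∑ l, ∑ μ, S.K l μ α * S.K μ l β
          + ∑ l, ∑ i, S.r * S.F i l α * (S.r * (S.gi * S.Fl i) l β)
          + ∑ i, ∑ l, S.r * (S.gi * S.Fl i) l α * (S.r * S.F i l β)
          + ∑ i, ∑ j, S.r * S.P α j i * (S.r * S.P β i j)) := by
    intro α β
    simp only [Fintype.sum_sum_type (f := fun a => (∑ l, S.conn l l a) * _), trace_conn_inl,
      trace_conn_inr]
    simp [Fintype.sum_sum_type, der, conn, Finset.sum_add_distrib, P, add_assoc]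
    exact add_left_comm _ _ _
  have h2 : ∀ i j, ∑ l, S.der l (S.conn (.inr i) l (.inr j))
        - S.der (.inr i) (∑ l, S.conn l l (.inr j))
        - ∑ a, (∑ l, S.conn l l a) * S.conn (.inr i) a (.inr j)
        + ∑ l, ∑ a, S.conn l a (.inr i) * S.conn a l (.inr j)
      = ∑ l, S.d l (S.r * ∑ α, S.gi l α * S.H α i j)
        - ∑ μ, (S.kt μ - S.r * S.t μ) * (S.r * ∑ α, S.gi μ α * S.H α i j)
        + (∑ l, ∑ μ, S.r * (S.gi * S.Fl i) μ l * (S.r * (S.gi * S.Fl j) l μ)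
          + ∑ l, ∑ k, (- (S.r * S.P l k i) - S.W l k i) * (S.r * ∑ α, S.gi l α * S.H α k j)
          + ∑ k, ∑ l, (S.r * ∑ α, S.gi l α * S.H α k i) * (- (S.r * S.P l k j) - S.W l k j)
          + ∑ k, ∑ l, S.L k l i * S.L l k j) := by
    intro i j
    simp only [Fintype.sum_sum_type (f := fun a => (∑ l, S.conn l l a) * _), trace_conn_inl,
      trace_conn_inr]
    simp [Fintype.sum_sum_type, der, conn, Finset.sum_add_distrib, P, add_assoc]
    exact add_left_comm _ _ _
  have h3 : ∀ b, ∀ X : m ⊕ κ → A, ∑ k, S.metricInv b k * X k = Sum.elim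
      (fun α => ∑ β, S.gi α β * X (.inl β)) (fun i => ∑ j, S.hi i j * X (.inr j)) b := by
    intro b X
    rcases b with α | i <;> simp [metricInv, Fintype.sum_sum_type]
  simp only [h3]
  rw [Fintype.sum_sum_type]
  simp only [Sum.elim_inl, Sum.elim_inr, h1, h2]
  rw [base_block, fibre_block]
  have h4 : ∑ α, ∑ β, S.gi α β * (S.d α (S.t β) + ∑ μ, S.K α μ β * S.t μ)
      = ∑ α, ∑ β, S.gi α β * S.d α (S.t β)
        + ∑ α, ∑ β, S.gi α β * ∑ μ, S.t μ * S.K α μ β := by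
    simp only [mul_add, Finset.sum_add_distrib, mul_comm (S.t _)]
  rw [h4]
  simp only [mul_add, Finset.sum_add_distrib]
  linear_combination (∑ α, ∑ β, S.gi α β * S.d α (S.t β)
        + ∑ α, ∑ β, S.gi α β * ∑ μ, S.t μ * S.K α μ β) * S.two_r

end KaluzaKlein

/-! ## Left invariant metrics on `su(2)` -/

section SU2

variable {A : Type} [CommRing A] [Algebra ℂ A] {h hi : Matrix (Fin 3) (Fin 3) A} {r : A}

theorem eps_swap_right (i j k : Fin 3) : eps i k j = - eps i j k := by
  revert i j k; decide

theorem eps_swap_left (i j k : Fin 3) : eps j i k = - eps i j k := by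
  revert i j k; decide

theorem sum_eps (F : Fin 3 → Fin 3 → Fin 3 → A) :
    ∑ i, ∑ j, ∑ k, (eps i j k : A) * F i j k
      = F 0 1 2 + F 1 2 0 + F 2 0 1 - F 0 2 1 - F 2 1 0 - F 1 0 2 := by
  have h0 : ∀ i j, eps i i j = 0 ∧ eps i j i = 0 ∧ eps j i i = 0 := by decide
  have h1 : eps 0 1 2 = 1 ∧ eps 1 2 0 = 1 ∧ eps 2 0 1 = 1 ∧ eps 0 2 1 = -1 ∧ eps 2 1 0 = -1
    ∧ eps 1 0 2 = -1 := by decide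
  simp only [Fin.sum_univ_three, h0, h1]
  push_cast
  ring

/-- The lowered Levi-Civita coefficients of a left invariant metric on `su(2)`. -/
def su2Low (r : A) (h : Matrix (Fin 3) (Fin 3) A) (i : Fin 3) : Matrix (Fin 3) (Fin 3) A :=
  Matrix.of fun k j => ∑ l, (eps l j k : A) * h i l - r * h.trace * (eps i j k : A)

/-- The Levi-Civita coefficients of a left invariant metric on `su(2)`. -/
def su2Conn (r : A) (h hi : Matrix (Fin 3) (Fin 3) A) (i : Fin 3) : Matrix (Fin 3) (Fin 3) A :=
  hi * su2Low r h i

/-- In three dimensions, h acting as a derivation on volume forms multiplies them by its trace. -/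
theorem eps_identity (hs : h.IsSymm) (i j k : Fin 3) :
    ∑ l, (eps l j k : A) * h i l - ∑ l, (eps l i k : A) * h j l + ∑ l, (eps l i j : A) * h k l
      = h.trace * (eps i j k : A) := by
  have h0 : ∀ i j, eps i i j = 0 ∧ eps i j i = 0 ∧ eps j i i = 0 := by decide
  have h1 : eps 0 1 2 = 1 ∧ eps 1 2 0 = 1 ∧ eps 2 0 1 = 1 ∧ eps 0 2 1 = -1 ∧ eps 2 1 0 = -1
    ∧ eps 1 0 2 = -1 := by decide
  have s1 := hs.apply 0 1
  have s2 := hs.apply 0 2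
  have s3 := hs.apply 1 2
  fin_cases i <;> fin_cases j <;> fin_cases k <;>
    simp [Matrix.trace, Fin.sum_univ_three, h0, h1, s1, s2, s3] <;> ring

/-- `su2Low` is the Koszul formula. Antisymmetry in its matrix indices is metricity, and its trace
term is what `eps_identity` needs for the torsion to match the structure constants. -/
theorem su2Conn_isLeviCivita (hr : 2 * r = 1) (hs : h.IsSymm) (hh : hi * h = 1) :
    IsLeviCivita (0 : Fin 3 → Derivation ℂ A A) (fun i j k => - (eps i j k : A)) h
      (su2Conn r h hi) := by
  have hhi := mul_eq_one_comm.1 hh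
  constructor
  · intro l a b
    have h1 : ∀ k, su2Low r h a k b - su2Low r h b k a = - ∑ m, h k m * (eps m a b : A) := by
      intro k
      have h2 := eps_identity hs a b k
      have h3 : (eps b a k : A) = - (eps a b k : A) := by rw [eps_swap_left]; push_cast; rfl
      simp only [su2Low, Matrix.of_apply, h3]
      simp only [mul_comm (h k _)]
      linear_combination h2 - h.trace * (eps a b k : A) * hr
    simp only [su2Conn]
    rw [Matrix.mul_apply, Matrix.mul_apply, ← Finset.sum_sub_distrib]
    simp only [← mul_sub, h1, mul_neg, Finset.sum_neg_distrib, Finset.mul_sum, ← mul_assoc]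
    rw [Finset.sum_comm]
    simp only [← Finset.sum_mul, ← Matrix.mul_apply, hh, Matrix.one_apply]
    simp
  · intro a
    have h1 : (su2Low r h a).transpose = - su2Low r h a := by
      ext k j
      simp only [su2Low, Matrix.transpose_apply, Matrix.neg_apply, Matrix.of_apply,
        eps_swap_right _ j k]
      push_cast
      simp only [neg_mul, Finset.sum_neg_distrib]
      ring
    have h2 : dmat (0 : Derivation ℂ A A) h = 0 := rfl
    rw [Pi.zero_apply, h2, su2Conn, Matrix.transpose_mul, (isSymm_of_mul_eq_one hs hh).eq, h1,
      mul_assoc, hh, ← mul_assoc, hhi]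
    simp

/-- The finite counterpart of `eps_identity`: h applied to all three indices of ε multiplies it by
det h. -/
theorem eps_det (hs : h.IsSymm) (m p i : Fin 3) :
    ∑ a, ∑ b, ∑ l, (eps a b l : A) * (h a p * h b i * h m l)
      = h.det * (eps p i m : A) := by
  have h0 : ∀ i j, eps i i j = 0 ∧ eps i j i = 0 ∧ eps j i i = 0 := by decide
  have h1 : eps 0 1 2 = 1 ∧ eps 1 2 0 = 1 ∧ eps 2 0 1 = 1 ∧ eps 0 2 1 = -1 ∧ eps 2 1 0 = -1
    ∧ eps 1 0 2 = -1 := by decide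
  have s1 := hs.apply 0 1
  have s2 := hs.apply 0 2
  have s3 := hs.apply 1 2
  rw [sum_eps (fun a b l => h a p * h b i * h m l), Matrix.det_fin_three]
  fin_cases m <;> fin_cases p <;> fin_cases i <;> simp [h0, h1, s1, s2, s3] <;> ring

/-- The cofactor form of the Levi-Civita coefficients, up to a factor `2 det h`. -/
def su2Cof (h : Matrix (Fin 3) (Fin 3) A) (k l b : Fin 3) : A :=
  ∑ a, (eps a b l : A) * ((2 • h - h.trace • 1 : Matrix (Fin 3) (Fin 3) A) * h.transpose) k a

/-- A polynomial identity in the six independent entries of h, verified by expansion. Each component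
of `su2Cof` is zero or a signed entry of a single matrix X. -/
theorem su2Cof_sum (hs : h.IsSymm) :
    ∑ k, ∑ l, ∑ b, ∑ b', su2Cof h k l b * su2Cof h l k b' * h b b'
      = h.det * (4 * (h * h).trace - 2 * h.trace ^ 2) := by
  have h0 : ∀ i j, eps i i j = 0 ∧ eps i j i = 0 ∧ eps j i i = 0 := by decide
  have h1 : eps 0 1 2 = 1 ∧ eps 1 2 0 = 1 ∧ eps 2 0 1 = 1 ∧ eps 0 2 1 = -1 ∧ eps 2 1 0 = -1
    ∧ eps 1 0 2 = -1 := by decide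
  have s1 := hs.apply 0 1
  have s2 := hs.apply 0 2
  have s3 := hs.apply 1 2
  set X : Matrix (Fin 3) (Fin 3) A := (2 • h - h.trace • 1) * h.transpose with hX
  have hC : ∀ k, su2Cof h k 0 0 = 0 ∧ su2Cof h k 1 1 = 0 ∧ su2Cof h k 2 2 = 0
      ∧ su2Cof h k 0 1 = - X k 2 ∧ su2Cof h k 1 0 = X k 2 ∧ su2Cof h k 0 2 = X k 1
      ∧ su2Cof h k 2 0 = - X k 1 ∧ su2Cof h k 1 2 = - X k 0 ∧ su2Cof h k 2 1 = X k 0 := by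
    intro k
    simp [su2Cof, Fin.sum_univ_three, h0, h1, hX]
  have hXe : ∀ k a, X k a = 2 * (h k 0 * h 0 a + h k 1 * h 1 a + h k 2 * h 2 a)
      - (h 0 0 + h 1 1 + h 2 2) * h k a := by
    intro k a
    simp only [hX, hs.eq, two_smul, add_mul, sub_mul, smul_mul_assoc, one_mul, Matrix.sub_apply,
      Matrix.add_apply, Matrix.smul_apply, Matrix.mul_apply, Fin.sum_univ_three, Matrix.trace,
      Matrix.diag, smul_eq_mul]
    ring
  have ht : h.trace = h 0 0 + h 1 1 + h 2 2 := by simp [Matrix.trace, Fin.sum_univ_three]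
  have ht' : (h * h).trace = h 0 0 ^ 2 + h 1 1 ^ 2 + h 2 2 ^ 2
      + 2 * (h 0 1 ^ 2 + h 0 2 ^ 2 + h 1 2 ^ 2) := by
    simp only [Matrix.trace, Matrix.diag, Matrix.mul_apply, Fin.sum_univ_three, s1, s2, s3]
    ring
  simp only [Fin.sum_univ_three, hC, ht, ht', Matrix.det_fin_three]
  simp only [hXe, s1, s2, s3]
  ring

/-- The factor det h clears the inverse metric. The identity is checked after lowering an index with
h, where `eps_det` turns the cofactor expression into `su2Low`. -/
theorem su2Conn_cof (hr : 2 * r = 1) (hs : h.IsSymm) (hh : hi * h = 1) (k l i : Fin 3) :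
    2 * h.det * su2Conn r h hi k l i = ∑ b, su2Cof h k l b * h b i := by
  have h1 : h * Matrix.of (fun l i => ∑ b, su2Cof h k l b * h b i) = (2 * h.det) • su2Low r h k := by
    ext m i
    have h2 : ∀ l b, su2Cof h k l b = ∑ p, (2 • h - h.trace • 1 : Matrix (Fin 3) (Fin 3) A) k p
        * ∑ a, (eps a b l : A) * h a p := by
      intro l b
      simp only [su2Cof, Matrix.mul_apply, Matrix.transpose_apply, Finset.mul_sum]
      rw [Finset.sum_comm]
      exact Finset.sum_congr rfl fun p _ => Finset.sum_congr rfl fun a _ => by ring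
    calc _ = ∑ p, (2 • h - h.trace • 1 : Matrix (Fin 3) (Fin 3) A) k p
          * ∑ a, ∑ b, ∑ l, (eps a b l : A) * (h a p * h b i * h m l) := by
          simp only [Matrix.mul_apply, Matrix.of_apply, h2, Fin.sum_univ_three]
          ring
      _ = _ := by
          simp only [eps_det hs, su2Low, Matrix.smul_apply, Matrix.of_apply, smul_eq_mul,
            Matrix.sub_apply, sub_mul, Finset.sum_sub_distrib]
          have h3 : ∑ p, h.trace * (1 : Matrix (Fin 3) (Fin 3) A) k p * (h.det * (eps p i m : A))
              = h.trace * (h.det * (eps k i m : A)) := by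
            simp [Matrix.one_apply]
          rw [h3, mul_sub, Finset.mul_sum]
          simp only [nsmul_eq_mul]
          push_cast
          rw [show 2 * h.det * (r * h.trace * (eps k i m : A))
            = h.trace * (h.det * (eps k i m : A)) by
              linear_combination h.trace * h.det * (eps k i m : A) * hr]
          congr 1
          exact Finset.sum_congr rfl fun p _ => by ring
  have h2 : (2 * h.det) • su2Conn r h hi k = Matrix.of (fun l i => ∑ b, su2Cof h k l b * h b i) := by
    rw [su2Conn, ← mul_smul_comm, ← h1, ← mul_assoc, hh, one_mul]
  exact congrFun (congrFun h2 l) i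

/-- By `su2Conn_cof` each coefficient carries a factor h on its last index once denominators are
cleared. The inverse metric contracted with two such factors returns a single h, leaving the
polynomial of `su2Cof_sum`. Division is avoided throughout: det h has inverse det h⁻¹ and 2 has
inverse r. -/
theorem su2_fibreScalar (hr : 2 * r = 1) (hs : h.IsSymm) (hh : hi * h = 1) :
    (∑ i, ∑ j, hi i j * ∑ k, ∑ l, su2Conn r h hi k l i * su2Conn r h hi l k j) * h.det
      = (h * h).trace - r * h.trace ^ 2 := by
  have hd : hi.det * h.det = 1 := by rw [← Matrix.det_mul, hh, Matrix.det_one]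
  have h1 : (2 * h.det) ^ 2 * ∑ i, ∑ j, hi i j * ∑ k, ∑ l, su2Conn r h hi k l i * su2Conn r h hi l k j
      = ∑ k, ∑ l, ∑ b, ∑ b', su2Cof h k l b * su2Cof h l k b' * h b b' := by
    have h2 : ∀ b b', ∑ i, ∑ j, hi i j * (h b i * h b' j) = h b b' := by
      intro b b'
      have h3 : ∑ i, ∑ j, hi i j * (h b i * h b' j) = (h * (hi * h)) b b' := by
        simp only [Matrix.mul_apply, Finset.mul_sum]
        exact Finset.sum_congr rfl fun p _ => Finset.sum_congr rfl fun a _ => by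
          rw [hs.apply a b']; ring
      rw [h3, hh, mul_one]
    calc _ = ∑ i, ∑ j, hi i j * ∑ k, ∑ l, (∑ b, su2Cof h k l b * h b i)
          * ∑ b, su2Cof h l k b * h b j := by
          simp only [← su2Conn_cof hr hs hh, Finset.mul_sum]
          exact Finset.sum_congr rfl fun i _ => Finset.sum_congr rfl fun j _ =>
            Finset.sum_congr rfl fun k _ => Finset.sum_congr rfl fun l _ => by ring
      -- Grouping the six indices into two products lets a single exchange of sums bring the
      -- contraction with the inverse metric inside.
      _ = ∑ x : Fin 3 × Fin 3, ∑ y : Fin 3 × Fin 3 × Fin 3 × Fin 3,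
          su2Cof h y.1 y.2.1 y.2.2.1 * su2Cof h y.2.1 y.1 y.2.2.2
            * (hi x.1 x.2 * (h y.2.2.1 x.1 * h y.2.2.2 x.2)) := by
          simp only [Fintype.sum_prod_type, Finset.sum_mul_sum]
          simp only [Finset.mul_sum]
          exact Finset.sum_congr rfl fun i _ => Finset.sum_congr rfl fun j _ =>
            Finset.sum_congr rfl fun k _ => Finset.sum_congr rfl fun l _ =>
            Finset.sum_congr rfl fun b _ => Finset.sum_congr rfl fun b' _ => by ring
      _ = ∑ k, ∑ l, ∑ b, ∑ b', su2Cof h k l b * su2Cof h l k b'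
          * ∑ i, ∑ j, hi i j * (h b i * h b' j) := by
          rw [Finset.sum_comm]
          simp only [Fintype.sum_prod_type, Finset.mul_sum]
      _ = _ := by simp only [h2]
  rw [su2Cof_sum hs] at h1
  set S := ∑ i, ∑ j, hi i j * ∑ k, ∑ l, su2Conn r h hi k l i * su2Conn r h hi l k j
  calc S * h.det = (2 * r) ^ 2 * (hi.det * h.det) * (S * h.det) := by rw [hr, hd]; ring
    _ = r ^ 2 * hi.det * (h.det * (4 * (h * h).trace - 2 * h.trace ^ 2)) := by
      rw [← h1]; ring
    _ = (hi.det * h.det) * ((2 * r) ^ 2 * (h * h).trace - (2 * r) * r * h.trace ^ 2) := by ring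
    _ = _ := by rw [hd, hr]; ring

end SU2

/-! ## The logarithm of a positive definite matrix -/

/-- In an orthonormal eigenbasis this is the scalar identity at each positive eigenvalue. -/
theorem exp_log_of_posDef {k : Type} [Fintype k] [DecidableEq k] {H : Matrix k k ℝ} (hH : H.PosDef) :
    NormedSpace.exp (cfc Real.log H) = H := by
  have hh := hH.1
  set V : Matrix k k ℝ := hh.eigenvectorUnitary.1 with hV
  have hVV : V * star V = 1 := Unitary.mul_star_self_of_mem hh.eigenvectorUnitary.2
  have hinv : V⁻¹ = star V := Matrix.inv_eq_right_inv hVV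
  have hu : IsUnit V := IsUnit.of_mul_eq_one _ hVV
  have h1 : cfc Real.log H = V * Matrix.diagonal (fun i => Real.log (hh.eigenvalues i)) * V⁻¹ := by
    rw [hh.cfc_eq, Matrix.IsHermitian.cfc, Unitary.conjStarAlgAut_apply, hinv]
    rfl
  have h2 : H = V * Matrix.diagonal hh.eigenvalues * V⁻¹ := by
    conv_lhs => rw [hh.spectral_theorem, Unitary.conjStarAlgAut_apply]
    rw [hinv]
    rfl
  rw [h1, Matrix.exp_conj _ _ hu, Matrix.exp_diagonal]
  conv_rhs => rw [h2]
  congr 3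
  ext i
  rw [Pi.coe_exp, ← Real.exp_eq_exp_ℝ, Real.exp_log (hH.eigenvalues_pos i)]

theorem trace_log_of_posDef {k : Type} [Fintype k] [DecidableEq k] {H : Matrix k k ℝ} (hH : H.PosDef) :
    (cfc Real.log H).trace = Real.log H.det := by
  have hh := hH.1
  rw [hh.cfc_eq, Matrix.IsHermitian.cfc, Unitary.conjStarAlgAut_apply, Matrix.trace_mul_cycle]
  rw [Unitary.coe_star_mul_self, one_mul, hh.det_eq_prod_eigenvalues]
  simp only [RCLike.ofReal_real_eq_id, id]
  rw [Real.log_prod fun i _ => (hH.eigenvalues_pos i).ne']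
  simp [Matrix.trace]

/-! ## The fuzzy sphere at a point of spacetime -/

namespace Fields

variable {n : ℕ} {U : TopologicalSpace.Opens (E n)} (F : Fields U)

theorem h_symm {x : E n} (hx : x ∈ U) : (F.h x).IsSymm := by
  have := (F.h_posDef x hx).1
  rwa [Matrix.IsHermitian, Matrix.conjTranspose_eq_transpose_of_trivial] at this

theorem h_det_pos {x : E n} (hx : x ∈ U) : 0 < (F.h x).det := (F.h_posDef x hx).det_pos

theorem h_inv_mul {x : E n} (hx : x ∈ U) : (F.h x)⁻¹ * F.h x = 1 :=
  Matrix.nonsing_inv_mul _ (F.h_det_pos hx).ne'.isUnit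

/-- With e^Φ = h and e^{Tr Φ} = det h the exponentials disappear, which gives the form in which
`su2_fibreScalar` delivers the fibre curvature. -/
theorem Rh_eq {x : E n} (hx : x ∈ U) :
    F.Rh x * (2 * (F.h x).det) = (F.h x * F.h x).trace - 1 / 2 * (F.h x).trace ^ 2 := by
  have hd := F.h_det_pos hx
  have h1 : NormedSpace.exp (F.Phi x) = F.h x := exp_log_of_posDef (F.h_posDef x hx)
  have h2 : NormedSpace.exp ((2 : ℝ) • F.Phi x) = F.h x * F.h x := by
    have : (2 : ℝ) • F.Phi x = (2 : ℕ) • F.Phi x := by rw [two_smul, two_smul]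
    rw [this, Matrix.exp_nsmul, h1, pow_two]
  rw [Rh, h1, h2, Phi, trace_log_of_posDef (F.h_posDef x hx), Real.exp_neg, Real.exp_log hd]
  field_simp

/-- The metric of the fuzzy sphere at a point, with complex entries. -/
def hC (x : E n) : Matrix (Fin 3) (Fin 3) ℂ := (F.h x).map Complex.ofRealHom

/-- The inverse metric of the fuzzy sphere at a point, with complex entries. -/
def hiC (x : E n) : Matrix (Fin 3) (Fin 3) ℂ := ((F.h x)⁻¹).map Complex.ofRealHom

theorem hiC_mul {x : E n} (hx : x ∈ U) : F.hiC x * F.hC x = 1 := by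
  rw [hiC, hC, ← Matrix.map_mul, F.h_inv_mul hx]
  exact Matrix.map_one _ (map_zero _) (map_one _)

theorem hC_symm {x : E n} (hx : x ∈ U) : (F.hC x).IsSymm := by
  rw [hC, Matrix.IsSymm, ← Matrix.transpose_map, (F.h_symm hx).eq]

theorem fibre_eq_Rh {x : E n} (hx : x ∈ U) (s : ℂ)
    (hs : s * (F.hC x).det = (F.hC x * F.hC x).trace - 1 / 2 * (F.hC x).trace ^ 2) :
    1 / 2 * s = (F.Rh x : ℂ) := by
  have h1 : (F.hC x).det = ((F.h x).det : ℂ) := (RingHom.map_det Complex.ofRealHom (F.h x)).symm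
  have h2 : (F.hC x).trace = ((F.h x).trace : ℂ) :=
    (AddMonoidHom.map_trace Complex.ofRealHom.toAddMonoidHom (F.h x)).symm
  have h3 : (F.hC x * F.hC x).trace = ((F.h x * F.h x).trace : ℂ) := by
    rw [hC, ← Matrix.map_mul]
    exact (AddMonoidHom.map_trace Complex.ofRealHom.toAddMonoidHom (F.h x * F.h x)).symm
  have h4 := congrArg (Complex.ofReal) (F.Rh_eq hx)
  push_cast at h4
  have hd : ((F.h x).det : ℂ) ≠ 0 := Complex.ofReal_ne_zero.2 (F.h_det_pos hx).ne'
  rw [h1, h2, h3, ← h4] at hs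
  have h5 : s = F.Rh x * 2 := mul_right_cancel₀ hd (by linear_combination hs)
  rw [h5]
  ring

theorem fuzzy_isLeviCivita {lam : ℝ} {x : E n} (hx : x ∈ U) :
    IsLeviCivita (0 : Fin 3 → Derivation ℂ ℂ ℂ)
      (fun l a b => algebraMap ℂ ℂ ((fuzzyCalculus lam).c l a b)) (F.hC x)
      (su2Conn (1 / 2) (F.hC x) (F.hiC x)) :=
  su2Conn_isLeviCivita (by norm_num) (F.hC_symm hx) (F.hiC_mul hx)

theorem eps_trace (j : Fin 3) : ∑ i, eps i i j = 0 := by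
  revert j; decide

/-- `R_h(x)` is the Ricci scalar of the fuzzy sphere with metric `h_{ij}(x)`. -/
theorem fuzzy_ricciScalar (lam : ℝ) {x : E n} (hx : x ∈ U) :
    ∃ Q : BimodulePairing (Fin 3) (FuzzySphere lam),
      IsInverseMetric (F.fuzzyMetric lam x) Q ∧
      ∃ D : BimoduleConnection (fuzzyCalculus lam),
        (IsQLC (F.fuzzyMetric lam x) D ∧ FlipsOn Set.univ D) ∧
        (∀ D' : BimoduleConnection (fuzzyCalculus lam),
          IsQLC (F.fuzzyMetric lam x) D' ∧ FlipsOn Set.univ D' → D' = D) ∧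
        ricciScalar D (F.fuzzyMetric lam x) Q
          = algebraMap ℂ (FuzzySphere lam) ((F.Rh x : ℝ) : ℂ) := by
  -- At a fixed spacetime point the metric coefficients are constants, so the central coefficient
  -- algebra is ℂ with zero derivations.
  have hι : ∀ (z : ℂ) (b : FuzzySphere lam), Commute (Algebra.ofId ℂ (FuzzySphere lam) z) b :=
    fun z b => Algebra.commutes z b
  have hδ : ∀ (a : Fin 3) (z : ℂ), (fuzzyCalculus lam).pd a (Algebra.ofId ℂ (FuzzySphere lam) z)
      = Algebra.ofId ℂ (FuzzySphere lam) ((0 : Fin 3 → Derivation ℂ ℂ ℂ) a z) := by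
    intro a z
    rw [Algebra.ofId_apply, Algebra.algebraMap_eq_smul_one, map_smul, FramedCalculus.pd_one]
    simp
  have hG : F.fuzzyMetric lam x = fun a b => Algebra.ofId ℂ (FuzzySphere lam) (F.hC x a b) := rfl
  have hgi := F.hiC_mul hx
  have hgi' := mul_eq_one_comm.1 hgi
  have hlc := F.fuzzy_isLeviCivita (lam := lam) hx
  have hP := pairingOf_isInverseMetric hι hgi hgi'
  rw [hG]
  refine ⟨pairingOf _ hι (F.hiC x), hP, connOf _ _ hι _,
    ⟨connOf_isQLC hι hδ hlc, connOf_flips hι _ _⟩, fun D' h => ?_, ?_⟩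
  · exact isQLC_unique (F.hC_symm hx) hgi h.1 (connOf_isQLC hι hδ hlc) h.2 (connOf_flips hι _ _)
  · rw [ricciScalar_connOf hι hδ hP (F.hC_symm hx) hgi', scalarCurv_fibre (r := 1 / 2) (by norm_num)
      hgi hlc, smul_eq_mul, F.fibre_eq_Rh hx, Algebra.ofId_apply]
    · exact su2_fibreScalar (by norm_num) (F.hC_symm hx) hgi
    · intro j
      have h := congrArg (Int.cast : ℤ → ℂ) (eps_trace j)
      push_cast at h
      simp only [fuzzyCalculus, fc, Algebra.algebraMap_self, RingHom.id_apply,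
        Finset.sum_neg_distrib, h, neg_zero]

/-! ## The trace of `Φ_α` -/

/-- The gauge field in the adjoint representation. -/
def adA (α : Fin n) (x : E n) : Matrix (Fin 3) (Fin 3) ℝ :=
  Matrix.of fun l i => ∑ k, (eps i k l : ℝ) * F.At x α k

/-- The entrywise derivative of `h`. -/
def dh (α : Fin n) (x : E n) : Matrix (Fin 3) (Fin 3) ℝ :=
  Matrix.of fun i j => del α (fun y => F.h y i j) x

/-- Symmetry of h makes the two gauge terms transposes of each other, which is the shape of
`KaluzaKlein.H`. -/
theorem covH_eq {x : E n} (hx : x ∈ U) (α : Fin n) :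
    F.covH α x = F.dh α x - F.h x * F.adA α x - (F.h x * F.adA α x).transpose := by
  have h1 : ∀ i j, (F.h x * F.adA α x) i j
      = ∑ k, ∑ l, F.At x α k * (F.h x l i * (eps j k l : ℝ)) := by
    intro i j
    simp only [Matrix.mul_apply, adA, Matrix.of_apply, Finset.mul_sum]
    rw [Finset.sum_comm]
    exact Finset.sum_congr rfl fun k _ => Finset.sum_congr rfl fun l _ => by
      rw [(F.h_symm hx).apply l i]; ring
  ext i j
  simp only [Matrix.sub_apply, Matrix.transpose_apply, h1, covH, dh, Matrix.of_apply, mul_add,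
    Finset.sum_add_distrib]
  ring

/-- The adjoint action is traceless, so the gauge field does not contribute. -/
theorem trace_PhiD {x : E n} (hx : x ∈ U) (α : Fin n) :
    (F.PhiD α x).trace = ((F.h x)⁻¹ * F.dh α x).trace := by
  have h0 : ∀ i k : Fin 3, eps i k i = 0 := by decide
  have h1 : (F.adA α x).trace = 0 := by
    simp [Matrix.trace, adA, h0]
  have h2 : ((F.h x)⁻¹ * (F.h x * F.adA α x)).trace = 0 := by
    rw [← mul_assoc, F.h_inv_mul hx, one_mul, h1]
  have h3 : ((F.h x)⁻¹ * (F.h x * F.adA α x).transpose).trace = 0 := by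
    rw [← h2, ← Matrix.trace_transpose, Matrix.transpose_mul, Matrix.transpose_transpose,
      (isSymm_of_mul_eq_one (F.h_symm hx) (F.h_inv_mul hx)).eq, Matrix.trace_mul_comm]
  rw [PhiD, covH_eq F hx, mul_sub, mul_sub, Matrix.trace_sub, Matrix.trace_sub, h2, h3]
  ring

/-- Near x one has Tr ln h = ln det h, and Jacobi's formula, here for the expanded 3 × 3
determinant, gives the derivative Tr(h⁻¹ ∂h). -/
theorem hasLineDerivAt_trace_Phi {x : E n} (hx : x ∈ U) (α : Fin n) :
    HasLineDerivAt ℝ (fun y => (F.Phi y).trace) (F.PhiD α x).trace x (Pi.single α 1) := by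
  have he : (fun y => (F.Phi y).trace) =ᶠ[nhds x] fun y => Real.log (F.h y).det := by
    filter_upwards [U.isOpen.mem_nhds hx] with y hy
    exact trace_log_of_posDef (F.h_posDef y hy)
  refine HasLineDerivAt.congr_of_eventuallyEq ?_ he
  have hd : ∀ i j, HasLineDerivAt ℝ (fun y => F.h y i j) (F.dh α x i j) x (Pi.single α 1) := by
    intro i j
    exact (((F.h_smooth i j).contDiffAt (U.isOpen.mem_nhds hx)).differentiableAt
      (by simp)).hasFDerivAt.hasLineDerivAt _
  have hdet := (F.h_det_pos hx).ne'
  have key : (F.PhiD α x).trace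
      = ((F.h x).adjugate * F.dh α x).trace / (F.h x).det := by
    rw [trace_PhiD F hx, Matrix.inv_def, Ring.inverse_eq_inv', smul_mul_assoc, Matrix.trace_smul,
      smul_eq_mul]
    ring
  rw [key]
  simp only [Matrix.det_fin_three]
  simp only [HasLineDerivAt] at hd ⊢
  have h0 : x + (0 : ℝ) • (Pi.single α 1 : E n) = x := by simp
  refine ((((((((hd 0 0).fun_mul (hd 1 1)).fun_mul (hd 2 2)).fun_sub
    (((hd 0 0).fun_mul (hd 1 2)).fun_mul (hd 2 1))).fun_sub
    (((hd 0 1).fun_mul (hd 1 0)).fun_mul (hd 2 2))).fun_add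
    (((hd 0 1).fun_mul (hd 1 2)).fun_mul (hd 2 0))).fun_add
    (((hd 0 2).fun_mul (hd 1 0)).fun_mul (hd 2 1))).fun_sub
    (((hd 0 2).fun_mul (hd 1 1)).fun_mul (hd 2 0))).log ?_ |>.congr_deriv ?_
  · rw [h0]
    rwa [Matrix.det_fin_three] at hdet
  · rw [h0]
    congr 1
    simp only [Matrix.trace, Matrix.diag, Matrix.mul_apply, Fin.sum_univ_three]
    simp [Matrix.adjugate_fin_three]
    ring

end Fields

/-! ## Coordinate and gauge frames -/

section Christoffel

variable {m A : Type} [Fintype m] [DecidableEq m] [CommRing A] [Algebra ℂ A]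

/-- Minus the Christoffel symbols of a metric in coordinates. -/
def chrConn (r : A) (d : m → Derivation ℂ A A) (g gi : Matrix m m A) (α : m) : Matrix m m A :=
  Matrix.of fun l β =>
    - (r * ∑ ρ, gi l ρ * (d α (g ρ β) + d β (g ρ α) - d ρ (g α β)))

theorem chrConn_isLeviCivita {r : A} (hr : 2 * r = 1) (d : m → Derivation ℂ A A) {g gi : Matrix m m A}
    (hs : g.IsSymm) (hg : gi * g = 1) : IsLeviCivita d 0 g (chrConn r d g gi) := by
  constructor
  · intro l a b
    simp only [chrConn, Matrix.of_apply, hs.apply a b, Pi.zero_apply, sub_eq_zero]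
    simp only [add_comm (d a (g _ b))]
  · intro a
    have h1 : ∀ b k, (g * chrConn r d g gi a) b k
        = - (r * (d a (g b k) + d k (g b a) - d b (g a k))) := by
      intro b k
      have hg' : g * gi = 1 := mul_eq_one_comm.1 hg
      have h2 : ∀ X : Matrix m Unit A, g * (gi * X) = X := fun X => by
        rw [← Matrix.mul_assoc, hg', Matrix.one_mul]
      have h2 := congrFun (congrFun (h2 (Matrix.of fun ρ _ =>
        d a (g ρ k) + d k (g ρ a) - d ρ (g a k))) b) ()
      simp only [Matrix.mul_apply, Matrix.of_apply] at h2
      rw [← h2, Matrix.mul_apply, Finset.mul_sum, ← Finset.sum_neg_distrib]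
      exact Finset.sum_congr rfl fun l _ => by rw [chrConn, Matrix.of_apply]; ring
    have h3 : (chrConn r d g gi a).transpose * g = (g * chrConn r d g gi a).transpose := by
      rw [Matrix.transpose_mul, hs.eq]
    ext b k
    rw [h3, Matrix.add_apply, Matrix.add_apply, Matrix.transpose_apply, h1, h1, dmat_apply,
      hs.apply b k, hs.apply a k, hs.apply a b, Matrix.zero_apply]
    linear_combination - d a (g b k) * hr

end Christoffel

namespace KaluzaKlein

variable {m κ A : Type} [Fintype m] [DecidableEq m] [Fintype κ] [DecidableEq κ]
  [CommRing A] [Algebra ℂ A] (S : KaluzaKlein m κ A)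

/-- The sign arises because Y is a trace of a product, while the contraction transposes one
antisymmetric factor F. -/
theorem neg_Y_eq : - S.Y = ∑ i, ∑ j, ∑ μ, ∑ ν, S.h i j * S.F i μ ν
    * ∑ α, ∑ β, S.gi μ α * S.gi ν β * S.F j α β := by
  rw [Y, ← Finset.sum_neg_distrib]
  refine Finset.sum_congr rfl fun i _ => ?_
  have h1 : - (S.F i * S.gi * S.Fl i * S.gi).trace = contr (S.F i) (S.gi * S.Fl i * S.gi) := by
    rw [contr_eq_trace, S.F_antisymm, neg_mul, Matrix.trace_neg]
    simp only [mul_assoc]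
  have h2 : S.gi * S.Fl i * S.gi = ∑ j, S.h i j • (S.gi * S.F j * S.gi) := by
    simp only [Fl, Finset.mul_sum, Finset.sum_mul, mul_smul_comm, smul_mul_assoc]
  have h3 : ∀ j μ ν, (S.gi * S.F j * S.gi) μ ν
      = ∑ α, ∑ β, S.gi μ α * S.gi ν β * S.F j α β := by
    intro j μ ν
    simp only [Matrix.mul_apply, Finset.sum_mul]
    rw [Finset.sum_comm]
    exact Finset.sum_congr rfl fun α _ => Finset.sum_congr rfl fun β _ => by
      rw [S.gi_symm.apply ν β]; ring
  rw [h1, h2, contr_sum]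
  refine Finset.sum_congr rfl fun j _ => ?_
  rw [contr_smul, contr]
  simp only [h3, mul_assoc, Finset.mul_sum]

/-- The matrix of the frame `θ^i = s^i + a_{μi} d x^μ`. -/
def gaugeM (a : Matrix m κ A) : Matrix (m ⊕ κ) (m ⊕ κ) A := Matrix.fromBlocks 1 0 a.transpose 1

/-- The matrix of the inverse change of frame. -/
def gaugeN (a : Matrix m κ A) : Matrix (m ⊕ κ) (m ⊕ κ) A :=
  Matrix.fromBlocks 1 0 (- a.transpose) 1

theorem gaugeN_mul (a : Matrix m κ A) : gaugeN a * gaugeM a = 1 := by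
  simp [gaugeN, gaugeM, Matrix.fromBlocks_multiply]

/-- The structure coefficients of the frame `d x^μ`, `s^i`. -/
def prodCoeff (f : κ → κ → κ → A) : m ⊕ κ → m ⊕ κ → m ⊕ κ → A
  | .inr i, .inr j, .inr k => f i j k
  | _, _, _ => 0

/-- The metric in the frame `d x^μ`, `s^i`. -/
theorem gauge_metric (a : Matrix m κ A) :
    (gaugeM a).transpose * S.metric * gaugeM a = Matrix.fromBlocks
      (S.g + a * S.h * a.transpose) (a * S.h) (S.h * a.transpose) S.h := by
  simp [gaugeM, metric, Matrix.fromBlocks_transpose, Matrix.fromBlocks_multiply]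

/-- Cartan's structure equation for θ^i = s^i + a_{μi} dx^μ. On substituting s = θ - a into ds^i,
the terms with one θ give W, and those with none combine with da into F. -/
theorem isFrameChange {a : Matrix m κ A} (hcomm : ∀ μ ν x, S.d μ (S.d ν x) = S.d ν (S.d μ x))
    (hf : ∀ i j k, S.f i j k = - S.f i k j)
    (hW : ∀ α i j, S.W α i j = ∑ k, S.f i k j * a α k)
    (hF : ∀ i α β, S.F i α β = S.d α (a β i) - S.d β (a α i)
      + ∑ j, ∑ k, S.f i j k * a α j * a β k) :
    IsFrameChange S.der (prodCoeff S.f) S.coeff (gaugeM a) (gaugeN a) := by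
  refine ⟨gaugeN_mul a, ?_, ?_, ?_⟩
  · rintro (μ | i) x <;> simp [gaugeM, der, Matrix.one_apply]
  · rintro (μ | i) (ν | j) x
    · simpa [der, prodCoeff] using sub_eq_zero.2 (hcomm μ ν x)
    · simp [der, prodCoeff]
    · simp [der, prodCoeff]
    · simp [der, prodCoeff]
  · have h1 : ∀ i α β, ∑ j, S.W β i j * a α j = - ∑ j, ∑ k, S.f i j k * (a α j * a β k) := by
      intro i α β
      simp only [hW, Finset.sum_mul, ← Finset.sum_neg_distrib]
      exact Finset.sum_congr rfl fun j _ => Finset.sum_congr rfl fun k _ => by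
        rw [hf i k j]; ring
    have h2 : ∀ i α β, ∑ j, S.W α i j * a β j = ∑ j, ∑ k, S.f i j k * (a α j * a β k) := by
      intro i α β
      simp only [hW, Finset.sum_mul]
      rw [Finset.sum_comm]
      exact Finset.sum_congr rfl fun j _ => Finset.sum_congr rfl fun k _ => by ring
    have h3 : ∀ i α k, ∑ j, S.f i j k * a α j = S.W α i k := by
      intro i α k
      rw [hW]
    rintro (l | i) (μ | j) (ν | k)
    · simp [gaugeM, prodCoeff, coeff, der, Matrix.one_apply, apply_ite]
    · simp [gaugeM, prodCoeff, coeff, der]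
    · simp [gaugeM, prodCoeff, coeff, der]
    · simp [gaugeM, prodCoeff, coeff, der]
    · simp [gaugeM, prodCoeff, coeff, der, Fintype.sum_sum_type, Matrix.one_apply,
        Finset.sum_add_distrib]
      rw [h1, h2, hF]
      simp only [mul_assoc]
      ring
    · simp [gaugeM, prodCoeff, coeff, der, Fintype.sum_sum_type, Matrix.one_apply, apply_ite, h3]
    · have h4 : ∑ k, S.f i j k * a ν k = - S.W ν i j := by
        rw [hW, ← Finset.sum_neg_distrib]
        exact Finset.sum_congr rfl fun k _ => by rw [hf i j k, neg_mul]
      have h5 : S.d ν (if i = j then 1 else 0) = 0 := by split_ifs <;> simp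
      simp [gaugeM, prodCoeff, coeff, der, Fintype.sum_sum_type, Matrix.one_apply, h4, h5,
        Finset.sum_add_distrib]
    · simp [gaugeM, prodCoeff, coeff, der, Fintype.sum_sum_type, Matrix.one_apply]

end KaluzaKlein

/-! ## The fuzzy sphere is not zero -/

section Representation

/-- Shift and multiplication operators on functions on `ℤ`. -/
def weightedShift (k : ℤ) (c : ℤ → ℂ) : Module.End ℂ (ℤ → ℂ) where
  toFun ψ m := c m * ψ (m + k)
  map_add' ψ φ := by ext m; simp [mul_add]
  map_smul' z ψ := by ext m; simp [mul_left_comm]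

theorem weightedShift_apply (k : ℤ) (c : ℤ → ℂ) (ψ : ℤ → ℂ) (m : ℤ) :
    weightedShift k c ψ m = c m * ψ (m + k) := rfl

/-- The generators of the fuzzy sphere in a representation on functions on `ℤ`. -/
def repY (lam : ℝ) : Fin 3 → Module.End ℂ (ℤ → ℂ) :=
  let Jp := weightedShift (-1) fun _ => 1
  let Jm := weightedShift 1 fun m => (1 - (lam : ℂ) ^ 2) / (4 * (lam : ℂ) ^ 2) - m ^ 2 - m
  ![(lam : ℂ) • (Jp + Jm), (-Complex.I * lam) • (Jp - Jm),
    (2 * (lam : ℂ)) • weightedShift 0 fun m => m]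

/-- The generators are 2λ times angular momentum operators, the third being multiplication by m.
With C = (1-λ²)/(4λ²), the weight C - m² - m gives the ladder operators the commutator 2m and total
Casimir C, and 4λ²C = 1-λ². Using functions on all of ℤ avoids any quantisation of λ. -/
theorem repY_rel {lam : ℝ} (h : lam ≠ 0) {a b : FreeAlgebra ℂ (Fin 3)} (hab : FuzzyRel lam a b) :
    FreeAlgebra.lift ℂ (repY lam) a = FreeAlgebra.lift ℂ (repY lam) b := by
  have hl : (lam : ℂ) ≠ 0 := Complex.ofReal_ne_zero.2 h
  have h0 : ∀ i j, eps i i j = 0 ∧ eps i j i = 0 ∧ eps j i i = 0 := by decide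
  have h1 : eps 0 1 2 = 1 ∧ eps 1 2 0 = 1 ∧ eps 2 0 1 = 1 ∧ eps 0 2 1 = -1 ∧ eps 2 1 0 = -1
    ∧ eps 1 0 2 = -1 := by decide
  have hI : Complex.I ^ 2 = -1 := Complex.I_sq
  cases hab with
  | comm i j =>
    refine LinearMap.ext fun ψ => funext fun m => ?_
    fin_cases i <;> fin_cases j <;>
      simp [repY, Fin.sum_univ_three, h0, h1, weightedShift_apply] <;> ring_nf <;>
      simp only [hI] <;> ring_nf
  | casimir =>
    refine LinearMap.ext fun ψ => funext fun m => ?_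
    rw [AlgHom.commutes, Module.algebraMap_end_apply]
    simp [repY, Fin.sum_univ_three, weightedShift_apply]
    ring_nf
    simp only [hI]
    field_simp
    ring_nf

/-- A representation of the fuzzy sphere. -/
def fuzzyRep {lam : ℝ} (h : lam ≠ 0) : FuzzySphere lam →ₐ[ℂ] Module.End ℂ (ℤ → ℂ) :=
  RingQuot.liftAlgHom ℂ ⟨FreeAlgebra.lift ℂ (repY lam), fun _ _ hab => repY_rel h hab⟩

theorem fuzzySphere_nontrivial {lam : ℝ} (h : lam ≠ 0) : Nontrivial (FuzzySphere lam) :=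
  (fuzzyRep h).toRingHom.domain_nontrivial

/-- Slicing the tensor product with such a functional turns identities in the product algebra into
identities between functions on spacetime. -/
theorem exists_fuzzy_functional {lam : ℝ} (h : lam ≠ 0) :
    ∃ φ : FuzzySphere lam →ₗ[ℂ] ℂ, φ 1 = 1 := by
  have := fuzzySphere_nontrivial h
  by_contra! hc
  have h1 : (1 : FuzzySphere lam) = 0 := by
    rw [← Module.forall_dual_apply_eq_zero_iff ℂ]
    intro φ
    by_contra hφ
    exact hc ((φ 1)⁻¹ • φ) (by simp [hφ])
  exact one_ne_zero h1

end Representation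

/-! ## The central subalgebra of functions on spacetime -/

section Central

variable {n : ℕ} {U : TopologicalSpace.Opens (E n)} {lam : ℝ}

/-- Functions on spacetime inside the product algebra. -/
def incl (U : TopologicalSpace.Opens (E n)) (lam : ℝ) : Smooth U →ₐ[ℂ] ProdAlg U lam :=
  (Algebra.TensorProduct.includeLeft : Smooth U →ₐ[ℂ] Smooth U ⊗[ℂ] FuzzySphere lam)

theorem incl_apply (f : Smooth U) : incl U lam f = ptmul f 1 := rfl

theorem incl_commute (f : Smooth U) (b : ProdAlg U lam) : Commute (incl U lam f) b := by
  refine prod_induction U lam b (Commute.zero_right _) (fun g q => ?_)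
    fun x y hx hy => hx.add_right hy
  rw [Commute, SemiconjBy, incl_apply, ptmul_mul, ptmul_mul, mul_comm, one_mul, mul_one]

/-- The coordinate derivations of `C^∞(U)`. -/
def dS (μ : Fin n) : Derivation ℂ (Smooth U) (Smooth U) :=
  Derivation.mk' (spd μ) fun f g => by
    rw [spd_mul, smul_eq_mul, smul_eq_mul]
    ring

theorem pd_incl (a : Idx n) (f : Smooth U) :
    (prodCalculus U lam).pd a (incl U lam f) = incl U lam (Sum.elim dS 0 a f) := by
  rcases a with μ | i
  · rfl
  · show ppd U lam (.inr i) (ptmul f 1) = _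
    have h : fpd lam i 1 = 0 := (fuzzyCalculus lam).pd_one i
    rw [ppd_inr, h]
    exact (TensorProduct.tmul_zero _ _).trans (map_zero _).symm

end Central

/-! ## Smooth functions representing real fields -/

section Rep

variable {n : ℕ} {U : TopologicalSpace.Opens (E n)}

/-- The smooth function `a` takes the values of the real function `f` on `U`. -/
def Rep (a : Smooth U) (f : E n → ℝ) : Prop := ∀ x : U, (a : U → ℂ) x = (f x : ℂ)

variable {a b : Smooth U} {f g : E n → ℝ}

theorem rep_ofReal (hf : ContDiffOn ℝ ∞ f U) : Rep (ofReal f hf) f := fun _ => rfl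

theorem Rep.ext (ha : Rep a f) (hb : Rep b g) (h : ∀ x ∈ U, f x = g x) : a = b := by
  ext x
  rw [ha x, hb x, h x x.2]

theorem Rep.congr (ha : Rep a f) (h : ∀ x ∈ U, f x = g x) : Rep a g := fun x => by
  rw [ha x, h x x.2]

theorem Rep.add (ha : Rep a f) (hb : Rep b g) : Rep (a + b) fun x => f x + g x := fun x => by
  simp [ha x, hb x]

theorem Rep.sub (ha : Rep a f) (hb : Rep b g) : Rep (a - b) fun x => f x - g x := fun x => by
  simp [ha x, hb x]

theorem Rep.neg (ha : Rep a f) : Rep (-a) fun x => - f x := fun x => by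
  simp [ha x]

theorem Rep.mul (ha : Rep a f) (hb : Rep b g) : Rep (a * b) fun x => f x * g x := fun x => by
  simp [ha x, hb x]

theorem rep_algebraMap (r : ℝ) : Rep (algebraMap ℂ (Smooth U) r) fun _ => r := fun _ => rfl

theorem rep_intCast (k : ℤ) : Rep (k : Smooth U) fun _ => (k : ℝ) := fun x => by
  simp

theorem rep_sum {J : Type} (s : Finset J) {a : J → Smooth U} {f : J → E n → ℝ}
    (h : ∀ j, Rep (a j) (f j)) : Rep (∑ j ∈ s, a j) fun x => ∑ j ∈ s, f j x := fun x => by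
  simp [h _ x]

/-- Near a point of U the real part of the smooth representative is f, so f is differentiable there
whatever its values outside U. -/
theorem Rep.dS (ha : Rep a f) (μ : Fin n) : Rep (dS μ a) (del μ f) := by
  intro x
  have h : ext0 (a : U → ℂ) =ᶠ[nhds (x : E n)] fun y => (f y : ℂ) :=
    ext0_eventuallyEq (F := fun y => (f y : ℂ)) ha x
  have hf : DifferentiableAt ℝ f x := by
    have h1 : (fun y => (ext0 (a : U → ℂ) y).re) =ᶠ[nhds (x : E n)] f := by
      filter_upwards [h] with y hy
      rw [hy, Complex.ofReal_re]
    exact (Complex.reCLM.differentiableAt.comp _ (smooth_differentiableAt a x)).congr_of_eventuallyEq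
      h1.symm
  have h2 : HasFDerivAt (fun y => (f y : ℂ)) (Complex.ofRealCLM.comp (fderiv ℝ f x)) x :=
    Complex.ofRealCLM.hasFDerivAt.comp _ hf.hasFDerivAt
  show del μ _ _ = _
  rw [del, h.fderiv_eq, h2.fderiv]
  rfl

theorem contDiffOn_det {k : Type} [Fintype k] [DecidableEq k] {M : E n → Matrix k k ℝ}
    (hM : ∀ i j, ContDiffOn ℝ ∞ (fun x => M x i j) U) : ContDiffOn ℝ ∞ (fun x => (M x).det) U := by
  simp only [Matrix.det_apply]
  refine ContDiffOn.sum fun σ _ => ContDiffOn.const_smul _ ?_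
  exact contDiffOn_prod fun i _ => hM _ _

theorem contDiffOn_inv {k : Type} [Fintype k] [DecidableEq k] {M : E n → Matrix k k ℝ}
    (hM : ∀ i j, ContDiffOn ℝ ∞ (fun x => M x i j) U) (hd : ∀ x ∈ U, (M x).det ≠ 0) (i j : k) :
    ContDiffOn ℝ ∞ (fun x => (M x)⁻¹ i j) U := by
  simp only [Matrix.inv_def, Ring.inverse_eq_inv', Matrix.smul_apply, smul_eq_mul,
    Matrix.adjugate_apply]
  refine ((contDiffOn_det hM).inv hd).mul (contDiffOn_det fun p q => ?_)
  simp only [Matrix.updateRow_apply]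
  split_ifs
  · exact contDiffOn_const
  · exact hM p q

/-- Evaluation at a point. -/
def evalAt (x : U) : Smooth U →+* ℂ := (Pi.evalRingHom (fun _ : U => ℂ) x).comp (Smooth U).val.toRingHom

theorem evalAt_apply (x : U) (a : Smooth U) : evalAt x a = (a : U → ℂ) x := rfl

/-- Flip braiding on `d x^μ ⊗ s^i` and `s^i ⊗ s^j` forces flip braiding throughout. -/
theorem flips_univ {lam : ℝ} {D : BimoduleConnection (prodCalculus U lam)}
    (h : FlipsOn (Set.range Sum.inr) D) : FlipsOn Set.univ D := by
  rintro a (ν | j) -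
  · have hx : ContDiffOn ℝ ∞ (fun x : E n => x ν) U :=
      (ContinuousLinearMap.proj (R := ℝ) (φ := fun _ : Fin n => ℝ) ν).contDiff.contDiffOn
    set X : ProdAlg U lam := incl U lam (ofReal (fun x => x ν) hx) with hX
    have hd : d0 (prodCalculus U lam) X = basis (.inl ν) := by
      ext b
      rw [d0, hX, pd_incl, basis_apply]
      rcases b with μ | i
      · have h1 : dS μ (ofReal (fun x => x ν) hx) = if μ = ν then 1 else 0 := by
          ext x
          refine ((rep_ofReal hx).dS μ x).trans ?_
          have h2 : HasFDerivAt (fun x : E n => x ν)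
              (ContinuousLinearMap.proj (R := ℝ) (φ := fun _ : Fin n => ℝ) ν) x :=
            (ContinuousLinearMap.proj (R := ℝ) (φ := fun _ : Fin n => ℝ) ν).hasFDerivAt
          rw [del, h2.fderiv, ContinuousLinearMap.proj_apply, Pi.single_apply]
          by_cases hμ : μ = ν
          · simp [hμ]
          · simp [hμ, Ne.symm hμ]
        rw [Sum.elim_inl, h1]
        by_cases hμ : μ = ν <;> simp [hμ]
      · simp
    -- The coordinate x^ν is central, so its left and right Leibniz rules expand the same element;
    -- comparing them leaves dx^ν ⊗ e^a = σ(e^a ⊗ dx^ν).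
    have hc : MulOpposite.op X • (basis a : T1 (Idx n) (ProdAlg U lam)) = X • basis a := by
      ext b
      exact (incl_commute _ _).eq.symm
    have hc2 : MulOpposite.op X • D.nabla (basis a) = X • D.nabla (basis a) := by
      ext b k
      exact (incl_commute _ _).eq.symm
    have h1 := D.leibniz_left X (basis a)
    have h2 := D.leibniz_right X (basis a)
    rw [hc, h1, hc2, hd] at h2
    exact (add_left_cancel h2).symm
  · exact h a _ ⟨j, rfl⟩

end Rep

/-! ## Non-degeneracy of the effective metric -/

namespace Fields

variable {n : ℕ} {U : TopologicalSpace.Opens (E n)} (F : Fields U)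

/-- The coefficients of the product metric. -/
def GA : Matrix (Idx n) (Idx n) (Smooth U) := Matrix.fromBlocks
  (Matrix.of fun μ ν => ofReal (fun x => F.g x μ ν) (F.g_smooth μ ν))
  (Matrix.of fun μ i => ofReal (fun x => F.A x μ i) (F.A_smooth μ i))
  (Matrix.of fun i μ => ofReal (fun x => F.A x μ i) (F.A_smooth μ i))
  (Matrix.of fun i j => ofReal (fun x => F.h x i j) (F.h_smooth i j))

theorem metric_eq (lam : ℝ) : F.metric lam = fun a b => incl U lam (F.GA a b) := by
  ext (μ | i) (ν | j) <;> rfl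

/-- The product metric at a point. -/
def Gx (x : E n) : Matrix (Idx n) (Idx n) ℝ :=
  Matrix.fromBlocks (F.g x) (F.A x) (F.A x).transpose (F.h x)

theorem evalAt_GA (x : U) (a b : Idx n) : evalAt x (F.GA a b) = (F.Gx x a b : ℂ) := by
  rcases a with μ | i <;> rcases b with ν | j <;> rfl

/-- Evaluating `ev_basis_mul` at x and slicing the fuzzy factor gives a complex left inverse of the
metric matrix at x. Its determinant is det h times that of g̃, the Schur complement of h. -/
theorem gt_det_ne_zero {lam : ℝ} (hlam : lam ≠ 0) {P : BimodulePairing (Idx n) (ProdAlg U lam)}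
    (hP : IsInverseMetric (F.metric lam) P) {x : E n} (hx : x ∈ U) : (F.gt x).det ≠ 0 := by
  obtain ⟨φ, hφ⟩ := exists_fuzzy_functional hlam
  let ψ : ProdAlg U lam →ₗ[ℂ] ℂ := LinearMap.mul' ℂ ℂ ∘ₗ
    TensorProduct.map ((LinearMap.proj (⟨x, hx⟩ : U)).comp (Smooth U).val.toLinearMap) φ
  have hψ : ∀ f q, ψ (ptmul f q) = evalAt ⟨x, hx⟩ f * φ q := fun f q => rfl
  -- The functional ψ need not be multiplicative, but it is linear over functions on spacetime, and
  -- the metric coefficients are such functions.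
  have hmul : ∀ b f, ψ (b * incl U lam f) = ψ b * evalAt ⟨x, hx⟩ f := by
    intro b f
    refine prod_induction U lam b ?_ (fun g q => ?_) fun b b' hb hb' => ?_
    · simp only [zero_mul, map_zero]
    · rw [incl_apply, ptmul_mul, hψ, hψ, map_mul, mul_one]
      ring
    · rw [add_mul, map_add, map_add, hb, hb', add_mul]
  have hone : ψ 1 = 1 := by
    have : (1 : ProdAlg U lam) = ptmul 1 1 := rfl
    rw [this, hψ, hφ, map_one, mul_one]
  rw [metric_eq] at hP
  have h1 : (Matrix.of fun a k => ψ (P.ev (tens (basis a) (basis k))))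
      * (F.Gx x).map Complex.ofRealHom = 1 := by
    ext a b
    have h2 := congrArg ψ (ev_basis_mul incl_commute hP a b)
    rw [map_sum] at h2
    simp only [hmul, evalAt_GA] at h2
    rw [Matrix.mul_apply, Matrix.one_apply]
    refine h2.trans ?_
    by_cases hab : a = b
    · simp [hab, hone]
    · simp [hab, Ne.symm hab]
  have h3 : (F.Gx x).det ≠ 0 := by
    intro h0
    have h4 := congrArg Matrix.det h1
    have h5 : ((F.Gx x).map Complex.ofRealHom).det = ((F.Gx x).det : ℂ) :=
      (RingHom.map_det Complex.ofRealHom (F.Gx x)).symm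
    rw [Matrix.det_mul, h5, h0, Matrix.det_one] at h4
    simp at h4
  have : Invertible (F.h x) := Matrix.invertibleOfIsUnitDet _ (F.h_det_pos hx).ne'.isUnit
  rw [Gx, Matrix.det_fromBlocks₂₂, Matrix.invOf_eq_nonsing_inv] at h3
  exact right_ne_zero_of_mul h3

end Fields

/-! ## The product metric as a Kaluza-Klein metric -/

theorem Rep.contDiffOn {n : ℕ} {U : TopologicalSpace.Opens (E n)} {a : Smooth U} {f : E n → ℝ}
    (ha : Rep a f) : ContDiffOn ℝ ∞ f U := by
  have h := Complex.reCLM.contDiff.comp_contDiffOn a.2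
  refine h.congr fun x hx => ?_
  have h1 := (ext0_coe (a : U → ℂ) ⟨x, hx⟩).trans (ha ⟨x, hx⟩)
  simp [h1]

theorem rep_mul {n : ℕ} {U : TopologicalSpace.Opens (E n)} {I J K : Type} [Fintype J]
    {X : Matrix I J (Smooth U)} {Y : Matrix J K (Smooth U)} {X' : E n → Matrix I J ℝ}
    {Y' : E n → Matrix J K ℝ} (hX : ∀ i j, Rep (X i j) fun x => X' x i j)
    (hY : ∀ i j, Rep (Y i j) fun x => Y' x i j) (i : I) (k : K) :
    Rep ((X * Y) i k) fun x => (X' x * Y' x) i k := by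
  simp only [Matrix.mul_apply]
  exact rep_sum _ fun j => (hX i j).mul (hY j k)

theorem rep_one {n : ℕ} {U : TopologicalSpace.Opens (E n)} {I : Type} [DecidableEq I] (i j : I) :
    Rep ((1 : Matrix I I (Smooth U)) i j) fun _ => (1 : Matrix I I ℝ) i j := by
  intro x
  by_cases h : i = j <;> simp [Matrix.one_apply, h]

namespace Fields

variable {n : ℕ} {U : TopologicalSpace.Opens (E n)} (F : Fields U)

/-- `g_{μν}` as smooth functions. -/
def g0A : Matrix (Fin n) (Fin n) (Smooth U) :=
  Matrix.of fun μ ν => ofReal (fun x => F.g x μ ν) (F.g_smooth μ ν)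

/-- `A_{μi}` as smooth functions. -/
def AA : Matrix (Fin n) (Fin 3) (Smooth U) :=
  Matrix.of fun μ i => ofReal (fun x => F.A x μ i) (F.A_smooth μ i)

/-- `h_{ij}` as smooth functions. -/
def hA : Matrix (Fin 3) (Fin 3) (Smooth U) :=
  Matrix.of fun i j => ofReal (fun x => F.h x i j) (F.h_smooth i j)

/-- `h^{ij}` as smooth functions. -/
def hiA : Matrix (Fin 3) (Fin 3) (Smooth U) :=
  Matrix.of fun i j => ofReal (fun x => (F.h x)⁻¹ i j)
    (contDiffOn_inv F.h_smooth (fun _ hx => (F.h_det_pos hx).ne') i j)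

/-- `Ã_{μi}` as smooth functions. -/
def atA : Matrix (Fin n) (Fin 3) (Smooth U) := F.AA * F.hiA

/-- `g̃_{μν}` as smooth functions. -/
def gA : Matrix (Fin n) (Fin n) (Smooth U) := F.g0A - F.AA * F.hiA * F.AA.transpose

theorem rep_g0A (μ ν : Fin n) : Rep (F.g0A μ ν) fun x => F.g x μ ν := fun _ => rfl

theorem rep_AA (μ : Fin n) (i : Fin 3) : Rep (F.AA μ i) fun x => F.A x μ i := fun _ => rfl

theorem rep_hA (i j : Fin 3) : Rep (F.hA i j) fun x => F.h x i j := fun _ => rfl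

theorem rep_hiA (i j : Fin 3) : Rep (F.hiA i j) fun x => (F.h x)⁻¹ i j := fun _ => rfl

theorem rep_gA (μ ν : Fin n) : Rep (F.gA μ ν) fun x => F.gt x μ ν :=
  (F.rep_g0A μ ν).sub (rep_mul (rep_mul F.rep_AA F.rep_hiA)
    (Y' := fun x => (F.A x).transpose) (fun i j => F.rep_AA j i) μ ν)

theorem h_inv_symm {x : E n} (hx : x ∈ U) : ((F.h x)⁻¹).IsSymm :=
  isSymm_of_mul_eq_one (F.h_symm hx) (F.h_inv_mul hx)

theorem rep_atA (α : Fin n) (i : Fin 3) : Rep (F.atA α i) fun x => F.At x α i :=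
  (rep_mul F.rep_AA F.rep_hiA α i).congr fun x hx => by
    simp only [Matrix.mul_apply, At]
    exact Finset.sum_congr rfl fun j _ => by rw [(F.h_inv_symm hx).apply i j, mul_comm]

theorem hA_symm : F.hA.IsSymm := by
  ext i j
  exact congrArg Subtype.val
    ((F.rep_hA j i).ext (F.rep_hA i j) fun x hx => (F.h_symm hx).apply i j) ▸ rfl

theorem hiA_mul : F.hiA * F.hA = 1 := by
  ext1 i j
  exact (rep_mul F.rep_hiA F.rep_hA i j).ext (rep_one i j) fun x hx => by rw [F.h_inv_mul hx]

theorem gA_symm : F.gA.IsSymm := by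
  have h0 : F.g0A.transpose = F.g0A := by
    ext1 i j
    exact (F.rep_g0A j i).ext (F.rep_g0A i j) fun x hx => (F.g_symm x hx).apply i j
  rw [Matrix.IsSymm, gA, Matrix.transpose_sub, Matrix.transpose_mul, Matrix.transpose_mul,
    Matrix.transpose_transpose, (isSymm_of_mul_eq_one F.hA_symm F.hiA_mul).eq, h0,
    Matrix.mul_assoc]

variable (hd : ∀ x ∈ U, (F.gt x).det ≠ 0)

/-- `g̃^{μν}` as smooth functions. -/
def giA : Matrix (Fin n) (Fin n) (Smooth U) :=
  Matrix.of fun i j => ofReal (fun x => F.gtInv x i j)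
    (contDiffOn_inv (fun i j => (F.rep_gA i j).contDiffOn) hd i j)

theorem rep_giA (μ ν : Fin n) : Rep (F.giA hd μ ν) fun x => F.gtInv x μ ν := fun _ => rfl

theorem giA_mul : F.giA hd * F.gA = 1 := by
  ext1 i j
  exact (rep_mul (F.rep_giA hd) F.rep_gA i j).ext (rep_one i j) fun x hx => by
    rw [gtInv, Matrix.nonsing_inv_mul _ (hd x hx).isUnit]

theorem half_add_half : 2 * algebraMap ℂ (Smooth U) ((1 / 2 : ℝ) : ℂ) = 1 := by
  have h : (2 : Smooth U) = algebraMap ℂ (Smooth U) 2 := (map_ofNat _ 2).symm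
  rw [h, ← map_mul]
  norm_num

/-- The product metric as a Kaluza-Klein metric. -/
def kk : KaluzaKlein (Fin n) (Fin 3) (Smooth U) where
  d := dS
  f i j k := - (eps i j k : Smooth U)
  g := F.gA
  gi := F.giA hd
  h := F.hA
  hi := F.hiA
  K := chrConn (algebraMap ℂ (Smooth U) ((1 / 2 : ℝ) : ℂ)) dS F.gA (F.giA hd)
  L := su2Conn (algebraMap ℂ (Smooth U) ((1 / 2 : ℝ) : ℂ)) F.hA F.hiA
  F i := Matrix.of fun α β => dS α (F.atA β i) - dS β (F.atA α i)
    + ∑ j, ∑ k, - (eps i j k : Smooth U) * F.atA α j * F.atA β k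
  W α := Matrix.of fun i j => ∑ k, - (eps i k j : Smooth U) * F.atA α k
  r := algebraMap ℂ (Smooth U) ((1 / 2 : ℝ) : ℂ)
  two_r := half_add_half
  g_symm := F.gA_symm
  gi_mul := F.giA_mul hd
  h_symm := F.hA_symm
  hi_mul := F.hiA_mul
  K_lc := chrConn_isLeviCivita half_add_half _ F.gA_symm (F.giA_mul hd)
  L_lc := su2Conn_isLeviCivita half_add_half F.hA_symm F.hiA_mul
  F_antisymm i := by
    ext1 α β
    simp only [Matrix.transpose_apply, Matrix.neg_apply, Matrix.of_apply]
    have h : ∑ j, ∑ k, - (eps i j k : Smooth U) * F.atA β j * F.atA α k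
        = - ∑ j, ∑ k, - (eps i j k : Smooth U) * F.atA α j * F.atA β k := by
      rw [Finset.sum_comm, ← Finset.sum_neg_distrib]
      refine Finset.sum_congr rfl fun j _ => ?_
      rw [← Finset.sum_neg_distrib]
      refine Finset.sum_congr rfl fun k _ => ?_
      rw [eps_swap_right i j k]
      push_cast
      ring
    rw [h]
    ring
  f_trace j := by
    have h := congrArg (Int.cast : ℤ → Smooth U) (eps_trace j)
    push_cast at h
    rw [Finset.sum_neg_distrib, h, neg_zero]

theorem kk_isFrameChange : IsFrameChange (F.kk hd).der (KaluzaKlein.prodCoeff (F.kk hd).f)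
    (F.kk hd).coeff (KaluzaKlein.gaugeM F.atA) (KaluzaKlein.gaugeN F.atA) :=
  (F.kk hd).isFrameChange (fun μ ν x => spd_comm μ ν x)
    (fun i j k => by simp only [kk]; rw [eps_swap_right]; push_cast; ring) (fun _ _ _ => rfl)
    fun _ _ _ => rfl

/-- Completing the square: Ã h = A and g̃ + Ã h Ãᵀ = g. -/
theorem kk_gauge_metric : (KaluzaKlein.gaugeM F.atA).transpose * (F.kk hd).metric
    * KaluzaKlein.gaugeM F.atA = F.GA := by
  have h1 : F.atA * F.hA = F.AA := by
    rw [atA, Matrix.mul_assoc, F.hiA_mul, Matrix.mul_one]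
  have h2 : F.hA * F.atA.transpose = F.AA.transpose := by
    rw [← h1, Matrix.transpose_mul, F.hA_symm.eq]
  rw [KaluzaKlein.gauge_metric]
  show Matrix.fromBlocks (F.gA + F.atA * F.hA * F.atA.transpose) (F.atA * F.hA)
    (F.hA * F.atA.transpose) F.hA = _
  rw [Matrix.mul_assoc, h2, h1, gA, atA, sub_add_cancel]
  rfl

/-- The coefficients of the quantum Levi-Civita connection of the product. -/
def prodConn : Idx n → Matrix (Idx n) (Idx n) (Smooth U) :=
  changeFrame (F.kk hd).der (KaluzaKlein.gaugeM F.atA) (KaluzaKlein.gaugeN F.atA) (F.kk hd).conn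

/-- The inverse of the product metric. -/
def GiA : Matrix (Idx n) (Idx n) (Smooth U) :=
  KaluzaKlein.gaugeN F.atA * (F.kk hd).metricInv * (KaluzaKlein.gaugeN F.atA).transpose

theorem prodCoeff_eq (lam : ℝ) : KaluzaKlein.prodCoeff (F.kk hd).f
    = fun l a b => algebraMap ℂ (Smooth U) ((prodCalculus U lam).c l a b) := by
  have h : ∀ i j k, - (eps i j k : Smooth U) = algebraMap ℂ (Smooth U) (fc i j k) := by
    intro i j k
    rw [fc, map_neg, map_intCast]
  ext1 l; ext1 a; ext1 b
  rcases l with l | l <;> rcases a with a | a <;> rcases b with b | b <;>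
    first
    | exact (map_zero (algebraMap ℂ (Smooth U))).symm
    | exact h l a b

theorem prodConn_isLeviCivita (lam : ℝ) : IsLeviCivita (F.kk hd).der
    (fun l a b => algebraMap ℂ (Smooth U) ((prodCalculus U lam).c l a b)) F.GA
    (F.prodConn hd) := by
  rw [← F.prodCoeff_eq hd, ← F.kk_gauge_metric hd]
  exact (F.kk hd).conn_isLeviCivita.changeFrame (F.kk_isFrameChange hd)

theorem GA_symm (hd : ∀ x ∈ U, (F.gt x).det ≠ 0) : F.GA.IsSymm := by
  have h : (F.kk hd).metric.transpose = (F.kk hd).metric := by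
    rw [KaluzaKlein.metric, Matrix.fromBlocks_transpose, (F.kk hd).g_symm.eq, (F.kk hd).h_symm.eq]
    simp
  rw [← F.kk_gauge_metric hd, Matrix.IsSymm, Matrix.transpose_mul, Matrix.transpose_mul,
    Matrix.transpose_transpose, h, mul_assoc]

theorem GA_mul_GiA : F.GA * F.GiA hd = 1 := by
  have h1 : KaluzaKlein.gaugeM F.atA * KaluzaKlein.gaugeN F.atA = 1 :=
    mul_eq_one_comm.1 (KaluzaKlein.gaugeN_mul F.atA)
  have h2 : (KaluzaKlein.gaugeM F.atA).transpose * (KaluzaKlein.gaugeN F.atA).transpose = 1 := by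
    rw [← Matrix.transpose_mul, KaluzaKlein.gaugeN_mul, Matrix.transpose_one]
  have h3 : (F.kk hd).metric * (F.kk hd).metricInv = 1 := by
    simp [KaluzaKlein.metric, KaluzaKlein.metricInv, Matrix.fromBlocks_multiply,
      KaluzaKlein.g_mul, KaluzaKlein.h_mul]
  rw [← F.kk_gauge_metric hd, GiA]
  simp only [mul_assoc]
  rw [← mul_assoc (KaluzaKlein.gaugeM F.atA), h1, one_mul, ← mul_assoc (F.kk hd).metric, h3,
    one_mul, h2]

end Fields

/-! ## The Ricci scalar of the product -/

namespace KaluzaKlein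

variable {m κ A : Type} [Fintype m] [DecidableEq m] [Fintype κ] [DecidableEq κ]
  [CommRing A] [Algebra ℂ A] (S : KaluzaKlein m κ A)

/-- A connection on 1-forms has minus the Christoffel symbols as coefficients. Rewriting in -K, and
using the symmetry of K in its lower indices, gives the classical expression. -/
theorem baseScalar_eq : S.baseScalar = ∑ α, ∑ β, S.gi α β *
    ((∑ μ, (- S.d μ (-S.K α μ β) + S.d α (-S.K μ μ β)))
      + ∑ μ, ∑ ν, ((-S.K α μ ν) * (-S.K μ ν β) - (-S.K μ μ ν) * (-S.K α ν β))) := by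
  refine Finset.sum_congr rfl fun α _ => Finset.sum_congr rfl fun β _ => congrArg _ ?_
  have hs : ∀ l μ, S.K l μ α = S.K α μ l := fun l μ =>
    sub_eq_zero.1 (S.K_lc.torsion μ l α)
  have h1 : ∑ l, ∑ μ, S.K l μ α * S.K μ l β = ∑ μ, ∑ ν, S.K α μ ν * S.K μ ν β := by
    rw [Finset.sum_comm]
    exact Finset.sum_congr rfl fun μ _ => Finset.sum_congr rfl fun l _ => by rw [hs]
  have h2 : ∑ μ, S.kt μ * S.K α μ β = ∑ μ, ∑ ν, S.K μ μ ν * S.K α ν β := by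
    rw [Finset.sum_comm]
    exact Finset.sum_congr rfl fun μ _ => Finset.sum_mul _ _ _
  have h3 : S.d α (S.kt β) = ∑ μ, S.d α (S.K μ μ β) := map_sum (S.d α) _ _
  rw [h1, h2, h3]
  simp only [map_neg, neg_neg, neg_mul, mul_neg, Finset.sum_add_distrib,
    Finset.sum_sub_distrib, Finset.sum_neg_distrib]
  ring

theorem laplacian_t_eq : ∑ α, ∑ β, S.gi α β * (S.d α (S.t β) + ∑ μ, S.K α μ β * S.t μ)
    = ∑ α, ∑ β, S.gi α β * (S.d α (S.t β) - ∑ μ, (-S.K α μ β) * S.t μ) := by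
  simp only [neg_mul, Finset.sum_neg_distrib, sub_neg_eq_add]

end KaluzaKlein

theorem add_sum_neg_mul {J A : Type} [Fintype J] [CommRing A] (z : A) (e : J → J → A)
    (x y : J → A) : z + ∑ j, ∑ k, - e j k * x j * y k = z - ∑ j, ∑ k, e j k * x j * y k := by
  simp only [neg_mul, Finset.sum_neg_distrib, sub_eq_add_neg]

theorem trace_eval {n : ℕ} {U : TopologicalSpace.Opens (E n)} (x : U)
    (M : Matrix (Fin 3) (Fin 3) (Smooth U)) :
    evalAt x M.trace = ((evalAt x).mapMatrix M).trace :=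
  AddMonoidHom.map_trace (evalAt x).toAddMonoidHom M

namespace Fields

variable {n : ℕ} {U : TopologicalSpace.Opens (E n)} (F : Fields U)
  (hd : ∀ x ∈ U, (F.gt x).det ≠ 0)

theorem rep_neg_K (σ μ ν : Fin n) : Rep (-(F.kk hd).K μ σ ν) (F.Gam σ μ ν) := by
  have h : -(F.kk hd).K μ σ ν = algebraMap ℂ (Smooth U) ((1 / 2 : ℝ) : ℂ) *
      ∑ ρ, F.giA hd σ ρ * (dS μ (F.gA ρ ν) + dS ν (F.gA ρ μ) - dS ρ (F.gA μ ν)) := neg_neg _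
  rw [h]
  exact (rep_algebraMap _).mul (rep_sum _ fun ρ => (F.rep_giA hd σ ρ).mul
    ((((F.rep_gA ρ ν).dS μ).add ((F.rep_gA ρ μ).dS ν)).sub ((F.rep_gA μ ν).dS ρ)))

theorem rep_baseScalar : Rep (F.kk hd).baseScalar fun x => 2 * F.RM x := by
  rw [KaluzaKlein.baseScalar_eq]
  have h := rep_sum Finset.univ fun α => rep_sum Finset.univ fun β => (F.rep_giA hd α β).mul
    ((rep_sum Finset.univ fun μ => ((F.rep_neg_K hd μ α β).dS μ).neg.add
      ((F.rep_neg_K hd μ μ β).dS α)).add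
    (rep_sum Finset.univ fun μ => rep_sum Finset.univ fun ν =>
      ((F.rep_neg_K hd μ α ν).mul (F.rep_neg_K hd ν μ β)).sub
        ((F.rep_neg_K hd μ μ ν).mul (F.rep_neg_K hd ν α β))))
  refine h.congr fun x _ => ?_
  rw [RM]
  ring

theorem rep_F (i : Fin 3) (α β : Fin n) : Rep ((F.kk hd).F i α β) (F.Ft i α β) := by
  have h : (F.kk hd).F i α β = dS α (F.atA β i) - dS β (F.atA α i)
      - ∑ j, ∑ k, (eps i j k : Smooth U) * F.atA α j * F.atA β k :=
    add_sum_neg_mul _ _ _ _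
  rw [h]
  exact (((F.rep_atA β i).dS α).sub ((F.rep_atA α i).dS β)).sub
    (rep_sum _ fun j => rep_sum _ fun k =>
      ((rep_intCast _).mul (F.rep_atA α j)).mul (F.rep_atA β k))

theorem rep_neg_Y : Rep (-(F.kk hd).Y) F.YM := by
  rw [KaluzaKlein.neg_Y_eq]
  exact rep_sum _ fun i => rep_sum _ fun j => rep_sum _ fun μ => rep_sum _ fun ν =>
    ((F.rep_hA i j).mul (F.rep_F hd i μ ν)).mul (rep_sum _ fun α => rep_sum _ fun β =>
      ((F.rep_giA hd μ α).mul (F.rep_giA hd ν β)).mul (F.rep_F hd j α β))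

theorem rep_W (α : Fin n) (i j : Fin 3) : Rep ((F.kk hd).W α i j) fun x => F.adA α x i j := by
  have he : ∀ i j k, - eps i k j = eps j k i := by decide
  have h : ∑ k, - (eps i k j : Smooth U) * F.atA α k = ∑ k, (eps j k i : Smooth U) * F.atA α k :=
    Finset.sum_congr rfl fun k _ => by rw [← he i j k, Int.cast_neg]
  have h' : (F.kk hd).W α i j = _ := h
  rw [h']
  exact rep_sum _ fun k => (rep_intCast _).mul (F.rep_atA α k)

theorem rep_H (α : Fin n) (i j : Fin 3) : Rep ((F.kk hd).H α i j) fun x => F.covH α x i j := by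
  have h1 := rep_mul F.rep_hA (F.rep_W hd α)
  exact ((((F.rep_hA i j).dS α).sub (h1 i j)).sub (h1 j i)).congr fun x hx => by
    rw [F.covH_eq hx]
    rfl

theorem rep_P (α : Fin n) (i j : Fin 3) : Rep ((F.kk hd).P α i j) fun x => F.PhiD α x i j :=
  rep_mul F.rep_hiA (F.rep_H hd α) i j

theorem rep_t (α : Fin n) : Rep ((F.kk hd).t α) fun x => (F.PhiD α x).trace :=
  rep_sum Finset.univ fun i => F.rep_P hd α i i

theorem rep_divTrPhi : Rep (∑ α, ∑ β, (F.kk hd).gi α β * ((F.kk hd).d α ((F.kk hd).t β)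
    + ∑ μ, (F.kk hd).K α μ β * (F.kk hd).t μ)) F.divTrPhi := by
  rw [KaluzaKlein.laplacian_t_eq]
  exact rep_sum _ fun α => rep_sum _ fun β => (F.rep_giA hd α β).mul
    (((F.rep_t hd β).dS α).sub (rep_sum _ fun μ => (F.rep_neg_K hd μ α β).mul (F.rep_t hd μ)))

theorem rep_sigmaModel : Rep (∑ α, ∑ β, (F.kk hd).gi α β * (((F.kk hd).P α * (F.kk hd).P β).trace
    + (F.kk hd).t α * (F.kk hd).t β)) F.sigmaModel :=
  rep_sum _ fun α => rep_sum _ fun β => (F.rep_giA hd α β).mul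
    ((rep_sum _ fun i => rep_mul (F.rep_P hd α) (F.rep_P hd β) i i).add
      ((F.rep_t hd α).mul (F.rep_t hd β)))

/-- `su2_fibreScalar` over `Smooth U`, evaluated at x, becomes the identity used for the single
fuzzy sphere, so the same R_h appears in both. -/
theorem half_fibreScalar (x : U) : 1 / 2 * evalAt x (F.kk hd).fibreScalar = (F.Rh x : ℂ) := by
  refine F.fibre_eq_Rh x.2 _ ?_
  have h0 := su2_fibreScalar half_add_half F.hA_symm F.hiA_mul
  have hf : (F.kk hd).fibreScalar = ∑ i, ∑ j, F.hiA i j * ∑ k, ∑ l,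
      su2Conn (algebraMap ℂ (Smooth U) ((1 / 2 : ℝ) : ℂ)) F.hA F.hiA k l i
        * su2Conn (algebraMap ℂ (Smooth U) ((1 / 2 : ℝ) : ℂ)) F.hA F.hiA l k j := by
    unfold KaluzaKlein.fibreScalar
    rfl
  rw [← hf] at h0
  have h := congrArg (evalAt x) h0
  have hm : (evalAt x).mapMatrix F.hA = F.hC x := rfl
  have hr : evalAt x (algebraMap ℂ (Smooth U) ((1 / 2 : ℝ) : ℂ)) = 1 / 2 := by
    rw [evalAt_apply, rep_algebraMap]
    norm_num
  rw [map_mul, map_sub, map_mul, map_pow, RingHom.map_det, trace_eval, trace_eval, map_mul, hm, hr] at h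
  exact h

/-- The coefficients come from r = 1/2 and the overall 1/2 of the lift: -r² Y becomes one eighth of
the Yang-Mills term, the quadratic terms in Φ also receive 1/8, and the divergence term receives
1/2. -/
theorem rep_scalarCurv (x : U) :
    (((1 / 2 : ℂ) • scalarCurv (F.kk hd).der (F.kk hd).coeff (F.kk hd).metricInv (F.kk hd).conn :
      Smooth U) : U → ℂ) x
      = ((F.RM x + F.Rh x + 1 / 8 * F.YM x + 1 / 2 * F.divTrPhi x
            + 1 / 8 * F.sigmaModel x : ℝ) : ℂ) := by
  have hr : evalAt x (F.kk hd).r = 1 / 2 := by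
    refine ((rep_algebraMap (U := U) (1 / 2)) x).trans ?_
    norm_num
  have hY := F.rep_neg_Y hd x
  have h1 := F.rep_baseScalar hd x
  have h2 := F.rep_divTrPhi hd x
  have h3 := F.rep_sigmaModel hd x
  have h4 := F.half_fibreScalar hd x
  rw [← evalAt_apply] at hY h1 h2 h3
  rw [map_neg] at hY
  show (1 / 2 : ℂ) * evalAt x _ = _
  rw [KaluzaKlein.scalarCurv_conn, map_add, map_add, map_sub, map_add, map_mul, map_mul, map_pow,
    hr, h1, h2, h3]
  push_cast
  rw [← h4, ← hY]
  ring

theorem scalarCurv_prodConn (lam : ℝ) :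
    scalarCurv (F.kk hd).der (fun l a b => algebraMap ℂ (Smooth U) ((prodCalculus U lam).c l a b))
      (F.GiA hd) (F.prodConn hd)
      = scalarCurv (F.kk hd).der (F.kk hd).coeff (F.kk hd).metricInv (F.kk hd).conn := by
  rw [← F.prodCoeff_eq hd]
  exact scalarCurv_changeFrame (F.kk_isFrameChange hd) _ _

end Fields

end FuzzyKK

open FuzzyKK in
theorem mainTheorem4 (n : ℕ) (U : TopologicalSpace.Opens (E n)) (lam : ℝ)
    (hlam0 : lam ≠ 0) (hlam1 : lam ^ 2 ≠ 1) (F : Fields U)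
    (P : BimodulePairing (Idx n) (ProdAlg U lam))
    (hP : IsInverseMetric (F.metric lam) P) :
    -- the product has a unique quantum Levi-Civita connection with flip braiding,
    -- and its Ricci scalar is as follows
    (∃ D : BimoduleConnection (prodCalculus U lam),
      (IsQLC (F.metric lam) D ∧ FlipsOn (Set.range Sum.inr) D) ∧
      (∀ D' : BimoduleConnection (prodCalculus U lam),
        IsQLC (F.metric lam) D' ∧ FlipsOn (Set.range Sum.inr) D' → D' = D) ∧
      ∃ R : Smooth U,
        ricciScalar D (F.metric lam) P = ptmul R 1 ∧
        ∀ x : U, (R : U → ℂ) x =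
          ((F.RM x + F.Rh x + 1 / 8 * F.YM x + 1 / 2 * F.divTrPhi x
            + 1 / 8 * F.sigmaModel x : ℝ) : ℂ)) ∧
    -- `Tr Φ_α = ∂_α Tr Φ`
    (∀ x ∈ U, ∀ α : Fin n, HasLineDerivAt ℝ (fun y => (F.Phi y).trace) (F.PhiD α x).trace x
      (Pi.single α 1)) ∧
    -- `R_h` is the Ricci scalar of the fuzzy sphere with metric `h_{ij} s^i ⊗ s^j`
    (∀ x ∈ U, ∃ Q : BimodulePairing (Fin 3) (FuzzySphere lam),
      IsInverseMetric (F.fuzzyMetric lam x) Q ∧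
      ∃ D : BimoduleConnection (fuzzyCalculus lam),
        (IsQLC (F.fuzzyMetric lam x) D ∧ FlipsOn Set.univ D) ∧
        (∀ D' : BimoduleConnection (fuzzyCalculus lam),
          IsQLC (F.fuzzyMetric lam x) D' ∧ FlipsOn Set.univ D' → D' = D) ∧
        ricciScalar D (F.fuzzyMetric lam x) Q
          = algebraMap ℂ (FuzzySphere lam) ((F.Rh x : ℝ) : ℂ)) := by
  -- Non-degeneracy of g̃ is not assumed; it follows from the existence of P and makes the inverse
  -- of g̃ smooth.
  have hd : ∀ x ∈ U, (F.gt x).det ≠ 0 := fun x hx => F.gt_det_ne_zero hlam0 hP hx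
  refine ⟨?_, fun x hx α => F.hasLineDerivAt_trace_Phi hx α, fun x hx =>
    F.fuzzy_ricciScalar lam hx⟩
  have hG := F.GA_symm hd
  have hGi := F.GA_mul_GiA hd
  have hδ : ∀ a f, (prodCalculus U lam).pd a (incl U lam f) = incl U lam ((F.kk hd).der a f) := by
    intro a f
    rw [pd_incl]
    rcases a with a | a <;> rfl
  have hQ := connOf_isQLC incl_commute hδ (F.prodConn_isLeviCivita hd lam)
  rw [F.metric_eq] at hP ⊢
  refine ⟨connOf (prodCalculus U lam) (incl U lam) incl_commute (F.prodConn hd),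
    ⟨hQ, connOf_flips _ _ _⟩, fun D' hD' => ?_, _, ricciScalar_connOf incl_commute hδ hP hG hGi _, ?_⟩
  -- Uniqueness is available for the full flip, so the prescribed partial braiding is first extended
  -- to all basic forms.
  · exact isQLC_unique hG (mul_eq_one_comm.1 hGi) hD'.1 hQ (flips_univ hD'.2) (connOf_flips _ _ _)
  · intro x
    rw [F.scalarCurv_prodConn hd]
    exact F.rep_scalarCurv hd x
end
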